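/- Setting. Let $d\ge 1$ and let $X_1,X_2,\dots\in\mathbb R^d$ be nonstochastic design points. There are countably many conditional moment inequalities $f_m\le 0$, $m\in\mathbb N$. A model $w=(f^w,\varepsilon^w)$ consists of functions $f_m:\mathbb R^d\to\mathbb R$ ($m\in\mathbb N$) and the laws of independent disturbances $\varepsilon_i=(\varepsilon_{i,m})_{m\in\mathbb N}$; one observes $Y_{i,m}=f_m(X_i)+\varepsilon_{i,m}$, $i\le n$. Put $\Sigma_{i,m_1m_2}=E[\varepsilon_{i,m_1}\varepsilon_{i,m_2}]$. Class of models. Fix constants $C_M,\delta,C_{\rm Lip},c_V,L,C_D>0$, $\tau\ge 1/4$, and let $[\tau]$ be the largest integer strictly smaller than $\tau$; let $\varsigma=0$ if $\tau\le1$ and $\varsigma\in\{1,\dots,[\tau]\}$ if $\tau>1$. $\mathcal G$ is the set of models such that for all indices: $E\varepsilon_{i,m}=0$; $E|\varepsilon_{i,m}|^{4+\delta}\le C_M$; $\Sigma_{i,mm}\ge c_V$; $|\Sigma_{i,m_1m_2}-\Sigma_{j,m_1m_2}|\le C_{\rm Lip}\|X_i-X_j\|$, and likewise for the fourth mixed moments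 $E[\varepsilon_{i,m_1}\varepsilon_{i,m_2}\varepsilon_{i,m_3}\varepsilon_{i,m_4}]$; each $f_m$ belongs to $\mathcal F_\varsigma(\tau,L)$; and if $\varsigma<[\tau]$, all partial derivatives of $f_m$ of order $\varsigma+1$ are bounded by $C_D$. Here $\mathcal F(\tau,L)$ is the set of $C^{[\tau]}$ functions $g$ on $\mathbb R^d$ with $|D^\alpha g(x)-D^\alpha g(y)|\le L\|x-y\|^{\tau-[\tau]}$ for all $|\alpha|=[\tau]$; $\mathcal F_\varsigma(\tau,L)=\mathcal F(\tau,L)$ if $\tau\le 1$, and otherwise it consists of those $g\in\mathcal F(\tau,L)$ for which, for all unit vectors $l$ and all $x$, the directional derivatives satisfy $g^{(k,l)}(x)=0$ for $k=1,\dots,\varsigma$ whenever $g^{(1,l)}(x)=0$, and for which $g^{(1,l)}(x)=0$, $g^{(\varsigma+1,l)}(x)\ne0$ (in particular, it exists) for some $x$ and some unit vector $l$. Let $\mathcal G_0=\{w\in\mathcal G: f_m(X_i)\le 0\ \forall i,m\in\mathbb N\}$ and, for $\rho>0$, $\mathcal G_\rho=\{w\in\mathcal G:\sup_{i,m\in\mathbb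 N}[f_m(X_i)]_+\ge\rho\}$. Design. Let $\bar C>0$, $a\in(0,1)$, $h_{\min}=h_{\min,n}=\bar C a^{k_n}\to0$ with $k_n\in\mathbb N$, $H_n=\{\bar C a^k:0\le k\le k_n\}$, and $|H_n|\le C\log n$ for large $n$. Assume $\|X_i\|<\bar C$ and that for some $0<C_1<C_2$ and all large $n$, with $M_h(X_i)$ the number of $j\le n$ with $\|X_j-X_i\|\le h$: $C_1nh^d\le M_h(X_i)\le C_2nh^d$ for all $h\in H_n$ and all $i\in\mathbb N$, and $M_{h_{\min}/2}(X_i)\ge C_1n(h_{\min}/2)^d$ for $i\le n$. The kernel $K:\mathbb R^d\to[0,1]$ vanishes outside the closed unit ball and is bounded below by a constant in $(0,1)$ on $\{\|x\|\le1/2\}$. For $h\in H_n$, $I_h\subset\{1,\dots,n\}$ is a nonstochastic set with $\|X_i-X_j\|>2h$ for distinct $i,j\in I_h$, such that each $X_i$, $i\le n$, is within $2h$ of some $X_j$, $j\in I_h$. Test. At sample size $n$ a finite set $\mathcal M_n\subset\mathbb N$ of $K_n$ inequalities is used, and each $m\in\mathbb N$ lies in $\mathcal M_n$ for all large $n$ (so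 $K_n\to\infty$). Let $w_h(X_i,X_j)=K((X_i-X_j)/h)/\sum_{k\le n}K((X_i-X_k)/h)$, $S_n=\{(i,m,h):h\in H_n,i\in I_h,m\in\mathcal M_n\}$, $\hat f_{i,m,h}=\sum_jw_h(X_i,X_j)Y_{j,m}$, $\hat V^2_{i,m,h}=\sum_jw_h^2(X_i,X_j)\hat\Sigma_{j,mm}$, $\hat T=\max_{s\in S_n}\hat f_s/\hat V_s$, where $\hat\Sigma_i$ are (measurable, positive semidefinite) $K_n\times K_n$ estimators of $(\Sigma_{i,m_1m_2})_{m_1,m_2\in\mathcal M_n}$. Let $g_0:\mathbb R\to[0,1]$ be a nonincreasing $C^2$ function (for instance a thrice differentiable one) with $g_0=1$ on $(-\infty,0]$ and $g_0=0$ on $[1,\infty)$, and let $\beta_n>0$. For $A\subset S_n$ and $q\in(0,1)$ let $c_q(A)$ be the (least) solution $c$ of $E[g_0((T_A-c)/\beta_n)\mid Y]=q$, where $T_A=\max_{(i,m,h)\in A}\sum_jw_h(X_i,X_j)\tilde Y_{j,m}/\hat V_{i,m,h}$ and, conditionally on the sample, $\tilde Y_j\sim N(0,\hat\Sigma_j)$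 are independent. Let $0<\alpha<1$, $0<\gamma_n\le\bar\gamma<\alpha/2$, $c^{PIA}_q=c_q(S_n)$, $S^{RMS}=\{s\in S_n:\hat f_s/\hat V_s>-2(c^{PIA}_{1-\gamma_n}+\beta_n)\}$. The test accepts with probability $g^P_{1-\alpha}(\hat T)$, where $g^{PIA}_{1-\alpha}(x)=g_0((x-c^{PIA}_{1-\alpha})/\beta_n)$ and $g^{RMS}_{1-\alpha}(x)=g_0((x-c_{1-\alpha+2\gamma_n}(S^{RMS}))/\beta_n)$, the latter being $1$ if $S^{RMS}=\emptyset$. Statement. Let $\kappa>0$ and suppose that, as $n\to\infty$, $K_n\log n/n^{\kappa/4}\to0$, $\beta_n\le C$, and $K_n^6(\log n)^4/(\beta_n^{10}h_{\min}^{3d}n)\to0$. (a) If $\max_{i\le n}\|\hat\Sigma_i-\Sigma_i\|_o=o_p(n^{-\kappa})$ uniformly over $\mathcal G_0$ (spectral norm), then for $P=PIA$ and $P=RMS$ $$\inf_{w\in\mathcal G_0}E_w[g^P_{1-\alpha}(\hat T)]\ge 1-\alpha+o(1).$$ (b) If $\rho>0$, $w\in\mathcal G_\rho$, and $\max_{i\le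 n}\|\hat\Sigma_i-\Sigma_i\|_o=o_p(n^{-\kappa})$ under $w$, then for $P=PIA$ and $P=RMS$, $E_w[g^P_{1-\alpha}(\hat T)]\to0$. -/

import Mathlib

open MeasureTheory ProbabilityTheory Filter Topology

noncomputable section

namespace CMI

/-! ### Smoothness classes -/

/-- `[τ]`: the largest integer strictly smaller than `τ` (for `τ > 0`). -/
def holderFloor (τ : ℝ) : ℕ := ⌈τ⌉₊ - 1

/-- The partial derivative of order `k` of `g` at `x` in the coordinate directions
`idx 0, …, idx (k-1)`.  Every `D^α g` with `|α| = k` is of this form. -/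
def partialDeriv {d : ℕ} (k : ℕ) (g : EuclideanSpace ℝ (Fin d) → ℝ) (idx : Fin k → Fin d)
    (x : EuclideanSpace ℝ (Fin d)) : ℝ :=
  iteratedFDeriv ℝ k g x (fun j => EuclideanSpace.single (idx j) (1 : ℝ))

/-- The `k`-th derivative of `g` at `x` in the direction `l`. -/
def dirDeriv {d : ℕ} (k : ℕ) (g : EuclideanSpace ℝ (Fin d) → ℝ)
    (l x : EuclideanSpace ℝ (Fin d)) : ℝ :=
  iteratedDeriv k (fun t : ℝ => g (x + t • l)) 0

/-- The Hölder class `𝓕(τ, L)` on `ℝ^d`. -/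
def Holder {d : ℕ} (τ L : ℝ) (g : EuclideanSpace ℝ (Fin d) → ℝ) : Prop :=
  ContDiff ℝ (holderFloor τ) g ∧
  ∀ (idx : Fin (holderFloor τ) → Fin d) (x y : EuclideanSpace ℝ (Fin d)),
    |partialDeriv (holderFloor τ) g idx x - partialDeriv (holderFloor τ) g idx y|
      ≤ L * ‖x - y‖ ^ (τ - holderFloor τ)

/-- The class `𝓕_ς(τ, L)`; it is `𝓕(τ, L)` when `τ ≤ 1`.  (When a derivative of order `ς + 1`
does not exist, `dirDeriv` is `0`, so the last clause asserts existence as well.) -/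
def HolderFlat {d : ℕ} (ς : ℕ) (τ L : ℝ) (g : EuclideanSpace ℝ (Fin d) → ℝ) : Prop :=
  Holder τ L g ∧
  (1 < τ →
    (∀ l x : EuclideanSpace ℝ (Fin d), ‖l‖ = 1 → dirDeriv 1 g l x = 0 →
      ∀ k : ℕ, 1 ≤ k → k ≤ ς → dirDeriv k g l x = 0) ∧
    ∃ l x : EuclideanSpace ℝ (Fin d), ‖l‖ = 1 ∧ dirDeriv (ς + 1) g l x ≠ 0 ∧ dirDeriv 1 g l x = 0)

/-! ### Models -/

/-- A model: the countably many regression functions `f_m`, and the laws of the disturbances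
`ε_i = (ε_{i,m})_m`, which are independent across `i` (see `Model.sampleLaw`). -/
structure Model (d : ℕ) where
  f : ℕ → EuclideanSpace ℝ (Fin d) → ℝ
  law : ℕ → Measure (ℕ → ℝ)
  isProb : ∀ i, IsProbabilityMeasure (law i)

attribute [instance] Model.isProb

/-- `Σ_{i, m₁ m₂} = E[ε_{i,m₁} ε_{i,m₂}]`. -/
def Model.cov {d : ℕ} (w : Model d) (i m₁ m₂ : ℕ) : ℝ :=
  ∫ e, e m₁ * e m₂ ∂(w.law i)

/-- `E[ε_{i,m₁} ε_{i,m₂} ε_{i,m₃} ε_{i,m₄}]`. -/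
def Model.mom4 {d : ℕ} (w : Model d) (i m₁ m₂ m₃ m₄ : ℕ) : ℝ :=
  ∫ e, e m₁ * e m₂ * e m₃ * e m₄ ∂(w.law i)

/-- The joint law of the responses `Y_{i,m} = f_m(X_i) + ε_{i,m}`, `i < n`, `m ∈ ℕ`. -/
def Model.sampleLaw {d : ℕ} (w : Model d) (X : ℕ → EuclideanSpace ℝ (Fin d)) (n : ℕ) :
    Measure (Fin n → ℕ → ℝ) :=
  (Measure.pi (fun i : Fin n => w.law i)).map (fun e i m => w.f m (X i) + e i m)

/-- The fixed constants that determine the class of models. -/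
structure ClassConst where
  /-- bound on the absolute moments of order `4 + δ` -/
  Cmom : ℝ
  δ : ℝ
  /-- Lipschitz constant of second and fourth moments -/
  Clip : ℝ
  /-- lower bound on variances -/
  Cvar : ℝ
  /-- Hölder smoothness and constant -/
  τ : ℝ
  L : ℝ
  ς : ℕ
  /-- bound on the derivatives of order `ς + 1` -/
  Cder : ℝ

/-- The ranges of the constants. -/
def ClassConst.Admissible (c : ClassConst) : Prop :=
  0 < c.Cmom ∧ 0 < c.δ ∧ 0 < c.Clip ∧ 0 < c.Cvar ∧ 1 / 4 ≤ c.τ ∧ 0 < c.L ∧ 0 < c.Cder ∧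
  c.ς ≤ holderFloor c.τ ∧ (1 < c.τ → 1 ≤ c.ς)

/-- Assumption on the disturbances. -/
def DisturbanceCond {d : ℕ} (c : ClassConst) (X : ℕ → EuclideanSpace ℝ (Fin d))
    (w : Model d) : Prop :=
  (∀ i m, ∫⁻ e, ENNReal.ofReal (|e m| ^ (4 + c.δ)) ∂(w.law i) ≤ ENNReal.ofReal c.Cmom) ∧
  (∀ i m, ∫ e, e m ∂(w.law i) = 0) ∧
  (∀ i j m₁ m₂, |w.cov i m₁ m₂ - w.cov j m₁ m₂| ≤ c.Clip * ‖X i - X j‖) ∧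
  (∀ i j m₁ m₂ m₃ m₄,
    |w.mom4 i m₁ m₂ m₃ m₄ - w.mom4 j m₁ m₂ m₃ m₄| ≤ c.Clip * ‖X i - X j‖) ∧
  (∀ i m, c.Cvar ≤ w.cov i m m)

/-- Assumption on the regression functions. -/
def RegressionCond {d : ℕ} (c : ClassConst) (w : Model d) : Prop :=
  (∀ m, HolderFlat c.ς c.τ c.L (w.f m)) ∧
  (c.ς < holderFloor c.τ → ∀ m (idx : Fin (c.ς + 1) → Fin d) x,
    |partialDeriv (c.ς + 1) (w.f m) idx x| ≤ c.Cder)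

/-- The class `𝓖` of models. -/
def modelClass {d : ℕ} (c : ClassConst) (X : ℕ → EuclideanSpace ℝ (Fin d)) : Set (Model d) :=
  {w | DisturbanceCond c X w ∧ RegressionCond c w}

/-- The subclass `𝓖₀`: all conditional moment inequalities hold at all design points. -/
def nullClass {d : ℕ} (c : ClassConst) (X : ℕ → EuclideanSpace ℝ (Fin d)) : Set (Model d) :=
  {w | w ∈ modelClass c X ∧ ∀ i m, w.f m (X i) ≤ 0}

/-- The distance `ρ(w, H₀) = sup_{i,m} [f_m(X_i)]₊`, possibly infinite. -/
def rho {d : ℕ} (X : ℕ → EuclideanSpace ℝ (Fin d)) (w : Model d) : ENNReal :=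
  ⨆ (i : ℕ) (m : ℕ), ENNReal.ofReal (w.f m (X i))

/-- The subclass `𝓖_ρ`: models at distance at least `ρ` from the null hypothesis. -/
def altClass {d : ℕ} (c : ClassConst) (X : ℕ → EuclideanSpace ℝ (Fin d)) (ρ : ℝ) :
    Set (Model d) :=
  {w | w ∈ modelClass c X ∧ ENNReal.ofReal ρ ≤ rho X w}

/-! ### The test -/

/-- Everything the econometrician uses, besides the responses. Observations are numbered from
`0`; the sample of size `n` consists of the observations `i < n`. -/
structure Design (d : ℕ) where
  /-- design points -/
  X : ℕ → EuclideanSpace ℝ (Fin d)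
  /-- kernel -/
  ker : EuclideanSpace ℝ (Fin d) → ℝ
  /-- largest bandwidth value, and the ratio of consecutive ones -/
  hmax : ℝ
  a : ℝ
  /-- the bandwidth values in use are `hmax * a ^ k`, `k ≤ depth n` -/
  depth : ℕ → ℕ
  /-- `pts n k`: the test points for the bandwidth value `hmax * a ^ k` -/
  pts : (n : ℕ) → ℕ → Finset (Fin n)
  /-- the inequalities that are used at sample size `n` -/
  ineq : ℕ → Finset ℕ
  /-- the function that generates the test functions -/
  g0 : ℝ → ℝ
  /-- width of the randomization -/
  β : ℕ → ℝ
  /-- level of the pretest in the refined moment selection -/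
  γ : ℕ → ℝ
  /-- the estimators `Σ̂_i`, functions of the sample -/
  sigmaHat : (n : ℕ) → (Fin n → ℕ → ℝ) → Fin n → Matrix (ineq n) (ineq n) ℝ

/-- The two critical values: plug-in asymptotics and refined moment selection. -/
inductive Method
  | PIA
  | RMS

/-- Maximum of `r` over a finite set (`0` for the empty set). -/
def maxOver {ι : Type} (A : Finset ι) (r : ι → ℝ) : ℝ :=
  open Classical in if h : A.Nonempty then A.sup' h r else 0

namespace Design

variable {d : ℕ} (D : Design d)

/-- The bandwidth value `hmax * a ^ k`. -/
def bw (k : ℕ) : ℝ := D.hmax * D.a ^ k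

/-- The minimal bandwidth value `h_min` at sample size `n`. -/
def hmin (n : ℕ) : ℝ := D.bw (D.depth n)

/-- The number `K_n` of inequalities used at sample size `n`. -/
def numIneq (n : ℕ) : ℕ := (D.ineq n).card

/-- `M_h(X_i)`: the number of observations `j < n` with `‖X_j - X_i‖ ≤ h`. -/
def count (n : ℕ) (h : ℝ) (i : ℕ) : ℕ :=
  open Classical in (Finset.univ.filter (fun j : Fin n => ‖D.X j - D.X i‖ ≤ h)).card

/-- `K_h(x) = K(x / h) / h^d`. -/
def kerScaled (h : ℝ) (x : EuclideanSpace ℝ (Fin d)) : ℝ := D.ker (h⁻¹ • x) / h ^ d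

/-- The weight `w_h(X_i, X_j)`. -/
def weight (n : ℕ) (h : ℝ) (i j : Fin n) : ℝ :=
  D.kerScaled h (D.X i - D.X j) / ∑ k : Fin n, D.kerScaled h (D.X i - D.X k)

/-- Triples (test point, inequality, exponent of the bandwidth value). -/
abbrev Idx (n : ℕ) : Type := Fin n × (D.ineq n) × ℕ

/-- The index set `S_n` of the test statistic. -/
def S (n : ℕ) : Finset (D.Idx n) :=
  (Finset.univ ×ˢ Finset.univ ×ˢ Finset.range (D.depth n + 1)).filter
    (fun s => s.1 ∈ D.pts n s.2.2)

/-- Kernel smoother `∑_j w_h(X_i, X_j) u_{j,m}` at `s = (i, m, h)`. -/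
def smooth (n : ℕ) (u : Fin n → D.ineq n → ℝ) (s : D.Idx n) : ℝ :=
  ∑ j : Fin n, D.weight n (D.bw s.2.2) s.1 j * u j s.2.1

/-- The kernel estimator `f̂_s`. -/
def fHat (n : ℕ) (y : Fin n → ℕ → ℝ) (s : D.Idx n) : ℝ :=
  D.smooth n (fun j m => y j m) s

/-- The estimated standard deviation `V̂_s`. -/
def vHat (n : ℕ) (y : Fin n → ℕ → ℝ) (s : D.Idx n) : ℝ :=
  Real.sqrt (∑ j : Fin n, D.weight n (D.bw s.2.2) s.1 j ^ 2 * D.sigmaHat n y j s.2.1 s.2.1)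

/-- The test statistic `T̂`. -/
def tHat (n : ℕ) (y : Fin n → ℕ → ℝ) : ℝ :=
  maxOver (D.S n) (fun s => D.fHat n y s / D.vHat n y s)

/-- The conditional law, given the sample, of the simulated responses: `Ỹ_j ∼ N(0, Σ̂_j)`,
independently across `j`. -/
def bootLaw (n : ℕ) (y : Fin n → ℕ → ℝ) :
    Measure (Fin n → EuclideanSpace ℝ (D.ineq n)) :=
  Measure.pi (fun j => multivariateGaussian 0 (D.sigmaHat n y j))

/-- The simulated statistic with the maximum taken over `A`. -/
def tBoot (n : ℕ) (y : Fin n → ℕ → ℝ) (A : Finset (D.Idx n))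
    (u : Fin n → EuclideanSpace ℝ (D.ineq n)) : ℝ :=
  maxOver A (fun s => D.smooth n (fun j m => u j m) s / D.vHat n y s)

/-- The critical value of level `q`: the (least) solution `c` of
`E[g₀((T - c) / β_n) | sample] = q`, where `T` is the simulated statistic over `A`. -/
def crit (n : ℕ) (y : Fin n → ℕ → ℝ) (A : Finset (D.Idx n)) (q : ℝ) : ℝ :=
  sInf {c : ℝ | ∫ u, D.g0 ((D.tBoot n y A u - c) / D.β n) ∂(D.bootLaw n y) = q}

/-- The plug-in critical value `c^{PIA}_{q}`. -/
def critPIA (n : ℕ) (y : Fin n → ℕ → ℝ) (q : ℝ) : ℝ := D.crit n y (D.S n) q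

/-- The selected set `S^{RMS}`. -/
def SRMS (n : ℕ) (y : Fin n → ℕ → ℝ) : Finset (D.Idx n) :=
  open Classical in (D.S n).filter (fun s =>
    D.fHat n y s / D.vHat n y s > -2 * (D.critPIA n y (1 - D.γ n) + D.β n))

/-- The value `g^P_{1-α}(T̂)`: the conditional probability, given the sample, with which the
randomized test of nominal size `α` accepts the null hypothesis. With the refined moment
selection the null hypothesis is accepted if no index is selected. -/
def accept (α : ℝ) (n : ℕ) (y : Fin n → ℕ → ℝ) : Method → ℝ
  | .PIA => D.g0 ((D.tHat n y - D.critPIA n y (1 - α)) / D.β n)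
  | .RMS => open Classical in
      if (D.SRMS n y).Nonempty then
        D.g0 ((D.tHat n y - D.crit n y (D.SRMS n y) (1 - α + 2 * D.γ n)) / D.β n)
      else 1

/-- `E_w[g^P_{1-α}(T̂)]` at sample size `n`. -/
def acceptProb (α : ℝ) (P : Method) (n : ℕ) (w : Model d) : ℝ :=
  ∫ y, D.accept α n y P ∂(w.sampleLaw D.X n)

/-! ### Assumptions on the design -/

/-- Bounded design points with regular local counts, at all bandwidth values in use; the lower
bound is also required at the radius `h_min / 2` around the points of the sample. -/
def DesignPointsCond : Prop :=
  (∀ i, ‖D.X i‖ < D.hmax) ∧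
  ∃ C₁ C₂ : ℝ, 0 < C₁ ∧ C₁ < C₂ ∧ ∀ᶠ n : ℕ in atTop, ∀ i : ℕ,
    (∀ k ≤ D.depth n, C₁ * n * D.bw k ^ d ≤ D.count n (D.bw k) i ∧
      (D.count n (D.bw k) i : ℝ) ≤ C₂ * n * D.bw k ^ d) ∧
    (i < n → C₁ * n * (D.hmin n / 2) ^ d ≤ D.count n (D.hmin n / 2) i)

/-- The set of bandwidth values. -/
def BandwidthCond : Prop :=
  0 < D.hmax ∧ 0 < D.a ∧ D.a < 1 ∧ Tendsto D.hmin atTop (𝓝 0) ∧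
  ∃ C : ℝ, 0 < C ∧ ∀ᶠ n : ℕ in atTop, (D.depth n + 1 : ℝ) ≤ C * Real.log n

/-- The kernel. -/
def KernelCond : Prop :=
  (∀ x, 0 ≤ D.ker x) ∧ (∀ x, 1 < ‖x‖ → D.ker x = 0) ∧ (∀ x, D.ker x ≤ 1) ∧
  ∃ C : ℝ, 0 < C ∧ C < 1 ∧ ∀ x, ‖x‖ ≤ 1 / 2 → C ≤ D.ker x

/-- The test points. -/
def TestPointsCond : Prop :=
  ∀ n, ∀ k ≤ D.depth n,
    (∀ i ∈ D.pts n k, ∀ j ∈ D.pts n k, i ≠ j → 2 * D.bw k < ‖D.X i - D.X j‖) ∧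
    ∀ i : Fin n, ∃ j ∈ D.pts n k, ‖D.X i - D.X j‖ ≤ 2 * D.bw k

/-- The function `g₀`. (A thrice differentiable function is of class `C²`.) -/
def TestFunctionCond : Prop :=
  ContDiff ℝ 2 D.g0 ∧ Antitone D.g0 ∧ (∀ x ≤ 0, D.g0 x = 1) ∧ (∀ x, 1 ≤ x → D.g0 x = 0)

/-- The estimators are measurable functions of the sample, and are covariance matrices. -/
def EstimatorCond : Prop :=
  (∀ n i m₁ m₂, Measurable (fun y => D.sigmaHat n y i m₁ m₂)) ∧
  ∀ n y i, (D.sigmaHat n y i).PosSemidef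

/-- The matrix `Σ_i` of the inequalities used at sample size `n`. -/
def sigma (w : Model d) (n : ℕ) (i : Fin n) : Matrix (D.ineq n) (D.ineq n) ℝ :=
  Matrix.of fun m₁ m₂ => w.cov i m₁ m₂

/-- `max_{i} ‖Σ̂_i - Σ_i‖_o = o_p(n^{-κ})`, uniformly over the models in `𝒲`. -/
def VarianceRate (𝒲 : Set (Model d)) (κ : ℝ) : Prop :=
  ∀ δ : ℝ, 0 < δ → Tendsto (fun n : ℕ => ⨆ w ∈ 𝒲, (w.sampleLaw D.X n)
    {y | ∃ i : Fin n, δ * (n : ℝ) ^ (-κ) <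
      ‖Matrix.toEuclideanCLM (𝕜 := ℝ) (D.sigmaHat n y i - D.sigma w n i)‖}) atTop (𝓝 0)

end Design

end CMI

end

/-! After division by standard deviations the statistic is a maximum of signal plus noise over `S
n`. Everything is compared with one object: the maximum, over a set `A` of indices, of the jointly
Gaussian standard normal variables `zDual` that share the covariances of the noise. Its smoothed
distribution function is `gaussVal`.

Three facts hold uniformly over the models and over all nonempty `A ⊆ S n`. The noise behaves like
its Gaussian analogue: Lindeberg replacement is applied to a smooth function of log-sum-exp, whose
third-order error does not depend on the number of indices beyond a logarithm
(`eventually_abs_integral_noise_sub_le`). The simulated maximum behaves like it too: both are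
functionals of the same standard normal vectors, and the square roots of two close covariance
matrices are close (`eventually_bootVal_close`). Finally `gaussVal` hardly changes under shifts by
the polynomially small `slack` (`eventually_gaussVal_add_le`), by an anticoncentration inequality
that compares the maximum with a single normal variable (`measure_max_mem_Ioc_mul_le`).

Size: under the null hypothesis the signal only lowers the statistic, and a critical value based on
a larger set is larger. Hence, if the selected set contains a nonrandom `A` and the indices outside
`A` stay below the critical value, the acceptance probability is nearly at least the level
(`le_integral_accept`). For the plug-in value `A` is all of `S n`. For moment selection `A` collects
the indices whose normalized slackness is at most about the `1 - γ_n` quantile. The noise has to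
stay below that quantile, so that the other indices are harmless, and above its negative, so that
`A` is selected; each failure costs about `γ_n`, which the level `1 - α + 2γ_n` returns.

The remaining danger is a negative critical value, possible when `α` is large. Either the Gaussian
maximum over the nearly binding indices is bounded with high probability; then all of these are
selected and the rest lie below a uniform lower bound for critical values. Or it exceeds a large
level with nonnegligible probability; then two independent copies exceed a moderate level at a
common index with probability close to one (`exists_level_prod_exceed`), so that the noise selects
indices at which the simulated statistic is positive.

Consistency: at a fixed small bandwidth the normalized signal grows like `√n`, while critical values
are at most `log² n` (`eventually_crit_le`). -/

namespace CMI

/-! ### Maxima of jointly Gaussian standard normal variables: comparison with one variable -/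

section GaussianFamily

variable {Ω : Type*} [NormedAddCommGroup Ω] [NormedSpace ℝ Ω] [MeasurableSpace Ω] [BorelSpace Ω]

/-- A functional with standard normal law is square integrable, centered, of variance one. -/
lemma memLp_of_map_gaussianReal {Ω : Type*} [MeasurableSpace Ω] {μ : Measure Ω} {Z : Ω → ℝ}
    (hZ : Measurable Z) {v : NNReal} (h : μ.map Z = gaussianReal 0 v) : MemLp Z 2 μ := by
  have := (memLp_map_measure_iff (f := Z) (g := id) (p := 2) (μ := μ) (by fun_prop)
    hZ.aemeasurable).1 (h ▸ memLp_id_gaussianReal' 2 (by norm_num))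
  simpa using this

lemma integral_of_map_gaussianReal {Ω : Type*} [MeasurableSpace Ω] {μ : Measure Ω} {Z : Ω → ℝ}
    (hZ : Measurable Z) {v : NNReal} (h : μ.map Z = gaussianReal 0 v) : μ[Z] = 0 := by
  have h1 : ∫ x, x ∂(μ.map Z) = μ[Z] := by
    rw [integral_map hZ.aemeasurable (by fun_prop)]
  rw [← h1, h, integral_id_gaussianReal]

lemma variance_of_map_gaussianReal {Ω : Type*} [MeasurableSpace Ω] {μ : Measure Ω} {Z : Ω → ℝ}
    (hZ : Measurable Z) {v : NNReal} (h : μ.map Z = gaussianReal 0 v) : Var[Z; μ] = v := by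
  have := variance_map (μ := μ) (X := id) (Y := Z) (by fun_prop) hZ.aemeasurable
  rw [h, variance_id_gaussianReal] at this
  simpa using this.symm

/-- In a jointly Gaussian family of standard normal variables, `Z s` is independent of the
residuals of the others. -/
lemma indepFun_residuals {μ : Measure Ω} [IsGaussian μ] {ι : Type*} (Z : ι → StrongDual ℝ Ω)
    (A : Finset ι) (hZ : ∀ s ∈ A, μ.map (Z s) = gaussianReal 0 1) {s : ι} (hs : s ∈ A) :
    IndepFun (fun ω => Z s ω) (fun ω (t : A) => Z t ω - cov[Z s, Z t; μ] * Z s ω) μ := by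
  let X : Unit → Ω → ℝ := fun _ ω => Z s ω
  let Y : A → Ω → ℝ := fun t ω => Z t ω - cov[Z s, Z t; μ] * Z s ω
  have hG : HasGaussianLaw (fun ω => (fun i => X i ω, fun j => Y j ω)) μ := by
    have h := (IsGaussian.hasGaussianLaw_id (μ := μ)).map
      ((ContinuousLinearMap.pi (fun _ : Unit => Z s)).prod
        (ContinuousLinearMap.pi (fun t : A => Z t - cov[Z s, Z t; μ] • Z s)))
    exact h
  have hind := hG.indepFun_of_covariance_eval (fun i j => by
    have m1 := memLp_of_map_gaussianReal (Z s).continuous.measurable (hZ s hs)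
    have m2 := memLp_of_map_gaussianReal (Z j).continuous.measurable (hZ j j.2)
    have v1 := variance_of_map_gaussianReal (Z s).continuous.measurable (hZ s hs)
    change cov[fun ω => Z s ω, fun ω => Z j ω - cov[Z s, Z j; μ] * Z s ω; μ] = 0
    rw [covariance_fun_sub_right m1 m2 (m1.const_mul _), covariance_const_mul_right]
    rw [← covariance_self (by fun_prop)] at v1
    have : cov[fun ω => Z s ω, fun ω => Z s ω; μ] = 1 := by simpa using v1
    rw [this]; simp)
  exact hind.comp (φ := fun f : Unit → ℝ => f ()) (ψ := id) (by fun_prop) measurable_id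

/-- The variance of `Z s - Z t` equals `2 - 2 cov` and is nonnegative. -/
lemma cov_le_one {μ : Measure Ω} [IsGaussian μ] {ι : Type*} (Z : ι → StrongDual ℝ Ω)
    {s t : ι} (hs : μ.map (Z s) = gaussianReal 0 1) (ht : μ.map (Z t) = gaussianReal 0 1) :
    cov[Z s, Z t; μ] ≤ 1 := by
  have m1 := memLp_of_map_gaussianReal (Z s).continuous.measurable hs
  have m2 := memLp_of_map_gaussianReal (Z t).continuous.measurable ht
  have v1 := variance_of_map_gaussianReal (Z s).continuous.measurable hs
  have v2 := variance_of_map_gaussianReal (Z t).continuous.measurable ht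
  have h := variance_nonneg (⇑(Z s) - ⇑(Z t)) μ
  rw [variance_sub m1 m2, v1, v2] at h
  norm_num at h
  linarith

/-- Anticoncentration of the maximum of jointly Gaussian standard normal variables, relative to
the one-dimensional normal law. -/
lemma measure_max_mem_Ioc_mul_le {μ : Measure Ω} [IsGaussian μ] {ι : Type*} [Countable ι]
    (Z : ι → StrongDual ℝ Ω) (A : Finset ι) (hZ : ∀ s ∈ A, μ.map (Z s) = gaussianReal 0 1)
    (c c' : ℝ) :
    μ {ω | (∀ s ∈ A, Z s ω ≤ c') ∧ ∃ s ∈ A, c < Z s ω} * gaussianReal 0 1 (Set.Ioi c')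
      ≤ gaussianReal 0 1 (Set.Ioc c c') := by
  classical
  -- An injective ranking breaks ties, so that the events of being the first maximizer are disjoint.
  obtain ⟨r, hr⟩ := Countable.exists_injective_nat ι
  let ρ : ι → ι → ℝ := fun s t => cov[Z s, Z t; μ]
  -- `E s x`: the residuals allow `s` to be the first maximizer, with value `x`
  let E : ι → ℝ → Set Ω := fun s x => {ω | ∀ t ∈ A, Z t ω - ρ s t * Z s ω ≤ (1 - ρ s t) * x ∧
    (r t < r s → Z t ω - ρ s t * Z s ω < (1 - ρ s t) * x)}
  -- Correlations are at most one, so the thresholds `(1 - ρ) x` are nondecreasing in `x`. This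
  -- monotonicity allows a random level to be replaced by the endpoint `c'` in both estimates below.
  have hmono : ∀ s ∈ A, ∀ x y, x ≤ y → E s x ⊆ E s y := by
    intro s hs x y hxy ω hω t ht
    have h1 : ρ s t ≤ 1 := cov_le_one Z (hZ s hs) (hZ t ht)
    have h2 : (1 - ρ s t) * x ≤ (1 - ρ s t) * y :=
      mul_le_mul_of_nonneg_left hxy (by linarith)
    exact ⟨(hω t ht).1.trans h2, fun h => ((hω t ht).2 h).trans_le h2⟩
  have hE : ∀ s ω, ω ∈ E s (Z s ω) ↔ ∀ t ∈ A, Z t ω ≤ Z s ω ∧ (r t < r s → Z t ω < Z s ω) := by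
    intro s ω
    refine forall₂_congr fun t _ => ?_
    constructor <;> rintro ⟨h1, h2⟩ <;>
      exact ⟨by linarith, fun h => by linarith [h2 h]⟩
  have hindep : ∀ s ∈ A, ∀ (I : Set ℝ), MeasurableSet I → ∀ x,
      μ ({ω | Z s ω ∈ I} ∩ E s x) = gaussianReal 0 1 I * μ (E s x) := by
    intro s hs I hI x
    let F : Set (A → ℝ) := {f | ∀ t : A, f t ≤ (1 - ρ s t) * x ∧
      (r t < r s → f t < (1 - ρ s t) * x)}
    have hF : MeasurableSet F := by
      have : F = ⋂ t : A, {f : A → ℝ | f t ≤ (1 - ρ s t) * x ∧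
          (r t < r s → f t < (1 - ρ s t) * x)} := by
        ext f; simp [F]
      rw [this]
      refine MeasurableSet.iInter fun t => ?_
      refine (measurableSet_le (f := fun f : A → ℝ => f t) (g := fun _ => (1 - ρ s t) * x)
        (by fun_prop) (by fun_prop)).inter ?_
      change MeasurableSet {f : A → ℝ | r t < r s → f t < (1 - ρ s t) * x}
      by_cases h : r t < r s
      · simp only [h, true_imp_iff]
        exact measurableSet_lt (by fun_prop) (by fun_prop)
      · simp only [h, false_imp_iff, Set.ofPred_true, MeasurableSet.univ]
    have hEF : E s x = (fun ω (t : A) => Z t ω - cov[Z s, Z t; μ] * Z s ω) ⁻¹' F := by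
      ext ω; simp [E, F, ρ]
    have h := (indepFun_residuals Z A hZ hs).measure_inter_preimage_eq_mul I F hI hF
    rw [hEF, ← hZ s hs, Measure.map_apply (Z s).continuous.measurable hI]
    exact h
  have hEmeas : ∀ s, MeasurableSet {ω | ω ∈ E s (Z s ω)} := by
    intro s
    have : {ω | ω ∈ E s (Z s ω)} = ⋂ t ∈ A, {ω | Z t ω ≤ Z s ω ∧ (r t < r s → Z t ω < Z s ω)} := by
      ext ω; simp [hE]
    rw [this]
    refine Finset.measurableSet_biInter _ fun t _ => ?_
    refine (measurableSet_le (f := fun ω => Z t ω) (g := fun ω => Z s ω)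
      (by fun_prop) (by fun_prop)).inter ?_
    change MeasurableSet {ω | r t < r s → Z t ω < Z s ω}
    by_cases h : r t < r s
    · simp only [h, true_imp_iff]
      exact measurableSet_lt (by fun_prop) (by fun_prop)
    · simp only [h, false_imp_iff, Set.ofPred_true, MeasurableSet.univ]
  -- The first maximizer `s` has its value in `(c, c']` and its residuals in `E s (Z s) ⊆ E s c'`;
  -- the two conditions at the fixed level `c'` are independent.
  have hle : μ {ω | (∀ s ∈ A, Z s ω ≤ c') ∧ ∃ s ∈ A, c < Z s ω} ≤
      ∑ s ∈ A, gaussianReal 0 1 (Set.Ioc c c') * μ (E s c') := by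
    calc _ ≤ μ (⋃ s ∈ A, ({ω | Z s ω ∈ Set.Ioc c c'} ∩ E s c')) := by
          refine measure_mono fun ω hω => ?_
          obtain ⟨h1, s0, hs0, h0⟩ := hω
          obtain ⟨m, hm, hmax⟩ := A.exists_max_image (fun s => Z s ω) ⟨s0, hs0⟩
          obtain ⟨s, hs, hmin⟩ := (A.filter (fun s => Z s ω = Z m ω)).exists_min_image r
            ⟨m, by simp [hm]⟩
          rw [Finset.mem_filter] at hs
          have hsE : ω ∈ E s (Z s ω) := by
            rw [hE]
            intro t ht
            have h2 : Z t ω ≤ Z s ω := by rw [hs.2]; exact hmax t ht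
            refine ⟨h2, fun hlt => lt_of_le_of_ne h2 fun heq => ?_⟩
            have := hmin t (by simp [ht, heq, hs.2])
            omega
          simp only [Set.mem_iUnion]
          refine ⟨s, hs.1, ⟨?_, h1 s hs.1⟩, hmono s hs.1 _ _ (h1 s hs.1) hsE⟩
          exact h0.trans_le (hs.2 ▸ hmax s0 hs0)
      _ ≤ ∑ s ∈ A, μ ({ω | Z s ω ∈ Set.Ioc c c'} ∩ E s c') := measure_biUnion_finset_le _ _
      _ = _ := Finset.sum_congr rfl fun s hs => hindep s hs _ measurableSet_Ioc _
  -- Where `Z s > c'`, the event `E s c'` forces `s` to be the first maximizer. These events are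
  -- disjoint, so their probabilities add up to at most one.
  have hge : ∑ s ∈ A, gaussianReal 0 1 (Set.Ioi c') * μ (E s c') ≤ 1 := by
    calc _ ≤ ∑ s ∈ A, μ ({ω | Z s ω ∈ Set.Ioi c'} ∩ {ω | ω ∈ E s (Z s ω)}) := by
          refine Finset.sum_le_sum fun s hs => ?_
          rw [← hindep s hs _ measurableSet_Ioi]
          refine measure_mono fun ω hω => ⟨hω.1, ?_⟩
          exact hmono s hs _ _ (le_of_lt hω.1) hω.2
      _ = μ (⋃ s ∈ A, ({ω | Z s ω ∈ Set.Ioi c'} ∩ {ω | ω ∈ E s (Z s ω)})) := by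
          refine (measure_biUnion_finset ?_ fun s _ => ?_).symm
          · intro s hs t ht hst
            refine Set.disjoint_left.2 fun ω h1 h2 => ?_
            have e1 := (hE s ω).1 h1.2
            have e2 := (hE t ω).1 h2.2
            rcases lt_trichotomy (r s) (r t) with h | h | h
            · have := (e2 s hs).2 h; have := (e1 t ht).1; linarith
            · exact hst (hr h)
            · have := (e1 t ht).2 h; have := (e2 s hs).1; linarith
          · exact ((measurableSet_Ioi).preimage (Z s).continuous.measurable).inter (hEmeas s)
      _ ≤ 1 := prob_le_one
  calc _ ≤ (∑ s ∈ A, gaussianReal 0 1 (Set.Ioc c c') * μ (E s c')) *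
        gaussianReal 0 1 (Set.Ioi c') := by gcongr
    _ = gaussianReal 0 1 (Set.Ioc c c') *
        ∑ s ∈ A, gaussianReal 0 1 (Set.Ioi c') * μ (E s c') := by
        rw [Finset.mul_sum, Finset.sum_mul]
        exact Finset.sum_congr rfl fun s _ => by ring
    _ ≤ gaussianReal 0 1 (Set.Ioc c c') * 1 := by gcongr
    _ = _ := mul_one _

end GaussianFamily

end CMI


namespace CMI

/-! ### Tails of Gaussian families -/

/-- Chernoff's bound with exponent `t / σ`. Only an upper bound `σ` for the variance enters, so
degenerate laws are covered. -/
lemma measureReal_ge_le_of_map_gaussianReal {Ω : Type*} [MeasurableSpace Ω] {μ : Measure Ω}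
    [IsProbabilityMeasure μ] {X : Ω → ℝ} (hX : Measurable X) {v : NNReal}
    (h : μ.map X = gaussianReal 0 v) {σ : ℝ} (hσ : 0 < σ) (hv : (v : ℝ) ≤ σ) {t : ℝ}
    (ht : 0 ≤ t) : μ.real {ω | t ≤ X ω} ≤ Real.exp (-t ^ 2 / (2 * σ)) := by
  have hint : Integrable (fun ω => Real.exp (t / σ * X ω)) μ := by
    have := integrable_exp_mul_gaussianReal (μ := 0) (v := v) (t / σ)
    rw [← h] at this
    exact (integrable_map_measure (by fun_prop) hX.aemeasurable).1 this
  refine (measure_ge_le_exp_mul_mgf t (by positivity) hint).trans ?_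
  rw [mgf_gaussianReal h, ← Real.exp_add]
  apply Real.exp_le_exp.2
  have : -(t / σ) * t + (0 * (t / σ) + v * (t / σ) ^ 2 / 2) ≤
      -(t / σ) * t + (0 * (t / σ) + σ * (t / σ) ^ 2 / 2) := by gcongr
  refine this.trans (le_of_eq ?_)
  field_simp
  ring

lemma measureReal_abs_ge_le_of_map_gaussianReal {Ω : Type*} [MeasurableSpace Ω] {μ : Measure Ω}
    [IsProbabilityMeasure μ] {X : Ω → ℝ} (hX : Measurable X) {v : NNReal}
    (h : μ.map X = gaussianReal 0 v) {σ : ℝ} (hσ : 0 < σ) (hv : (v : ℝ) ≤ σ) {t : ℝ}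
    (ht : 0 ≤ t) : μ.real {ω | t ≤ |X ω|} ≤ 2 * Real.exp (-t ^ 2 / (2 * σ)) := by
  have hneg : μ.map (fun ω => -X ω) = gaussianReal 0 v := by
    have : μ.map (fun ω => -X ω) = (μ.map X).map (fun x => -x) := by
      rw [Measure.map_map (by fun_prop) hX]; rfl
    rw [this, h, gaussianReal_map_neg]; simp
  have h1 := measureReal_ge_le_of_map_gaussianReal hX h hσ hv ht
  have h2 := measureReal_ge_le_of_map_gaussianReal hX.neg hneg hσ hv ht
  have : {ω | t ≤ |X ω|} = {ω | t ≤ X ω} ∪ {ω | t ≤ (-X) ω} := by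
    ext ω; simp [le_abs]
  rw [this]
  refine (measureReal_union_le _ _).trans ?_
  rw [two_mul]
  exact add_le_add h1 h2

lemma measureReal_exists_abs_ge_le {Ω : Type*} [MeasurableSpace Ω] {μ : Measure Ω}
    [IsProbabilityMeasure μ] {ι : Type*} (A : Finset ι) {X : ι → Ω → ℝ}
    (hX : ∀ s ∈ A, Measurable (X s)) {σ : ℝ} (hσ : 0 < σ)
    (h : ∀ s ∈ A, ∃ v : NNReal, (v : ℝ) ≤ σ ∧ μ.map (X s) = gaussianReal 0 v) {t : ℝ}
    (ht : 0 ≤ t) :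
    μ.real {ω | ∃ s ∈ A, t ≤ |X s ω|} ≤ A.card * (2 * Real.exp (-t ^ 2 / (2 * σ))) := by
  have : {ω | ∃ s ∈ A, t ≤ |X s ω|} = ⋃ s ∈ A, {ω | t ≤ |X s ω|} := by ext; simp
  rw [this]
  refine (measureReal_biUnion_finset_le _ _).trans ?_
  rw [← nsmul_eq_mul]
  refine Finset.sum_le_card_nsmul _ _ _ fun s hs => ?_
  obtain ⟨v, hv, hm⟩ := h s hs
  exact measureReal_abs_ge_le_of_map_gaussianReal (hX s hs) hm hσ hv ht

/-! ### Anticoncentration -/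

/-- The normal hazard rate grows at most linearly. With `b = max c 0` the density on the interval is
at most its value at `b`, while the tail beyond `c + δ` contains an interval of length `h = 1 / (1 +
B)` on which the density is smaller by at most a constant factor. -/
lemma gaussianReal_Ioc_le {c δ B : ℝ} (hB : 0 ≤ B) (hc : c ≤ B) (hδ : 0 ≤ δ)
    (hδB : δ * (1 + B) ≤ 1) :
    gaussianReal 0 1 (Set.Ioc c (c + δ)) ≤
      ENNReal.ofReal (Real.exp 4 * δ * (1 + B)) * gaussianReal 0 1 (Set.Ioi (c + δ)) := by
  set b := max c 0 with hb
  have hb0 : 0 ≤ b := le_max_right _ _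
  have hbB : b ≤ B := max_le hc hB
  have hcb : c ≤ b := le_max_left _ _
  set h := (1 + B)⁻¹ with hh
  have hh0 : 0 < h := by positivity
  have hhB : h * (1 + B) = 1 := by rw [hh]; field_simp
  have hpdf : ∀ x, gaussianPDFReal 0 1 x = (√(2 * Real.pi))⁻¹ * Real.exp (-x ^ 2 / 2) := by
    intro x; simp [gaussianPDFReal]
  have hupper : gaussianReal 0 1 (Set.Ioc c (c + δ)) ≤
      ENNReal.ofReal (gaussianPDFReal 0 1 b) * ENNReal.ofReal δ := by
    rw [gaussianReal_apply 0 one_ne_zero]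
    calc _ ≤ ∫⁻ x in Set.Ioc c (c + δ), ENNReal.ofReal (gaussianPDFReal 0 1 b) := by
          refine setLIntegral_mono measurable_const fun x hx => ?_
          rw [gaussianPDF]
          apply ENNReal.ofReal_le_ofReal
          rw [hpdf, hpdf]
          have : b ^ 2 ≤ x ^ 2 := by
            rcases le_total c 0 with h0 | h0
            · rw [hb, max_eq_right h0]; nlinarith [sq_nonneg x]
            · rw [hb, max_eq_left h0]; nlinarith [hx.1]
          gcongr
      _ = _ := by rw [setLIntegral_const, Real.volume_Ioc]; simp
  have hlower : ENNReal.ofReal (gaussianPDFReal 0 1 (b + δ + h)) * ENNReal.ofReal h ≤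
      gaussianReal 0 1 (Set.Ioi (c + δ)) := by
    calc _ = ∫⁻ x in Set.Ioc (b + δ) (b + δ + h),
          ENNReal.ofReal (gaussianPDFReal 0 1 (b + δ + h)) := by
          rw [setLIntegral_const, Real.volume_Ioc]; simp
      _ ≤ ∫⁻ x in Set.Ioc (b + δ) (b + δ + h), gaussianPDF 0 1 x := by
          refine setLIntegral_mono (measurable_gaussianPDF 0 1) fun x hx => ?_
          rw [gaussianPDF]
          apply ENNReal.ofReal_le_ofReal
          rw [hpdf, hpdf]
          have : x ^ 2 ≤ (b + δ + h) ^ 2 := by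
            have := hx.1; have := hx.2; nlinarith
          gcongr
      _ = gaussianReal 0 1 (Set.Ioc (b + δ) (b + δ + h)) := by
          rw [gaussianReal_apply 0 one_ne_zero]
      _ ≤ _ := measure_mono fun x hx => by
          have := hx.1; simp only [Set.mem_Ioi]; linarith
  refine hupper.trans ((?_ : _ ≤ _).trans (mul_le_mul_right hlower _))
  rw [← ENNReal.ofReal_mul (gaussianPDFReal_nonneg _ _ _),
    ← ENNReal.ofReal_mul (gaussianPDFReal_nonneg _ _ _), ← ENNReal.ofReal_mul (by positivity)]
  apply ENNReal.ofReal_le_ofReal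
  -- The exponents differ by `b (δ + h) + (δ + h)² / 2`. As `δ ≤ h`, `b h ≤ 1` and `h ≤ 1`, both
  -- terms are at most `2`.
  have key : Real.exp (-b ^ 2 / 2) ≤ Real.exp 4 * Real.exp (-(b + δ + h) ^ 2 / 2) := by
    rw [← Real.exp_add]
    apply Real.exp_le_exp.2
    have h1 : δ ≤ h := by rw [hh, ← one_div, le_div_iff₀ (by positivity)]; exact hδB
    have h2 : b * h ≤ 1 := by nlinarith
    have h3 : h ≤ 1 := by nlinarith
    nlinarith [mul_le_mul_of_nonneg_left h1 hb0]
  rw [hpdf, hpdf]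
  calc _ = (√(2 * Real.pi))⁻¹ * δ * Real.exp (-b ^ 2 / 2) := by ring
    _ ≤ (√(2 * Real.pi))⁻¹ * δ * (Real.exp 4 * Real.exp (-(b + δ + h) ^ 2 / 2)) := by gcongr
    _ = (√(2 * Real.pi))⁻¹ * δ * (Real.exp 4 * Real.exp (-(b + δ + h) ^ 2 / 2)) *
        (h * (1 + B)) := by rw [hhB, mul_one]
    _ = _ := by ring

/-- Anticoncentration of the maximum of jointly Gaussian standard normal variables. -/
lemma measureReal_max_mem_Ioc_le {Ω : Type*} [NormedAddCommGroup Ω] [NormedSpace ℝ Ω]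
    [MeasurableSpace Ω] [BorelSpace Ω] {μ : Measure Ω} [IsGaussian μ] {ι : Type*} [Countable ι]
    (Z : ι → StrongDual ℝ Ω) (A : Finset ι) (hZ : ∀ s ∈ A, μ.map (Z s) = gaussianReal 0 1)
    (c : ℝ) {δ B : ℝ} (hδ : 0 ≤ δ) (hB : 0 ≤ B) :
    μ.real {ω | (∀ s ∈ A, Z s ω ≤ c + δ) ∧ ∃ s ∈ A, c < Z s ω} ≤
      A.card * (2 * Real.exp (-B ^ 2 / 2)) + Real.exp 4 * δ * (1 + B) := by
  -- Otherwise the claimed bound exceeds one.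
  by_cases hδB : δ * (1 + B) ≤ 1
  swap
  · push Not at hδB
    have h1 : (1 : ℝ) ≤ Real.exp 4 := Real.one_le_exp (by norm_num)
    have h2 : 1 ≤ Real.exp 4 * δ * (1 + B) := by nlinarith
    have h3 : 0 ≤ (A.card : ℝ) * (2 * Real.exp (-B ^ 2 / 2)) := by positivity
    exact measureReal_le_one.trans (by linarith)
  -- Below `B` the hazard rate comparison applies, after division by the positive tail; above `B` a
  -- union bound suffices.
  rcases le_total c B with hc | hc
  · have h1 := measure_max_mem_Ioc_mul_le Z A hZ c (c + δ)
    have h2 := gaussianReal_Ioc_le hB hc hδ hδB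
    have hpos : gaussianReal 0 1 (Set.Ioi (c + δ)) ≠ 0 := by
      intro h0
      have := (gaussianReal_absolutelyContinuous' 0 (one_ne_zero)) h0
      simp at this
    have h3 := (ENNReal.mul_le_mul_iff_left hpos (measure_ne_top _ _)).1 (h1.trans h2)
    have h4 := ENNReal.toReal_le_of_le_ofReal (by positivity) h3
    have h5 : 0 ≤ (A.card : ℝ) * (2 * Real.exp (-B ^ 2 / 2)) := by positivity
    rw [measureReal_def]
    linarith
  · have h1 := measureReal_exists_abs_ge_le (μ := μ) A (X := fun s ω => Z s ω)
      (fun s _ => by fun_prop) one_pos (fun s hs => ⟨1, by simp, hZ s hs⟩) hB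
    rw [mul_one] at h1
    have h2 : 0 ≤ Real.exp 4 * δ * (1 + B) := by positivity
    refine (measureReal_mono ?_).trans (h1.trans (by linarith))
    rintro ω ⟨-, s, hs, h⟩
    exact ⟨s, hs, hc.trans (h.le.trans (le_abs_self _))⟩

/-! ### Weak concentration of Gaussian maxima -/

/-- The law of two independent copies is invariant under rotation by `π / 4`. If the first copy
exceeds `u` at an index where the second is below `C` in absolute value, then sum and difference,
divided by `√2`, both exceed `v` at that index. -/
lemma measureReal_exists_gt_le_prod {Ω : Type*} [NormedAddCommGroup Ω] [NormedSpace ℝ Ω]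
    [MeasurableSpace Ω] [BorelSpace Ω] [SecondCountableTopology Ω] [CompleteSpace Ω]
    {μ : Measure Ω} [IsGaussian μ] (h0 : μ[id] = 0) {ι : Type*}
    (Z : ι → StrongDual ℝ Ω) (A : Finset ι) (hZ : ∀ s ∈ A, μ.map (Z s) = gaussianReal 0 1)
    {u v C : ℝ} (hC : 0 ≤ C) (hu : √2 * v + C ≤ u) :
    μ.real {ω | ∃ s ∈ A, u < Z s ω} ≤
      (μ.prod μ).real {p | ∃ s ∈ A, v < Z s p.1 ∧ v < Z s p.2} + 2 * Real.exp (-C ^ 2 / 2) := by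
  set S : Set (Ω × Ω) := {p | ∃ s ∈ A, u < Z s p.1 ∧ |Z s p.2| < C} with hS
  set S2 : Set (Ω × Ω) := {p | ∃ s ∈ A, v < Z s p.1 ∧ v < Z s p.2} with hS2
  set U : Set Ω := {ω | ∃ s ∈ A, u < Z s ω} with hU
  have hSm : MeasurableSet S := by
    have : S = ⋃ s ∈ A, {p : Ω × Ω | u < Z s p.1 ∧ |Z s p.2| < C} := by
      ext; simp only [hS, Set.mem_iUnion, exists_prop]; rfl
    rw [this]
    exact Finset.measurableSet_biUnion _ fun s _ =>
      (measurableSet_lt (f := fun _ : Ω × Ω => u) (g := fun p => Z s p.1)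
        (by fun_prop) (by fun_prop)).inter
      (measurableSet_lt (f := fun p : Ω × Ω => |Z s p.2|) (g := fun _ => C)
        (by fun_prop) (by fun_prop))
  have hS2m : MeasurableSet S2 := by
    have : S2 = ⋃ s ∈ A, {p : Ω × Ω | v < Z s p.1 ∧ v < Z s p.2} := by
      ext; simp only [hS2, Set.mem_iUnion, exists_prop]; rfl
    rw [this]
    exact Finset.measurableSet_biUnion _ fun s _ =>
      (measurableSet_lt (f := fun _ : Ω × Ω => v) (g := fun p => Z s p.1)
        (by fun_prop) (by fun_prop)).inter
      (measurableSet_lt (f := fun _ : Ω × Ω => v) (g := fun p => Z s p.2)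
        (by fun_prop) (by fun_prop))
  have hUm : MeasurableSet U := by
    have : U = ⋃ s ∈ A, {ω : Ω | u < Z s ω} := by ext; simp [hU]
    rw [this]
    exact Finset.measurableSet_biUnion _ fun s _ => measurableSet_lt (by fun_prop) (by fun_prop)
  have hsub : S ⊆ ContinuousLinearMap.rotation (-(Real.pi / 4)) ⁻¹' S2 := by
    rintro ⟨x, y⟩ ⟨s, hs, h1, h2⟩
    refine ⟨s, hs, ?_⟩
    simp only [ContinuousLinearMap.rotation_apply, Real.cos_neg, Real.sin_neg,
      Real.cos_pi_div_four, Real.sin_pi_div_four, map_add, map_smul, smul_eq_mul, neg_neg]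
    rw [abs_lt] at h2
    have h3 : √2 * √2 = 2 := Real.mul_self_sqrt (by norm_num)
    have h4 : 0 < √2 := by positivity
    simp only at h1 h2
    have h5 : √2 / 2 * (√2 * v) = v := by rw [← mul_assoc, div_mul_eq_mul_div, h3]; ring
    have h6 : √2 * v < Z s x - Z s y := by linarith
    have h7 : √2 * v < Z s x + Z s y := by linarith
    constructor
    · linarith [mul_lt_mul_of_pos_left h6 (half_pos h4)]
    · linarith [mul_lt_mul_of_pos_left h7 (half_pos h4)]
  have hrot : (μ.prod μ) S ≤ (μ.prod μ) S2 := by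
    have := IsGaussian.map_rotation_eq_self (μ := μ) h0 (-(Real.pi / 4))
    calc _ ≤ _ := measure_mono hsub
      _ = (μ.prod μ) S2 := by
        rw [← Measure.map_apply (by fun_prop) hS2m, this]
  -- For a fixed first copy a single exceeding index is chosen, so that the second copy has to be
  -- controlled at this index only. No union bound over `A` occurs, and the error is free of its
  -- cardinality.
  have hdiff : (μ.prod μ) ((U ×ˢ Set.univ) \ S) ≤ ENNReal.ofReal (2 * Real.exp (-C ^ 2 / 2)) := by
    rw [Measure.prod_apply ((hUm.prod MeasurableSet.univ).diff hSm)]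
    calc _ ≤ ∫⁻ _, ENNReal.ofReal (2 * Real.exp (-C ^ 2 / 2)) ∂μ := by
          refine lintegral_mono fun x => ?_
          by_cases hx : x ∈ U
          · obtain ⟨s, hs, h⟩ := hx
            have h1 := measureReal_abs_ge_le_of_map_gaussianReal (μ := μ)
              (Z s).continuous.measurable (hZ s hs) one_pos (by simp) hC
            rw [mul_one] at h1
            refine (measure_mono (t := {y | C ≤ |Z s y|}) fun y hy => ?_).trans ?_
            · by_contra hlt
              exact hy.2 ⟨s, hs, h, not_le.1 hlt⟩
            · rw [← ENNReal.ofReal_toReal (measure_ne_top μ {y | C ≤ |Z s y|})]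
              exact ENNReal.ofReal_le_ofReal h1
          · have : Prod.mk x ⁻¹' ((U ×ˢ Set.univ) \ S) = ∅ := by
              ext y; simp [hx]
            rw [this]; simp
      _ = _ := by simp
  have htot : μ U ≤ (μ.prod μ) S2 + ENNReal.ofReal (2 * Real.exp (-C ^ 2 / 2)) := by
    calc μ U = (μ.prod μ) (U ×ˢ Set.univ) := by rw [Measure.prod_prod]; simp
      _ ≤ (μ.prod μ) (S ∪ ((U ×ˢ Set.univ) \ S)) := measure_mono (by
          intro p hp; by_cases h : p ∈ S <;> simp_all)
      _ ≤ _ := (measure_union_le _ _).trans (add_le_add hrot hdiff)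
  have := ENNReal.toReal_mono (by finiteness) htot
  rwa [ENNReal.toReal_add (by finiteness) (by finiteness),
    ENNReal.toReal_ofReal (by positivity)] at this

/-- If the maximum of jointly Gaussian standard normal variables exceeds a large level with
nonnegligible probability, then with probability close to one two independent copies of the
family exceed a given lower level at a common index. -/
lemma exists_level_prod_exceed {η : ℝ} (hη : 0 < η) (v : ℝ) : ∃ M : ℝ,
    ∀ {Ω : Type} [NormedAddCommGroup Ω] [NormedSpace ℝ Ω] [MeasurableSpace Ω] [BorelSpace Ω]
      [SecondCountableTopology Ω] [CompleteSpace Ω] {μ : Measure Ω} [IsGaussian μ],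
      μ[id] = 0 → ∀ {ι : Type} (Z : ι → StrongDual ℝ Ω) (A : Finset ι),
      (∀ s ∈ A, μ.map (Z s) = gaussianReal 0 1) → η ≤ μ.real {ω | ∃ s ∈ A, M < Z s ω} →
      1 - η ≤ (μ.prod μ).real {p | ∃ s ∈ A, v < Z s p.1 ∧ v < Z s p.2} := by
  rcases le_or_gt 1 η with h1 | h1
  · exact ⟨0, fun _ _ _ _ _ => by
      have : (1 : ℝ) - η ≤ 0 := by linarith
      exact fun _ => this.trans measureReal_nonneg⟩
  -- `k` is the number of squarings after which a probability below `1 - η / 2` falls below `η / 2`;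
  -- `C` is then so large that the `2 ^ k` tail errors add up to at most `η / 2`.
  obtain ⟨k, hk⟩ : ∃ k : ℕ, (1 - η / 2) ^ k < η / 2 :=
    exists_pow_lt_of_lt_one (by positivity) (by linarith)
  have hk2 : (1 - η / 2) ^ (2 ^ k) < η / 2 :=
    (pow_le_pow_of_le_one (by linarith) (by linarith) k.lt_two_pow_self.le).trans_lt hk
  obtain ⟨C, hC0, hC⟩ : ∃ C : ℝ, 0 ≤ C ∧ 2 * Real.exp (-C ^ 2 / 2) ≤ η / 2 / 2 ^ k := by
    have ht : Tendsto (fun C : ℝ => 2 * Real.exp (-C ^ 2 / 2)) atTop (𝓝 (2 * 0)) := by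
      refine Tendsto.const_mul _ (Real.tendsto_exp_atBot.comp ?_)
      have : Tendsto (fun C : ℝ => C ^ 2 / 2) atTop atTop :=
        (tendsto_pow_atTop (by norm_num)).atTop_div_const (by norm_num)
      convert tendsto_neg_atTop_atBot.comp this using 2
      simp; ring
    rw [mul_zero] at ht
    have := (ht.eventually (ge_mem_nhds (show 0 < η / 2 / 2 ^ k by positivity))).and
      (eventually_ge_atTop 0)
    obtain ⟨C, h1, h2⟩ := this.exists
    exact ⟨C, h2, h1⟩
  set τ := 2 * Real.exp (-C ^ 2 / 2) with hτ
  have hτ0 : 0 < τ := by positivity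
  let u : ℕ → ℝ := fun j => Nat.rec (√2 * v + C) (fun _ x => √2 * x + C) j
  refine ⟨u k, ?_⟩
  intro Ω _ _ _ _ _ _ μ _ h0 ι Z A hZ hM
  let p : ℝ → ℝ := fun x => μ.real {ω | ∃ s ∈ A, x < Z s ω}
  have hp1 : ∀ x, p x ≤ 1 := fun x => measureReal_le_one
  have hp0 : ∀ x, 0 ≤ p x := fun x => measureReal_nonneg
  have hstep : ∀ x, p (√2 * x + C) ≤ p x ^ 2 + τ := by
    intro x
    refine (measureReal_exists_gt_le_prod h0 Z A hZ hC0 le_rfl).trans ?_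
    gcongr
    have : (μ.prod μ).real ({ω | ∃ s ∈ A, x < Z s ω} ×ˢ {ω | ∃ s ∈ A, x < Z s ω}) = p x ^ 2 := by
      rw [measureReal_prod_prod, sq]
    rw [← this]
    refine measureReal_mono ?_
    rintro q ⟨s, hs, h1, h2⟩
    exact ⟨⟨s, hs, h1⟩, ⟨s, hs, h2⟩⟩
  -- Each passage from `u j` to `u (j + 1)` squares the exceedance probability. Since all quantities
  -- are at most one, squaring at most doubles the accumulated error.
  have hind : ∀ j, p (u j) ≤ p (u 0) ^ (2 ^ j) + (2 ^ j - 1) * τ := by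
    intro j
    induction j with
    | zero => simp
    | succ j ih =>
      have h1 : p (u (j + 1)) ≤ p (u j) ^ 2 + τ := hstep (u j)
      have h2 : p (u 0) ^ (2 ^ j) ≤ 1 := pow_le_one₀ (hp0 _) (hp1 _)
      have h3 : 0 ≤ p (u 0) ^ (2 ^ j) := pow_nonneg (hp0 _) _
      have h4 : p (u 0) ^ (2 ^ (j + 1)) = (p (u 0) ^ (2 ^ j)) ^ 2 := by rw [pow_succ, pow_mul]
      have h5 : (0 : ℝ) ≤ 2 ^ j - 1 := by
        have : (1 : ℝ) ≤ 2 ^ j := one_le_pow₀ (by norm_num)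
        linarith
      rw [h4, pow_succ (2 : ℝ) j]
      set a := p (u 0) ^ (2 ^ j)
      set x := p (u j)
      have hx1 := hp1 (u j)
      have hx0 := hp0 (u j)
      have h6 : x ^ 2 ≤ a ^ 2 + 2 * ((2 ^ j - 1) * τ) := by
        rcases le_total x a with h | h
        · have := mul_nonneg h5 hτ0.le
          nlinarith
        · nlinarith
      nlinarith
  -- If not, the exceedance probability at `u k` would be below `η / 2 + η / 2`, against the
  -- hypothesis at `M = u k`. One further rotation turns exceedance of `u 0` into joint exceedance
  -- of `v`.
  have h6 : 1 - η / 2 ≤ p (u 0) := by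
    by_contra hlt
    push Not at hlt
    have h7 : p (u 0) ^ (2 ^ k) ≤ (1 - η / 2) ^ (2 ^ k) := pow_le_pow_left₀ (hp0 _) hlt.le _
    have h8 := hind k
    have h9 : (2 ^ k - 1) * τ ≤ η / 2 := by
      calc (2 ^ k - 1) * τ ≤ 2 ^ k * τ := by gcongr; linarith
        _ ≤ 2 ^ k * (η / 2 / 2 ^ k) := by gcongr
        _ = η / 2 := by field_simp
    have h10 : η ≤ p (u k) := hM
    linarith
  have h7 := measureReal_exists_gt_le_prod (μ := μ) h0 Z A hZ (v := v) hC0 le_rfl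
  have h8 : τ ≤ η / 2 := hC.trans (div_le_self (by positivity) (one_le_pow₀ (by norm_num)))
  have h9 : p (u 0) = μ.real {ω | ∃ s ∈ A, √2 * v + C < Z s ω} := rfl
  linarith

end CMI


namespace CMI

/-! ### Square roots of positive semidefinite matrices -/

/-- Let `b` be a unit eigenvector of `P - Q` with eigenvalue `l`. Then `⟨b, (P² - Q²) b⟩ = l (⟨b, P
b⟩ + ⟨b, Q b⟩)`, and `l` is the difference of the two nonnegative forms on the right, hence bounded
by their sum in absolute value. So `l² ≤ ‖P² - Q²‖`, and expansion in an eigenbasis concludes. -/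
lemma norm_sub_apply_sq_le_of_sq_sub_sq {E : Type*} [NormedAddCommGroup E] [InnerProductSpace ℝ E]
    [FiniteDimensional ℝ E] {P Q : E →L[ℝ] E} (hP : P.toLinearMap.IsSymmetric)
    (hQ : Q.toLinearMap.IsSymmetric)
    (hP0 : ∀ x, 0 ≤ inner ℝ x (P x)) (hQ0 : ∀ x, 0 ≤ inner ℝ x (Q x)) {δ : ℝ}
    (h : ‖P * P - Q * Q‖ ≤ δ) (x : E) : ‖(P - Q) x‖ ^ 2 ≤ δ * ‖x‖ ^ 2 := by
  have hT : (P - Q).toLinearMap.IsSymmetric := by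
    intro a b
    have h1 := hP a b
    have h2 := hQ a b
    simp only [ContinuousLinearMap.coe_coe, sub_apply, inner_sub_left,
      inner_sub_right] at *
    rw [h1, h2]
  let b := hT.eigenvectorBasis rfl
  let l := hT.eigenvalues rfl
  have hb : ∀ i, (P - Q) (b i) = l i • b i := fun i => hT.apply_eigenvectorBasis rfl i
  have hl : ∀ i, l i ^ 2 ≤ δ := by
    intro i
    have hn : ‖b i‖ = 1 := b.orthonormal.1 i
    have hin : inner ℝ (b i) (b i) = 1 := by rw [real_inner_self_eq_norm_sq, hn]; norm_num
    have e1 : inner ℝ (b i) (P (b i)) - inner ℝ (b i) (Q (b i)) = l i := by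
      rw [← inner_sub_right, ← sub_apply, hb, inner_smul_right, hin, mul_one]
    have e2 : inner ℝ (b i) ((P * P - Q * Q) (b i)) =
        l i * (inner ℝ (b i) (P (b i)) + inner ℝ (b i) (Q (b i))) := by
      have hPQ : P (b i) = Q (b i) + l i • b i := by
        rw [← hb, sub_apply]; abel
      have s1 := hP (b i) (P (b i))
      have s2 := hQ (b i) (Q (b i))
      have s3 := hQ (b i) (b i)
      simp only [ContinuousLinearMap.coe_coe] at s1 s2 s3
      rw [sub_apply, inner_sub_right, mul_apply_eq_comp,
        mul_apply_eq_comp, ← s1, ← s2, hPQ]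
      simp only [inner_add_left, inner_add_right, inner_smul_left, inner_smul_right, hin, s3,
        RCLike.conj_to_real]
      ring
    have e3 : |inner ℝ (b i) ((P * P - Q * Q) (b i))| ≤ δ := by
      refine (abs_real_inner_le_norm _ _).trans ?_
      rw [hn, one_mul]
      refine (ContinuousLinearMap.le_opNorm _ _).trans ?_
      rw [hn, mul_one]; exact h
    have p1 := hP0 (b i)
    have p2 := hQ0 (b i)
    rw [e2, abs_le] at e3
    rcases le_total 0 (l i) with h0 | h0
    · nlinarith
    · nlinarith
  have hexp : ∀ i, inner ℝ (b i) ((P - Q) x) = l i * inner ℝ (b i) x := by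
    intro i
    have := hT (b i) x
    simp only [ContinuousLinearMap.coe_coe] at this
    rw [← this, hb, inner_smul_left]; simp
  rw [← b.sum_sq_norm_inner_right ((P - Q) x), ← b.sum_sq_norm_inner_right x, Finset.mul_sum]
  refine Finset.sum_le_sum fun i _ => ?_
  rw [hexp, norm_mul, mul_pow]
  gcongr
  simpa using hl i

open scoped MatrixOrder in
-- The square root is Hölder continuous of order `1/2`, with constant one and without any lower
-- bound on eigenvalues. This serves both the coupling of simulated and ideal Gaussian vectors and
-- the measurability of the test.
lemma norm_sqrt_sub_sqrt_apply_sq_le {m : Type*} [Fintype m] [DecidableEq m]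
    {A B : Matrix m m ℝ} (hA : A.PosSemidef) (hB : B.PosSemidef) {δ : ℝ}
    (h : ‖Matrix.toEuclideanCLM (𝕜 := ℝ) (A - B)‖ ≤ δ) (x : EuclideanSpace ℝ m) :
    ‖Matrix.toEuclideanCLM (𝕜 := ℝ) (CFC.sqrt A) x -
      Matrix.toEuclideanCLM (𝕜 := ℝ) (CFC.sqrt B) x‖ ^ 2 ≤ δ * ‖x‖ ^ 2 := by
  have hsym : ∀ C : Matrix m m ℝ,
      (Matrix.toEuclideanCLM (𝕜 := ℝ) (CFC.sqrt C)).toLinearMap.IsSymmetric := fun C =>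
    ContinuousLinearMap.isSelfAdjoint_iff_isSymmetric.1
      ((CFC.sqrt_nonneg C).isSelfAdjoint.map (Matrix.toEuclideanCLM (𝕜 := ℝ)))
  have hpos : ∀ (C : Matrix m m ℝ) x,
      0 ≤ inner ℝ x (Matrix.toEuclideanCLM (𝕜 := ℝ) (CFC.sqrt C) x) := by
    intro C x
    rw [Matrix.inner_toEuclideanCLM]
    simpa using (Matrix.nonneg_iff_posSemidef.1 (CFC.sqrt_nonneg C)).dotProduct_mulVec_nonneg (x.ofLp)
  have hsq : ∀ C : Matrix m m ℝ, C.PosSemidef →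
      Matrix.toEuclideanCLM (𝕜 := ℝ) (CFC.sqrt C) * Matrix.toEuclideanCLM (𝕜 := ℝ) (CFC.sqrt C) =
        Matrix.toEuclideanCLM (𝕜 := ℝ) C := by
    intro C hC
    rw [← map_mul, CFC.sqrt_mul_sqrt_self _ hC.nonneg]
  have := norm_sub_apply_sq_le_of_sq_sub_sq (hsym A) (hsym B) (hpos A) (hpos B) (δ := δ)
    (by rw [hsq A hA, hsq B hB, ← map_sub]; exact h) x
  rwa [sub_apply] at this

open scoped MatrixOrder in
-- The Hölder bound makes the square root continuous on the positive semidefinite matrices, where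
-- the estimators take their values.
lemma measurable_sqrt_apply {m : Type*} [Fintype m] [DecidableEq m] {Y : Type*}
    [MeasurableSpace Y] {S : Y → Matrix m m ℝ} (hS : ∀ i j, Measurable fun y => S y i j)
    (hpos : ∀ y, (S y).PosSemidef) (i j : m) : Measurable fun y => CFC.sqrt (S y) i j := by
  let T := {f : m → m → ℝ // (Matrix.of f).PosSemidef}
  let g : T → (EuclideanSpace ℝ m →L[ℝ] EuclideanSpace ℝ m) := fun f =>
    Matrix.toEuclideanCLM (𝕜 := ℝ) (CFC.sqrt (Matrix.of f.1))
  let Lm : (m → m → ℝ) →ₗ[ℝ] (EuclideanSpace ℝ m →L[ℝ] EuclideanSpace ℝ m) :=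
    { toFun := fun f => Matrix.toEuclideanCLM (𝕜 := ℝ) (Matrix.of f)
      map_add' := fun f f' => map_add (Matrix.toEuclideanCLM (𝕜 := ℝ)) (Matrix.of f) (Matrix.of f')
      map_smul' := fun c f => map_smul (Matrix.toEuclideanCLM (𝕜 := ℝ)) c (Matrix.of f) }
  have hLm : Continuous Lm := Lm.continuous_of_finiteDimensional
  have hg : Continuous g := by
    rw [continuous_iff_continuousAt]
    intro f0
    rw [ContinuousAt, tendsto_iff_norm_sub_tendsto_zero]
    have hb : ∀ f : T, ‖g f - g f0‖ ≤ √‖Lm f.1 - Lm f0.1‖ := by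
      intro f
      refine ContinuousLinearMap.opNorm_le_bound _ (Real.sqrt_nonneg _) fun x => ?_
      have h := norm_sqrt_sub_sqrt_apply_sq_le f.2 f0.2 (δ := ‖Lm f.1 - Lm f0.1‖)
        (le_of_eq (by rw [map_sub]; rfl)) x
      have := Real.sqrt_le_sqrt h
      rwa [Real.sqrt_mul (norm_nonneg _), Real.sqrt_sq (norm_nonneg _),
        Real.sqrt_sq (norm_nonneg _)] at this
    refine squeeze_zero (fun _ => norm_nonneg _) hb ?_
    have hc : Continuous fun f : T => √‖Lm f.1 - Lm f0.1‖ :=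
      ((hLm.comp continuous_subtype_val).sub continuous_const).norm.sqrt
    have := hc.tendsto f0
    simpa using this
  have hent : ∀ f : T, CFC.sqrt (Matrix.of f.1) i j =
      inner ℝ (EuclideanSpace.single i (1 : ℝ)) (g f (EuclideanSpace.single j (1 : ℝ))) := by
    intro f
    simp only [g]
    rw [Matrix.inner_toEuclideanCLM]
    simp
  have hmeas : Measurable fun f : T => CFC.sqrt (Matrix.of f.1) i j := by
    have : Continuous fun f : T => CFC.sqrt (Matrix.of f.1) i j := by
      simp_rw [hent]
      exact continuous_const.inner (hg.clm_apply continuous_const)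
    exact this.measurable
  have hY : Measurable fun y => (⟨fun i j => S y i j, hpos y⟩ : T) :=
    Measurable.subtype_mk (measurable_pi_lambda _ fun i => measurable_pi_lambda _ fun j => hS i j)
  exact hmeas.comp hY

end CMI


namespace CMI

/-! ### Lindeberg's replacement method -/

section Lindeberg

variable {ι : Type*} [Fintype ι] {E E' : Type} [MeasurableSpace E] [MeasurableSpace E']

lemma pow_le_one_add_pow_three {x : ℝ} (hx : 0 ≤ x) : x ≤ 1 + x ^ 3 ∧ x ^ 2 ≤ 1 + x ^ 3 := by
  rcases le_total x 1 with h | h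
  · exact ⟨by nlinarith [pow_nonneg hx 3], by nlinarith [pow_nonneg hx 3]⟩
  · have h2 : 1 ≤ x ^ 2 := by nlinarith
    exact ⟨by nlinarith, by nlinarith⟩

lemma integrable_coord_of_cube {μ : Measure E} [IsProbabilityMeasure μ] {v : E → ι → ℝ}
    (hv : Measurable v) (h3 : Integrable (fun e => ‖v e‖ ^ 3) μ) (s : ι) :
    Integrable (fun e => v e s) μ := by
  refine ((integrable_const 1).add h3).mono' (by fun_prop) (ae_of_all _ fun e => ?_)
  exact (norm_le_pi_norm (v e) s).trans (pow_le_one_add_pow_three (norm_nonneg _)).1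

lemma integrable_coord_mul_of_cube {μ : Measure E} [IsProbabilityMeasure μ] {v : E → ι → ℝ}
    (hv : Measurable v) (h3 : Integrable (fun e => ‖v e‖ ^ 3) μ) (s t : ι) :
    Integrable (fun e => v e s * v e t) μ := by
  refine ((integrable_const 1).add h3).mono' (by fun_prop) (ae_of_all _ fun e => ?_)
  rw [norm_mul]
  refine le_trans ?_ (pow_le_one_add_pow_three (norm_nonneg (v e))).2
  rw [sq]
  exact mul_le_mul (norm_le_pi_norm _ _) (norm_le_pi_norm _ _) (norm_nonneg _) (norm_nonneg _)

lemma abs_integral_sub_taylor_le {f : (ι → ℝ) → ℝ} (hf : Measurable f) (hf1 : ∀ x, |f x| ≤ 1)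
    {Λ : ℝ} (x : ι → ℝ) (Lx : ι → ℝ) (Qx : ι → ι → ℝ)
    (h : ∀ v, |f (x + v) - f x - ∑ s, Lx s * v s - ∑ s, ∑ t, Qx s t * (v s * v t)| ≤ Λ * ‖v‖ ^ 3)
    {μ : Measure E} [IsProbabilityMeasure μ] {v : E → ι → ℝ} (hv : Measurable v)
    (h3 : Integrable (fun e => ‖v e‖ ^ 3) μ) :
    |∫ e, f (x + v e) ∂μ - (f x + ∑ s, Lx s * ∫ e, v e s ∂μ +
      ∑ s, ∑ t, Qx s t * ∫ e, v e s * v e t ∂μ)| ≤ Λ * ∫ e, ‖v e‖ ^ 3 ∂μ := by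
  have i0 : Integrable (fun e => f (x + v e)) μ :=
    (integrable_const (1 : ℝ)).mono'
      (hf.comp (by fun_prop : Measurable fun e => x + v e)).aestronglyMeasurable
      (ae_of_all _ fun e => hf1 _)
  have i1 : ∀ s, Integrable (fun e => Lx s * v e s) μ := fun s =>
    (integrable_coord_of_cube hv h3 s).const_mul _
  have i2 : ∀ s t, Integrable (fun e => Qx s t * (v e s * v e t)) μ := fun s t =>
    (integrable_coord_mul_of_cube hv h3 s t).const_mul _
  have j1 : Integrable (fun e => ∑ s, Lx s * v e s) μ := integrable_finsetSum _ fun s _ => i1 s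
  have j2 : Integrable (fun e => ∑ s, ∑ t, Qx s t * (v e s * v e t)) μ :=
    integrable_finsetSum _ fun s _ => integrable_finsetSum _ fun t _ => i2 s t
  have e1 : ∫ e, (f (x + v e) - f x - ∑ s, Lx s * v e s - ∑ s, ∑ t, Qx s t * (v e s * v e t)) ∂μ
      = ∫ e, f (x + v e) ∂μ - (f x + ∑ s, Lx s * ∫ e, v e s ∂μ +
        ∑ s, ∑ t, Qx s t * ∫ e, v e s * v e t ∂μ) := by
    have k1 : Integrable (fun e => f (x + v e) - f x) μ := i0.sub (integrable_const _)
    have k2 : Integrable (fun e => f (x + v e) - f x - ∑ s, Lx s * v e s) μ := k1.sub j1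
    rw [integral_sub k2 j2, integral_sub k1 j1, integral_sub i0 (integrable_const _),
      integral_finsetSum _ fun s _ => i1 s, integral_finsetSum _ fun s _ =>
        integrable_finsetSum _ fun t _ => i2 s t]
    simp_rw [integral_finsetSum _ fun t _ => i2 _ t, integral_const_mul]
    simp
    ring
  rw [← e1, ← integral_const_mul]
  refine (abs_integral_le_integral_abs).trans ?_
  refine integral_mono (((i0.sub (integrable_const _)).sub j1).sub j2).abs (h3.const_mul _) ?_
  exact fun e => h (v e)

/-- Replacement of one summand. -/
lemma abs_integral_replace_le {f : (ι → ℝ) → ℝ} (hf : Measurable f) (hf1 : ∀ x, |f x| ≤ 1)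
    {Λ : ℝ} (h : ∀ x, ∃ (Lx : ι → ℝ) (Qx : ι → ι → ℝ), ∀ v,
      |f (x + v) - f x - ∑ s, Lx s * v s - ∑ s, ∑ t, Qx s t * (v s * v t)| ≤ Λ * ‖v‖ ^ 3)
    {μ : Measure E} [IsProbabilityMeasure μ] {v : E → ι → ℝ} (hv : Measurable v)
    (h3 : Integrable (fun e => ‖v e‖ ^ 3) μ)
    {ν : Measure E'} [IsProbabilityMeasure ν] {v' : E' → ι → ℝ} (hv' : Measurable v')
    (h3' : Integrable (fun e => ‖v' e‖ ^ 3) ν)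
    (hm1 : ∀ s, ∫ e, v e s ∂μ = ∫ e, v' e s ∂ν)
    (hm2 : ∀ s t, ∫ e, v e s * v e t ∂μ = ∫ e, v' e s * v' e t ∂ν) (x : ι → ℝ) :
    |∫ e, f (x + v e) ∂μ - ∫ e, f (x + v' e) ∂ν| ≤
      Λ * (∫ e, ‖v e‖ ^ 3 ∂μ + ∫ e, ‖v' e‖ ^ 3 ∂ν) := by
  obtain ⟨Lx, Qx, hx⟩ := h x
  have a1 := abs_integral_sub_taylor_le hf hf1 x Lx Qx hx hv h3
  have a2 := abs_integral_sub_taylor_le hf hf1 x Lx Qx hx hv' h3'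
  simp_rw [← hm1, ← hm2] at a2
  rw [abs_le] at *
  constructor <;> linarith [a1.1, a1.2, a2.1, a2.2]

/-- Lindeberg's method: sums of independent vectors with the same first and second moments. -/
theorem abs_integral_sum_sub_le {f : (ι → ℝ) → ℝ} (hf : Measurable f) (hf1 : ∀ x, |f x| ≤ 1)
    {Λ : ℝ} (h : ∀ x, ∃ (Lx : ι → ℝ) (Qx : ι → ι → ℝ), ∀ v,
      |f (x + v) - f x - ∑ s, Lx s * v s - ∑ s, ∑ t, Qx s t * (v s * v t)| ≤ Λ * ‖v‖ ^ 3)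
    (n : ℕ) (μ : Fin n → Measure E) [∀ j, IsProbabilityMeasure (μ j)]
    (ν : Fin n → Measure E') [∀ j, IsProbabilityMeasure (ν j)]
    (v : Fin n → E → ι → ℝ) (v' : Fin n → E' → ι → ℝ)
    (hv : ∀ j, Measurable (v j)) (hv' : ∀ j, Measurable (v' j))
    (h3 : ∀ j, Integrable (fun e => ‖v j e‖ ^ 3) (μ j))
    (h3' : ∀ j, Integrable (fun e => ‖v' j e‖ ^ 3) (ν j))
    (hm1 : ∀ j s, ∫ e, v j e s ∂(μ j) = ∫ e, v' j e s ∂(ν j))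
    (hm2 : ∀ j s t, ∫ e, v j e s * v j e t ∂(μ j) = ∫ e, v' j e s * v' j e t ∂(ν j))
    (x : ι → ℝ) :
    |∫ e, f (x + ∑ j, v j (e j)) ∂(Measure.pi μ) - ∫ e, f (x + ∑ j, v' j (e j)) ∂(Measure.pi ν)| ≤
      Λ * ∑ j, (∫ e, ‖v j e‖ ^ 3 ∂(μ j) + ∫ e, ‖v' j e‖ ^ 3 ∂(ν j)) := by
  induction n generalizing x with
  | zero => simp
  | succ n ih =>
    have split : ∀ {F : Type} [MeasurableSpace F] (m : Fin (n + 1) → Measure F)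
        [∀ j, IsProbabilityMeasure (m j)] (u : Fin (n + 1) → F → ι → ℝ),
        (∀ j, Measurable (u j)) →
        ∫ e, f (x + ∑ j, u j (e j)) ∂(Measure.pi m) =
          ∫ p, f (x + u 0 p.1 + ∑ j, u (Fin.succ j) (p.2 j))
            ∂((m 0).prod (Measure.pi fun j : Fin n => m j.succ)) := by
      intro F _ m _ u hu
      have mp := measurePreserving_piFinSuccAbove m 0
      rw [← mp.symm.integral_comp (MeasurableEquiv.measurableEmbedding _)]
      refine integral_congr_ae (ae_of_all _ fun p => ?_)
      simp [MeasurableEquiv.piFinSuccAbove, Fin.sum_univ_succ, add_assoc]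
    rw [split μ v hv, split ν v' hv']
    let μr := fun j : Fin n => μ j.succ
    let νr := fun j : Fin n => ν j.succ
    have hbd : ∀ {F : Type} [MeasurableSpace F] {m : Measure F} [IsProbabilityMeasure m]
        {u : F → ι → ℝ}, Measurable u → Integrable (fun p => f (u p)) m := by
      intro F _ m _ u hu
      exact (integrable_const (1 : ℝ)).mono' (hf.comp hu).aestronglyMeasurable
        (ae_of_all _ fun e => hf1 _)
    -- The intermediate sum keeps the original first summand and replaces the others, which the
    -- induction hypothesis allows for each frozen value of the first. Then `s2` replaces the first
    -- summand, with the others frozen.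
    have s1 : |∫ p, f (x + v 0 p.1 + ∑ j : Fin n, v j.succ (p.2 j)) ∂((μ 0).prod (Measure.pi μr)) -
        ∫ p, f (x + v 0 p.1 + ∑ j : Fin n, v' j.succ (p.2 j)) ∂((μ 0).prod (Measure.pi νr))| ≤
        Λ * ∑ j : Fin n, (∫ e, ‖v j.succ e‖ ^ 3 ∂(μ j.succ) +
          ∫ e, ‖v' j.succ e‖ ^ 3 ∂(ν j.succ)) := by
      have b1 : Integrable (fun p : E × (Fin n → E) =>
          f (x + v 0 p.1 + ∑ j : Fin n, v j.succ (p.2 j))) ((μ 0).prod (Measure.pi μr)) :=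
        hbd (by fun_prop)
      have b2 : Integrable (fun p : E × (Fin n → E') =>
          f (x + v 0 p.1 + ∑ j : Fin n, v' j.succ (p.2 j))) ((μ 0).prod (Measure.pi νr)) :=
        hbd (by fun_prop)
      rw [integral_prod _ b1, integral_prod _ b2,
        ← integral_sub b1.integral_prod_left b2.integral_prod_left]
      refine abs_integral_le_integral_abs.trans ?_
      refine (integral_mono (b1.integral_prod_left.sub b2.integral_prod_left).abs
        (integrable_const _) fun e0 => ih μr νr (fun j => v j.succ) (fun j => v' j.succ)
          (fun j => hv _) (fun j => hv' _) (fun j => h3 _) (fun j => h3' _) (fun j => hm1 _)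
          (fun j => hm2 _) (x + v 0 e0)).trans (le_of_eq ?_)
      simp [μr, νr]
    have s2 : |∫ p, f (x + v 0 p.1 + ∑ j : Fin n, v' j.succ (p.2 j)) ∂((μ 0).prod (Measure.pi νr)) -
        ∫ p, f (x + v' 0 p.1 + ∑ j : Fin n, v' j.succ (p.2 j)) ∂((ν 0).prod (Measure.pi νr))| ≤
        Λ * (∫ e, ‖v 0 e‖ ^ 3 ∂(μ 0) + ∫ e, ‖v' 0 e‖ ^ 3 ∂(ν 0)) := by
      have b1 : Integrable (fun p : E × (Fin n → E') =>
          f (x + v 0 p.1 + ∑ j : Fin n, v' j.succ (p.2 j))) ((μ 0).prod (Measure.pi νr)) :=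
        hbd (by fun_prop)
      have b2 : Integrable (fun p : E' × (Fin n → E') =>
          f (x + v' 0 p.1 + ∑ j : Fin n, v' j.succ (p.2 j))) ((ν 0).prod (Measure.pi νr)) :=
        hbd (by fun_prop)
      rw [integral_prod_symm _ b1, integral_prod_symm _ b2,
        ← integral_sub b1.integral_prod_right b2.integral_prod_right]
      refine abs_integral_le_integral_abs.trans ?_
      refine (integral_mono (b1.integral_prod_right.sub b2.integral_prod_right).abs
        (integrable_const (Λ * (∫ e, ‖v 0 e‖ ^ 3 ∂(μ 0) + ∫ e, ‖v' 0 e‖ ^ 3 ∂(ν 0))))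
        fun r => ?_).trans (le_of_eq (by simp))
      have := abs_integral_replace_le hf hf1 h (hv 0) (h3 0) (hv' 0) (h3' 0) (hm1 0) (hm2 0)
        (x + ∑ j : Fin n, v' j.succ (r j))
      simp_rw [add_right_comm x (∑ j : Fin n, v' j.succ (r j))] at this
      exact this
    rw [Fin.sum_univ_succ, mul_add]
    calc _ = |(∫ p, f (x + v 0 p.1 + ∑ j : Fin n, v j.succ (p.2 j)) ∂((μ 0).prod (Measure.pi μr)) -
        ∫ p, f (x + v 0 p.1 + ∑ j : Fin n, v' j.succ (p.2 j)) ∂((μ 0).prod (Measure.pi νr))) +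
        (∫ p, f (x + v 0 p.1 + ∑ j : Fin n, v' j.succ (p.2 j)) ∂((μ 0).prod (Measure.pi νr)) -
        ∫ p, f (x + v' 0 p.1 + ∑ j : Fin n, v' j.succ (p.2 j)) ∂((ν 0).prod (Measure.pi νr)))| := by
          congr 1; ring
      _ ≤ _ := (abs_add_le _ _).trans ((add_le_add s1 s2).trans_eq (add_comm _ _))

end Lindeberg

end CMI


namespace CMI

/-! ### A smooth approximation of the maximum -/

/-- The mean value inequality is applied three times; the factor `1/6` is given away. -/
lemma abs_taylor_two_le {φ φ1 φ2 φ3 : ℝ → ℝ} {M : ℝ} (h0 : ∀ t, HasDerivAt φ (φ1 t) t)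
    (h1 : ∀ t, HasDerivAt φ1 (φ2 t) t) (h2 : ∀ t, HasDerivAt φ2 (φ3 t) t)
    (hM : ∀ t, |φ3 t| ≤ M) : |φ 1 - φ 0 - φ1 0 - φ2 0 / 2| ≤ M := by
  have hM0 : 0 ≤ M := (abs_nonneg _).trans (hM 0)
  have mv : ∀ {f f' : ℝ → ℝ}, (∀ t, HasDerivAt f (f' t) t) → (∀ t, 0 ≤ t → t ≤ 1 → |f' t| ≤ M) →
      ∀ t, 0 ≤ t → t ≤ 1 → |f t - f 0| ≤ M := by
    intro f f' hf hb t ht0 ht1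
    have := norm_image_sub_le_of_norm_deriv_le_segment' (f := f) (f' := f') (C := M) (a := 0)
      (b := 1) (fun x _ => (hf x).hasDerivWithinAt) (fun x hx => hb x hx.1 hx.2.le) t ⟨ht0, ht1⟩
    rw [Real.norm_eq_abs] at this
    exact this.trans (by nlinarith)
  have s2 := mv h2 fun t _ _ => hM t
  have s1 := mv (f := fun t => φ1 t - t * φ2 0) (f' := fun t => φ2 t - 1 * φ2 0)
    (fun t => (h1 t).sub ((hasDerivAt_id t).mul_const _))
    (fun t a b => by simpa using s2 t a b)
  have s0 := mv (f := fun t => φ t - t * φ1 0 - t ^ 2 / 2 * φ2 0)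
    (f' := fun t => φ1 t - 1 * φ1 0 - t * φ2 0)
    (fun t => by
      have e : HasDerivAt (fun t : ℝ => t ^ 2 / 2 * φ2 0) (t * φ2 0) t := by
        have := ((hasDerivAt_pow 2 t).div_const 2).mul_const (φ2 0)
        exact this.congr_deriv (by norm_num)
      exact ((h0 t).sub ((hasDerivAt_id t).mul_const _)).sub e)
    (fun t a b => by
      have := s1 t a b
      simp only [zero_mul, sub_zero] at this
      rwa [show φ1 t - 1 * φ1 0 - t * φ2 0 = φ1 t - t * φ2 0 - φ1 0 by ring])
  have := s0 1 zero_le_one le_rfl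
  rwa [show φ 1 - 1 * φ1 0 - 1 ^ 2 / 2 * φ2 0 - (φ 0 - 0 * φ1 0 - 0 ^ 2 / 2 * φ2 0) =
    φ 1 - φ 0 - φ1 0 - φ2 0 / 2 by ring] at this

section LogSumExp

variable {ι : Type*} [Fintype ι]

/-- `log ∑ exp`, a smooth upper approximation of the maximum. -/
noncomputable def logSumExp (x : ι → ℝ) : ℝ := Real.log (∑ s, Real.exp (x s))

lemma continuous_logSumExp [Nonempty ι] : Continuous (logSumExp (ι := ι)) := by
  refine Continuous.log (by fun_prop) fun x => ?_
  exact (Finset.sum_pos (fun s _ => Real.exp_pos _) Finset.univ_nonempty).ne'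

lemma le_logSumExp (x : ι → ℝ) (s : ι) : x s ≤ logSumExp x := by
  rw [logSumExp, Real.le_log_iff_exp_le]
  · exact Finset.single_le_sum (f := fun s => Real.exp (x s)) (fun t _ => (Real.exp_pos _).le)
      (Finset.mem_univ s)
  · exact Finset.sum_pos (fun s _ => Real.exp_pos _) ⟨s, Finset.mem_univ s⟩

lemma logSumExp_le [Nonempty ι] (x : ι → ℝ) {M : ℝ} (h : ∀ s, x s ≤ M) :
    logSumExp x ≤ M + Real.log (Fintype.card ι) := by
  have hc : (0 : ℝ) < Fintype.card ι := by exact_mod_cast Fintype.card_pos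
  rw [logSumExp, Real.log_le_iff_le_exp
    (Finset.sum_pos (fun s _ => Real.exp_pos _) Finset.univ_nonempty), Real.exp_add,
    Real.exp_log hc]
  calc _ ≤ ∑ _s : ι, Real.exp M := Finset.sum_le_sum fun s _ => Real.exp_le_exp.2 (h s)
    _ = _ := by simp [mul_comm]

/-- Third-order expansion of a smooth function of `logSumExp`. -/
lemma logSumExp_taylor [Nonempty ι] {G G1 G2 G3 : ℝ → ℝ} {K1 K2 K3 : ℝ}
    (h0 : ∀ t, HasDerivAt G (G1 t) t) (h1 : ∀ t, HasDerivAt G1 (G2 t) t)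
    (h2 : ∀ t, HasDerivAt G2 (G3 t) t) (b1 : ∀ t, |G1 t| ≤ K1) (b2 : ∀ t, |G2 t| ≤ K2)
    (b3 : ∀ t, |G3 t| ≤ K3) (x : ι → ℝ) :
    ∃ (L : ι → ℝ) (Q : ι → ι → ℝ), ∀ v : ι → ℝ,
      |G (logSumExp (x + v)) - G (logSumExp x) - ∑ s, L s * v s -
        ∑ s, ∑ t, Q s t * (v s * v t)| ≤ (K3 + 6 * K2 + 6 * K1) * ‖v‖ ^ 3 := by
  classical
  let p : ι → ℝ := fun s => Real.exp (x s) / ∑ t, Real.exp (x t)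
  let g1 := G1 (logSumExp x)
  let g2 := G2 (logSumExp x)
  -- The gradient and half the Hessian of `G ∘ logSumExp`: with Gibbs weights `p` the gradient of
  -- `logSumExp` is `p`, its Hessian `diag p - p pᵀ`.
  refine ⟨fun s => g1 * p s,
    fun s t => ((g2 - g1) * (p s * p t) + if s = t then g1 * p s else 0) / 2, fun v => ?_⟩
  -- Along the segment from `x` to `x + v` the quotients `m k = N k / N 0` are the moments of the
  -- coordinates of `v` under the tilted Gibbs weights; all derivatives are polynomials in them.
  let N : ℕ → ℝ → ℝ := fun k t => ∑ s, v s ^ k * Real.exp (x s + t * v s)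
  have hN0 : ∀ t, 0 < N 0 t := fun t =>
    Finset.sum_pos (fun s _ => by positivity) Finset.univ_nonempty
  have hN : ∀ k t, HasDerivAt (N k) (N (k + 1) t) t := by
    intro k t
    have : ∀ s ∈ Finset.univ, HasDerivAt (fun t : ℝ => v s ^ k * Real.exp (x s + t * v s))
        (v s ^ (k + 1) * Real.exp (x s + t * v s)) t := by
      intro s _
      have h := ((((hasDerivAt_id t).mul_const (v s)).const_add (x s)).exp).const_mul (v s ^ k)
      exact h.congr_deriv (by simp only [id, one_mul]; ring)
    exact HasDerivAt.fun_sum this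
  let m : ℕ → ℝ → ℝ := fun k t => N k t / N 0 t
  have hm : ∀ k t, HasDerivAt (m k) (m (k + 1) t - m k t * m 1 t) t := by
    intro k t
    have h := (hN k t).div (hN 0 t) (hN0 t).ne'
    have := (hN0 t).ne'
    refine h.congr_deriv ?_
    simp only [m, zero_add]
    field_simp
  -- Averages are bounded by the sup norm, whatever the number of coordinates: this makes the
  -- approximation insensitive to the dimension.
  have hmb : ∀ k t, |m k t| ≤ ‖v‖ ^ k := by
    intro k t
    simp only [m]
    rw [abs_div, abs_of_pos (hN0 t), div_le_iff₀ (hN0 t)]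
    refine (Finset.abs_sum_le_sum_abs _ _).trans ?_
    simp only [N]
    rw [Finset.mul_sum]
    refine Finset.sum_le_sum fun s _ => ?_
    rw [abs_mul, abs_pow, abs_of_pos (Real.exp_pos _), pow_zero, one_mul]
    gcongr
    exact norm_le_pi_norm v s
  let ψ : ℝ → ℝ := fun t => logSumExp (x + t • v)
  have hψN : ψ = fun t => Real.log (N 0 t) := by
    funext t; simp [ψ, logSumExp, N]
  have hψ : ∀ t, HasDerivAt ψ (m 1 t) t := by
    intro t
    rw [hψN]
    exact (hN 0 t).log (hN0 t).ne'
  let w : ℝ → ℝ := fun t => m 2 t - m 1 t * m 1 t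
  let z : ℝ → ℝ := fun t => m 3 t - m 2 t * m 1 t -
    ((m 2 t - m 1 t * m 1 t) * m 1 t + m 1 t * (m 2 t - m 1 t * m 1 t))
  have hw : ∀ t, HasDerivAt w (z t) t := fun t => (hm 2 t).sub ((hm 1 t).mul (hm 1 t))
  have t0 : ∀ t, HasDerivAt (fun t => G (ψ t)) (G1 (ψ t) * m 1 t) t := fun t =>
    (h0 (ψ t)).comp t (hψ t)
  have t1 : ∀ t, HasDerivAt (fun t => G1 (ψ t) * m 1 t)
      (G2 (ψ t) * m 1 t * m 1 t + G1 (ψ t) * w t) t := fun t =>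
    ((h1 (ψ t)).comp t (hψ t)).mul (hm 1 t)
  have t2 : ∀ t, HasDerivAt (fun t => G2 (ψ t) * m 1 t * m 1 t + G1 (ψ t) * w t)
      ((G3 (ψ t) * m 1 t * m 1 t + G2 (ψ t) * w t) * m 1 t + G2 (ψ t) * m 1 t * w t +
        (G2 (ψ t) * m 1 t * w t + G1 (ψ t) * z t)) t := fun t =>
    ((((h2 (ψ t)).comp t (hψ t)).mul (hm 1 t)).mul (hm 1 t)).add
      (((h1 (ψ t)).comp t (hψ t)).mul (hw t))
  have hK1 : 0 ≤ K1 := (abs_nonneg _).trans (b1 0)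
  have hK2 : 0 ≤ K2 := (abs_nonneg _).trans (b2 0)
  have hK3 : 0 ≤ K3 := (abs_nonneg _).trans (b3 0)
  -- The third derivative is `G₃ m₁³ + 3 G₂ w m₁ + G₁ z`, where `w` and `z` are the second and third
  -- cumulants, with `|w| ≤ 2 ‖v‖²` and `|z| ≤ 6 ‖v‖³`.
  have key := abs_taylor_two_le t0 t1 t2 (M := (K3 + 6 * K2 + 6 * K1) * ‖v‖ ^ 3) (fun t => by
    set r := ‖v‖ with hr
    have hr0 : 0 ≤ r := norm_nonneg v
    have m1 := hmb 1 t
    have m2 := hmb 2 t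
    have m3 := hmb 3 t
    rw [pow_one] at m1
    have m11 : |m 1 t * m 1 t| ≤ r ^ 2 := by
      rw [abs_mul, sq]; exact mul_le_mul m1 m1 (abs_nonneg _) hr0
    have hwb : |w t| ≤ 2 * r ^ 2 := (abs_sub _ _).trans (by linarith)
    have hw1 : |w t * m 1 t| ≤ 2 * r ^ 3 := by
      rw [abs_mul]
      calc |w t| * |m 1 t| ≤ 2 * r ^ 2 * r := mul_le_mul hwb m1 (abs_nonneg _) (by positivity)
        _ = 2 * r ^ 3 := by ring
    have m21 : |m 2 t * m 1 t| ≤ r ^ 3 := by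
      rw [abs_mul]
      calc |m 2 t| * |m 1 t| ≤ r ^ 2 * r := mul_le_mul m2 m1 (abs_nonneg _) (by positivity)
        _ = r ^ 3 := by ring
    have m111 : |m 1 t * m 1 t * m 1 t| ≤ r ^ 3 := by
      rw [abs_mul]
      calc |m 1 t * m 1 t| * |m 1 t| ≤ r ^ 2 * r :=
            mul_le_mul m11 m1 (abs_nonneg _) (by positivity)
        _ = r ^ 3 := by ring
    have hz : |z t| ≤ 6 * r ^ 3 := by
      have : z t = m 3 t - m 2 t * m 1 t - 2 * (w t * m 1 t) := by simp only [z, w]; ring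
      rw [this]
      refine (abs_sub _ _).trans ?_
      have := abs_sub (m 3 t) (m 2 t * m 1 t)
      rw [abs_mul 2, abs_two]
      linarith
    have e : (G3 (ψ t) * m 1 t * m 1 t + G2 (ψ t) * w t) * m 1 t + G2 (ψ t) * m 1 t * w t +
        (G2 (ψ t) * m 1 t * w t + G1 (ψ t) * z t) =
        G3 (ψ t) * (m 1 t * m 1 t * m 1 t) + 3 * (G2 (ψ t) * (w t * m 1 t)) + G1 (ψ t) * z t := by
      ring
    rw [e]
    have a3 : |G3 (ψ t) * (m 1 t * m 1 t * m 1 t)| ≤ K3 * r ^ 3 := by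
      rw [abs_mul]; exact mul_le_mul (b3 _) m111 (abs_nonneg _) hK3
    have a2 : |G2 (ψ t) * (w t * m 1 t)| ≤ K2 * (2 * r ^ 3) := by
      rw [abs_mul]; exact mul_le_mul (b2 _) hw1 (abs_nonneg _) hK2
    have a1 : |G1 (ψ t) * z t| ≤ K1 * (6 * r ^ 3) := by
      rw [abs_mul]; exact mul_le_mul (b1 _) hz (abs_nonneg _) hK1
    refine (abs_add_le _ _).trans ?_
    have := abs_add_le (G3 (ψ t) * (m 1 t * m 1 t * m 1 t)) (3 * (G2 (ψ t) * (w t * m 1 t)))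
    rw [abs_mul 3, abs_of_pos (three_pos : (0 : ℝ) < 3)] at this
    nlinarith)
  have hψ0 : ψ 0 = logSumExp x := by simp [ψ]
  have hψ1 : ψ 1 = logSumExp (x + v) := by simp [ψ]
  have hN00 : N 0 0 = ∑ t, Real.exp (x t) := by simp [N]
  have hm0 : ∀ k, m k 0 = ∑ s, p s * v s ^ k := by
    intro k
    simp only [m, p, hN00]
    rw [Finset.sum_div]
    refine Finset.sum_congr rfl fun s _ => ?_
    simp only [zero_mul, add_zero]
    ring
  have eL : ∑ s, g1 * p s * v s = G1 (ψ 0) * m 1 0 := by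
    rw [hm0, hψ0, Finset.mul_sum]
    exact Finset.sum_congr rfl fun s _ => by simp only [g1]; ring
  have eQ : ∑ s, ∑ t, ((g2 - g1) * (p s * p t) + if s = t then g1 * p s else 0) / 2 * (v s * v t)
      = (G2 (ψ 0) * m 1 0 * m 1 0 + G1 (ψ 0) * w 0) / 2 := by
    have e1 : ∀ s t, ((g2 - g1) * (p s * p t) + if s = t then g1 * p s else 0) / 2 * (v s * v t)
        = (g2 - g1) / 2 * ((p s * v s) * (p t * v t)) +
          if s = t then g1 / 2 * (p s * v s ^ 2) else 0 := by
      intro s t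
      split_ifs with h
      · subst h; ring
      · ring
    simp_rw [e1, Finset.sum_add_distrib, Finset.sum_ite_eq, Finset.mem_univ, if_true,
      ← Finset.mul_sum, ← Finset.sum_mul]
    simp only [w, hψ0]
    rw [hm0 1, hm0 2]
    simp only [pow_one, g1, g2]
    ring
  rw [eL, eQ]
  have e0 : G (logSumExp x) = G (ψ 0) := by rw [hψ0]
  rw [← hψ1, e0]
  exact key

end LogSumExp

end CMI


namespace CMI

/-! ### Finite maxima -/

section MaxOver

variable {ι : Type} {A : Finset ι} {r r' : ι → ℝ}

lemma le_maxOver {s : ι} (hs : s ∈ A) : r s ≤ maxOver A r := by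
  rw [maxOver, dif_pos ⟨s, hs⟩]
  exact Finset.le_sup' r hs

lemma maxOver_le (hA : A.Nonempty) {M : ℝ} (h : ∀ s ∈ A, r s ≤ M) : maxOver A r ≤ M := by
  rw [maxOver, dif_pos hA]
  exact Finset.sup'_le hA r h

lemma maxOver_le_iff (hA : A.Nonempty) {M : ℝ} : maxOver A r ≤ M ↔ ∀ s ∈ A, r s ≤ M :=
  ⟨fun h _ hs => (le_maxOver hs).trans h, maxOver_le hA⟩

lemma lt_maxOver_iff (hA : A.Nonempty) {M : ℝ} : M < maxOver A r ↔ ∃ s ∈ A, M < r s := by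
  rw [← not_le, maxOver_le_iff hA]
  push Not
  rfl

lemma maxOver_le_add (hA : A.Nonempty) {δ : ℝ} (h : ∀ s ∈ A, r s ≤ r' s + δ) :
    maxOver A r ≤ maxOver A r' + δ :=
  maxOver_le hA fun s hs => (h s hs).trans (by linarith [le_maxOver (r := r') hs])

lemma maxOver_mono {B : Finset ι} (hA : A.Nonempty) (h : A ⊆ B) : maxOver A r ≤ maxOver B r :=
  maxOver_le hA fun _ hs => le_maxOver (h hs)

lemma measurable_maxOver {Ω : Type*} [MeasurableSpace Ω] {X : ι → Ω → ℝ}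
    (hX : ∀ s ∈ A, Measurable (X s)) : Measurable fun ω => maxOver A fun s => X s ω := by
  rcases A.eq_empty_or_nonempty with rfl | hA
  · simp [maxOver]
  · refine measurable_of_Iic fun a => ?_
    have : (fun ω => maxOver A fun s => X s ω) ⁻¹' Set.Iic a = ⋂ s ∈ A, {ω | X s ω ≤ a} := by
      ext ω
      simp only [Set.mem_preimage, Set.mem_Iic, maxOver_le_iff hA, Set.mem_iInter]
      rfl
    rw [this]
    exact Finset.measurableSet_biInter _ fun s hs => measurableSet_le (hX s hs) measurable_const

end MaxOver

lemma abs_sub_le_of_abs_sub_le {a b a' b' x y z : ℝ} (h1 : |a - b| ≤ x) (h2 : |a' - b'| ≤ y)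
    (h3 : |a - a'| ≤ z) : |b - b'| ≤ x + y + z := by
  rw [abs_le] at *
  constructor <;> linarith [h1.1, h1.2, h2.1, h2.2, h3.1, h3.2]

/-! ### The test function -/

/-- The shape of the functions that generate the randomized tests. -/
def IsTestFunction (g : ℝ → ℝ) : Prop :=
  ContDiff ℝ 2 g ∧ Antitone g ∧ (∀ x ≤ 0, g x = 1) ∧ ∀ x, 1 ≤ x → g x = 0

namespace IsTestFunction

variable {g : ℝ → ℝ} (hg : IsTestFunction g)

include hg

lemma continuous : Continuous g := hg.1.continuous

lemma antitone : Antitone g := hg.2.1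

lemma nonneg (x : ℝ) : 0 ≤ g x := by
  rw [← hg.2.2.2 (max x 1) (le_max_right _ _)]
  exact hg.2.1 (le_max_left _ _)

lemma le_one (x : ℝ) : g x ≤ 1 := by
  rw [← hg.2.2.1 (min x 0) (min_le_right _ _)]
  exact hg.2.1 (min_le_left _ _)

lemma abs_le_one (x : ℝ) : |g x| ≤ 1 := by
  rw [abs_of_nonneg (hg.nonneg x)]; exact hg.le_one x

/-- Moving averages of a test function are close to it and have three bounded derivatives. -/
lemma exists_smoothing : ∃ D : ℝ, 0 ≤ D ∧ (∀ x y, |g x - g y| ≤ D * |x - y|) ∧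
    ∀ θ : ℝ, 0 < θ → ∃ (G G1 G2 G3 : ℝ → ℝ) (K : ℝ), 0 ≤ K ∧ (∀ t, HasDerivAt G (G1 t) t) ∧
      (∀ t, HasDerivAt G1 (G2 t) t) ∧ (∀ t, HasDerivAt G2 (G3 t) t) ∧ (∀ t, |G1 t| ≤ K) ∧
      (∀ t, |G2 t| ≤ K) ∧ (∀ t, |G3 t| ≤ K) ∧ (∀ t, |G t| ≤ 1) ∧ ∀ t, |G t - g t| ≤ D * θ := by
  obtain ⟨hC, -, hl, hr⟩ := id hg
  have hC1 : ContDiff ℝ 1 (deriv g) := (contDiff_succ_iff_deriv (n := 1)).1 hC |>.2.2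
  have hd1 : ∀ x, HasDerivAt g (deriv g x) x := fun x =>
    (hC.differentiable (by norm_num) x).hasDerivAt
  have hd2 : ∀ x, HasDerivAt (deriv g) (deriv (deriv g) x) x := fun x =>
    (hC1.differentiable (by norm_num) x).hasDerivAt
  have hc2 : Continuous (deriv (deriv g)) := hC1.continuous_deriv (by norm_num)
  -- The function is constant on both sides of `[0, 1]`, so its first two derivatives have compact
  -- support and are bounded.
  have hz1 : ∀ x ∉ Set.Icc (0 : ℝ) 1, deriv g =ᶠ[𝓝 x] fun _ => 0 := by
    intro x hx
    rw [Set.mem_Icc, not_and_or, not_le, not_le] at hx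
    rcases hx with h | h
    · filter_upwards [Iio_mem_nhds h] with y hy
      have : g =ᶠ[𝓝 y] fun _ => 1 := by
        filter_upwards [Iio_mem_nhds hy] with z hz using hl z (le_of_lt hz)
      rw [this.deriv_eq]; simp
    · filter_upwards [Ioi_mem_nhds h] with y hy
      have : g =ᶠ[𝓝 y] fun _ => 0 := by
        filter_upwards [Ioi_mem_nhds hy] with z hz using hr z (le_of_lt hz)
      rw [this.deriv_eq]; simp
  obtain ⟨D1, hD1⟩ := hC1.continuous.bounded_above_of_compact_support
    (HasCompactSupport.intro isCompact_Icc fun x hx => (hz1 x hx).eq_of_nhds)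
  obtain ⟨D2, hD2⟩ := hc2.bounded_above_of_compact_support
    (HasCompactSupport.intro isCompact_Icc fun x hx => by
      have := (hz1 x hx).deriv_eq; simpa using this)
  have h10 : 0 ≤ D1 := (norm_nonneg _).trans (hD1 0)
  have h20 : 0 ≤ D2 := (norm_nonneg _).trans (hD2 0)
  have lip : ∀ {f f' : ℝ → ℝ} {M : ℝ}, (∀ x, HasDerivAt f (f' x) x) → (∀ x, ‖f' x‖ ≤ M) →
      ∀ x y, |f x - f y| ≤ M * |x - y| := by
    intro f f' M h hM x y
    have := Convex.norm_image_sub_le_of_norm_hasDerivWithin_le (f := f) (f' := f') (s := Set.univ)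
      (fun x _ => (h x).hasDerivWithinAt) (fun x _ => hM x) convex_univ (Set.mem_univ y)
      (Set.mem_univ x)
    simpa using this
  refine ⟨D1, h10, lip hd1 hD1, fun θ hθ => ?_⟩
  -- The average of `g` over `[x, x + θ]` is a difference quotient of the primitive `P`. It gains
  -- the third derivative that Lindeberg's method needs, at the price of a bound of order `1 / θ`.
  let P : ℝ → ℝ := fun x => ∫ t in (0 : ℝ)..x, g t
  have hP : ∀ x, HasDerivAt P (g x) x := fun x =>
    (hg.continuous.integral_hasStrictDerivAt 0 x).hasDerivAt
  have hsh : ∀ {f f' : ℝ → ℝ}, (∀ x, HasDerivAt f (f' x) x) →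
      ∀ t, HasDerivAt (fun x => (f (x + θ) - f x) / θ) ((f' (t + θ) - f' t) / θ) t := by
    intro f f' h t
    exact (((h (t + θ)).comp_add_const t θ).sub (h t)).div_const θ
  -- By the mean value theorem the average is a value of `g` at a point within `θ`, which yields
  -- both the bound by one and the closeness to `g`.
  have hslope : ∀ t, ∃ ξ, |ξ - t| ≤ θ ∧ (P (t + θ) - P t) / θ = g ξ := by
    intro t
    obtain ⟨ξ, hξ, h⟩ := exists_hasDerivAt_eq_slope P g (show t < t + θ by linarith)
      (fun x _ => (hP x).continuousAt.continuousWithinAt) (fun x _ => hP x)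
    refine ⟨ξ, ?_, ?_⟩
    · rw [abs_le]; constructor <;> linarith [hξ.1, hξ.2]
    · rw [h]; simp
  have hdq : ∀ {f : ℝ → ℝ} {M : ℝ}, (∀ x y, |f x - f y| ≤ M * |x - y|) →
      ∀ t, |(f (t + θ) - f t) / θ| ≤ M := by
    intro f M h t
    rw [abs_div, abs_of_pos hθ, div_le_iff₀ hθ]
    have := h (t + θ) t
    simpa [abs_of_pos hθ] using this
  refine ⟨fun x => (P (x + θ) - P x) / θ, fun x => (g (x + θ) - g x) / θ,
    fun x => (deriv g (x + θ) - deriv g x) / θ,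
    fun x => (deriv (deriv g) (x + θ) - deriv (deriv g) x) / θ, D1 + D2 + 2 * D2 / θ,
    by positivity, hsh hP, hsh hd1, hsh hd2, fun t => ?_, fun t => ?_, fun t => ?_, fun t => ?_,
    fun t => ?_⟩
  · have : 0 ≤ 2 * D2 / θ := by positivity
    linarith [hdq (lip hd1 hD1) t]
  · have : 0 ≤ 2 * D2 / θ := by positivity
    linarith [hdq (lip hd2 hD2) t]
  · have h1 : |(deriv (deriv g) (t + θ) - deriv (deriv g) t) / θ| ≤ 2 * D2 / θ := by
      rw [abs_div, abs_of_pos hθ]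
      gcongr
      have a1 := hD2 (t + θ)
      have a2 := hD2 t
      rw [Real.norm_eq_abs] at a1 a2
      exact (abs_sub _ _).trans (by linarith)
    linarith
  · obtain ⟨ξ, -, h⟩ := hslope t
    simp only [h]
    exact hg.abs_le_one ξ
  · obtain ⟨ξ, hξ, h⟩ := hslope t
    simp only [h]
    exact (lip hd1 hD1 ξ t).trans (by gcongr)

/-- Comparison of the smoothed distribution functions of maxima of two sums of independent
random vectors with the same first and second moments. -/
theorem exists_abs_integral_max_sub_le {η : ℝ} (hη : 0 < η) : ∃ K : ℝ, 0 ≤ K ∧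
    ∀ {ι : Type} (A : Finset ι), A.Nonempty → ∀ {β ℓ : ℝ}, 0 < β → 1 ≤ ℓ →
      Real.log A.card ≤ ℓ → ∀ {E E' : Type} [MeasurableSpace E] [MeasurableSpace E'] (n : ℕ)
      (μ : Fin n → Measure E) [∀ j, IsProbabilityMeasure (μ j)]
      (ν : Fin n → Measure E') [∀ j, IsProbabilityMeasure (ν j)]
      (u : Fin n → E → ι → ℝ) (u' : Fin n → E' → ι → ℝ) (b : Fin n → E → ℝ) (b' : Fin n → E' → ℝ),
      (∀ j, ∀ s ∈ A, Measurable fun e => u j e s) → (∀ j, ∀ s ∈ A, Measurable fun e => u' j e s) →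
      (∀ j e, ∀ s ∈ A, |u j e s| ≤ b j e) → (∀ j e, ∀ s ∈ A, |u' j e s| ≤ b' j e) →
      (∀ j, Integrable (fun e => b j e ^ 3) (μ j)) →
      (∀ j, Integrable (fun e => b' j e ^ 3) (ν j)) →
      (∀ j, ∀ s ∈ A, ∫ e, u j e s ∂(μ j) = ∫ e, u' j e s ∂(ν j)) →
      (∀ j, ∀ s ∈ A, ∀ t ∈ A, ∫ e, u j e s * u j e t ∂(μ j) = ∫ e, u' j e s * u' j e t ∂(ν j)) →
      ∀ c : ℝ,
      |∫ e, g ((maxOver A (fun s => ∑ j, u j (e j) s) - c) / β) ∂(Measure.pi μ) -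
        ∫ e, g ((maxOver A (fun s => ∑ j, u' j (e j) s) - c) / β) ∂(Measure.pi ν)| ≤
      η + K * (ℓ ^ 2 / β ^ 3 * ∑ j, (∫ e, b j e ^ 3 ∂(μ j) + ∫ e, b' j e ^ 3 ∂(ν j))) := by
  obtain ⟨D, hD0, hLip, hsm⟩ := hg.exists_smoothing
  -- Smoothing `g` at width `1 / R` and replacing the maximum by log-sum-exp each change the value
  -- by at most `D / R ≤ η / 4`. Both laws incur both errors, in total `η`.
  set R : ℝ := max 1 (4 * D / η) with hR
  have hR1 : 1 ≤ R := le_max_left _ _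
  have hR0 : 0 < R := by linarith
  have hRD : D / R ≤ η / 4 := by
    rw [div_le_iff₀ hR0]
    have : 4 * D / η ≤ R := le_max_right _ _
    rw [div_le_iff₀ hη] at this
    linarith
  obtain ⟨G, G1, G2, G3, K, hK0, h0, h1, h2, b1, b2, b3, hG1, hGg⟩ := hsm R⁻¹ (by positivity)
  refine ⟨13 * K * R ^ 2, by positivity, ?_⟩
  intro ι A hA β ℓ hβ hℓ hlog E E' _ _ n μ _ ν _ u u' b b' hu hu' hub hub' hb hb' hm1 hm2 c
  have : Nonempty A := hA.to_subtype
  -- At inverse temperature `lam` log-sum-exp exceeds the maximum by at most `ℓ / lam = β / R`, that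
  -- is by `1 / R` on the scale `β`.
  set lam : ℝ := R * ℓ / β with hlam
  have hlam0 : 0 < lam := by positivity
  have hlb : lam * β = R * ℓ := by rw [hlam]; field_simp
  have hRl : 1 ≤ R * ℓ := by nlinarith
  -- the smooth functional
  let a : ℝ := (lam * β)⁻¹
  have ha0 : 0 < a := by simp only [a]; positivity
  have ha1 : a ≤ 1 := by simp only [a, hlb]; exact inv_le_one_of_one_le₀ hRl
  let q : ℝ → ℝ := fun y => a * y - c / β
  have hq : ∀ t, HasDerivAt q a t := fun t => by
    exact (((hasDerivAt_id t).const_mul a).sub_const (c / β)).congr_deriv (by simp)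
  let f : (A → ℝ) → ℝ := fun x => G (q (logSumExp (lam • x)))
  have hGc : Continuous G := continuous_iff_continuousAt.2 fun t => (h0 t).continuousAt
  have hf : Measurable f := by
    have : Continuous f := hGc.comp ((continuous_const.mul
      (continuous_logSumExp.comp (continuous_const_smul lam))).sub continuous_const)
    exact this.measurable
  have hscale : ∀ {M : ℝ → ℝ}, (∀ t, |M t| ≤ K) → ∀ t, |M (q t) * a| ≤ a * K := by
    intro M hM t
    rw [abs_mul, abs_of_pos ha0, mul_comm]
    exact mul_le_mul_of_nonneg_left (hM _) ha0.le
  -- Each derivative in the outer variable brings a factor `a = 1 / (R ℓ) ≤ 1`, of which only one is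
  -- kept. Rescaling by `lam` gives `13 K a lam³ = 13 K R² ℓ² / β³`, with `13 = 1 + 6 + 6`.
  have htay : ∀ x, ∃ (L : A → ℝ) (Q : A → A → ℝ), ∀ v,
      |f (x + v) - f x - ∑ s, L s * v s - ∑ s, ∑ t, Q s t * (v s * v t)| ≤
        (13 * K * R ^ 2 * (ℓ ^ 2 / β ^ 3)) * ‖v‖ ^ 3 := by
    intro x
    have hdG : ∀ t, HasDerivAt (fun y => G (q y)) (G1 (q t) * a) t := fun t =>
      (h0 (q t)).comp t (hq t)
    have hdG1 : ∀ t, HasDerivAt (fun y => G1 (q y) * a) (G2 (q t) * a * a) t := fun t =>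
      ((h1 (q t)).comp t (hq t)).mul_const a
    have hdG2 : ∀ t, HasDerivAt (fun y => G2 (q y) * a * a) (G3 (q t) * a * a * a) t := fun t =>
      (((h2 (q t)).comp t (hq t)).mul_const a).mul_const a
    have hb2 : ∀ t, |G2 (q t) * a * a| ≤ a * K := fun t => by
      rw [abs_mul, abs_of_pos ha0]
      have := hscale b2 t
      calc |G2 (q t) * a| * a ≤ |G2 (q t) * a| * 1 := by gcongr
        _ ≤ a * K := by linarith
    have hb3 : ∀ t, |G3 (q t) * a * a * a| ≤ a * K := fun t => by
      rw [abs_mul, abs_mul, abs_of_pos ha0]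
      have := hscale b3 t
      calc |G3 (q t) * a| * a * a ≤ |G3 (q t) * a| * 1 * 1 := by gcongr
        _ ≤ a * K := by linarith
    obtain ⟨L, Q, hLQ⟩ := logSumExp_taylor hdG hdG1 hdG2 (hscale b1) hb2 hb3 (lam • x)
    refine ⟨fun s => L s * lam, fun s t => Q s t * lam ^ 2, fun v => ?_⟩
    have := hLQ (lam • v)
    rw [← smul_add, norm_smul, Real.norm_eq_abs, abs_of_pos hlam0] at this
    have eL : ∑ s, L s * (lam • v) s = ∑ s, L s * lam * v s :=
      Finset.sum_congr rfl fun s _ => by simp [mul_assoc]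
    have eQ : ∑ s, ∑ t, Q s t * ((lam • v) s * (lam • v) t) =
        ∑ s, ∑ t, Q s t * lam ^ 2 * (v s * v t) :=
      Finset.sum_congr rfl fun s _ => Finset.sum_congr rfl fun t _ => by
        simp only [Pi.smul_apply, smul_eq_mul]; ring
    rw [eL, eQ] at this
    refine this.trans (le_of_eq ?_)
    simp only [a]
    rw [hlam]
    field_simp
    ring
  have hfg : ∀ x : ι → ℝ, |f (fun s => x s) - g ((maxOver A x - c) / β)| ≤ η / 2 := by
    intro x
    have l1 : lam * maxOver A x ≤ logSumExp (lam • fun s : A => x s) := by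
      rw [← le_div_iff₀' hlam0]
      refine maxOver_le hA fun s hs => ?_
      rw [le_div_iff₀' hlam0]
      exact le_logSumExp (lam • fun s : A => x s) ⟨s, hs⟩
    have l2 : logSumExp (lam • fun s : A => x s) ≤ lam * maxOver A x + ℓ := by
      have := logSumExp_le (lam • fun s : A => x s) (M := lam * maxOver A x) fun s => by
        simp only [Pi.smul_apply, smul_eq_mul]
        exact mul_le_mul_of_nonneg_left (le_maxOver s.2) hlam0.le
      rw [Fintype.card_coe] at this
      linarith
    have l3 : (maxOver A x - c) / β = q (lam * maxOver A x) := by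
      simp only [q, a]; field_simp
    have l4 : |q (logSumExp (lam • fun s : A => x s)) - (maxOver A x - c) / β| ≤ R⁻¹ := by
      rw [l3]
      simp only [q]
      rw [show ∀ y z w : ℝ, a * y - w - (a * z - w) = a * (y - z) by intros; ring, abs_mul,
        abs_of_pos ha0, abs_of_nonneg (by linarith)]
      calc _ ≤ a * ℓ := by gcongr; linarith
        _ = R⁻¹ := by simp only [a, hlb]; field_simp
    have l5 := hGg (q (logSumExp (lam • fun s : A => x s)))
    have l6 := hLip (q (logSumExp (lam • fun s : A => x s))) ((maxOver A x - c) / β)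
    have l7 : D * |q (logSumExp (lam • fun s : A => x s)) - (maxOver A x - c) / β| ≤ D * R⁻¹ := by
      gcongr
    rw [div_eq_mul_inv] at hRD
    refine (abs_sub_le _ (g (q (logSumExp (lam • fun s : A => x s)))) _).trans ?_
    simp only [f]
    linarith
  -- replacement
  let v : Fin n → E → A → ℝ := fun j e s => u j e s
  let v' : Fin n → E' → A → ℝ := fun j e s => u' j e s
  have hv : ∀ j, Measurable (v j) := fun j => measurable_pi_lambda _ fun s => hu j s s.2
  have hv' : ∀ j, Measurable (v' j) := fun j => measurable_pi_lambda _ fun s => hu' j s s.2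
  have hbn : ∀ j e, ‖v j e‖ ^ 3 ≤ b j e ^ 3 := fun j e => by
    have h0 : 0 ≤ b j e := by
      obtain ⟨s, hs⟩ := hA; exact (abs_nonneg _).trans (hub j e s hs)
    gcongr
    exact (pi_norm_le_iff_of_nonneg h0).2 fun s => hub j e s s.2
  have hbn' : ∀ j e, ‖v' j e‖ ^ 3 ≤ b' j e ^ 3 := fun j e => by
    have h0 : 0 ≤ b' j e := by
      obtain ⟨s, hs⟩ := hA; exact (abs_nonneg _).trans (hub' j e s hs)
    gcongr
    exact (pi_norm_le_iff_of_nonneg h0).2 fun s => hub' j e s s.2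
  have hi : ∀ j, Integrable (fun e => ‖v j e‖ ^ 3) (μ j) := fun j =>
    (hb j).mono' (((hv j).norm.pow_const 3).aestronglyMeasurable)
      (ae_of_all _ fun e => by rw [norm_pow, norm_norm]; exact hbn j e)
  have hi' : ∀ j, Integrable (fun e => ‖v' j e‖ ^ 3) (ν j) := fun j =>
    (hb' j).mono' (((hv' j).norm.pow_const 3).aestronglyMeasurable)
      (ae_of_all _ fun e => by rw [norm_pow, norm_norm]; exact hbn' j e)
  have main := abs_integral_sum_sub_le hf (fun x => hG1 _) htay n μ ν v v' hv hv' hi hi'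
    (fun j s => hm1 j s s.2) (fun j s t => hm2 j s s.2 t t.2) 0
  have hclose : ∀ {F : Type} [MeasurableSpace F] (m : Fin n → Measure F)
      [∀ j, IsProbabilityMeasure (m j)] (w : Fin n → F → ι → ℝ),
      (∀ j, ∀ s ∈ A, Measurable fun e => w j e s) →
      |∫ e, f (0 + ∑ j, (fun s : A => w j (e j) s)) ∂(Measure.pi m) -
        ∫ e, g ((maxOver A (fun s => ∑ j, w j (e j) s) - c) / β) ∂(Measure.pi m)| ≤ η / 2 := by
    intro F _ m _ w hw
    have i1 : Integrable (fun e : Fin n → F => f (0 + ∑ j, (fun s : A => w j (e j) s)))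
        (Measure.pi m) := by
      refine (integrable_const (1 : ℝ)).mono' (hf.comp ?_).aestronglyMeasurable
        (ae_of_all _ fun e => hG1 _)
      refine measurable_const.add (Finset.measurable_sum _ fun j _ => ?_)
      exact measurable_pi_lambda _ fun s => (hw j s s.2).comp (measurable_pi_apply j)
    have i2 : Integrable (fun e : Fin n → F =>
        g ((maxOver A (fun s => ∑ j, w j (e j) s) - c) / β)) (Measure.pi m) := by
      refine (integrable_const (1 : ℝ)).mono' (hg.continuous.measurable.comp
        (((measurable_maxOver fun s hs => ?_).sub_const c).div_const β)).aestronglyMeasurable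
        (ae_of_all _ fun e => hg.abs_le_one _)
      exact Finset.measurable_sum _ fun j _ => (hw j s hs).comp (measurable_pi_apply j)
    rw [← integral_sub i1 i2]
    refine abs_integral_le_integral_abs.trans
      ((integral_mono (i1.sub i2).abs (integrable_const (η / 2)) fun e => ?_).trans (by simp))
    have e1 : (0 + ∑ j, (fun s : A => w j (e j) s) : A → ℝ) =
        fun s : A => (fun s => ∑ j, w j (e j) s) s := by
      ext s; simp
    have := hfg fun s => ∑ j, w j (e j) s
    rw [← e1] at this
    exact this
  have c1 := hclose μ u hu
  have c2 := hclose ν u' hu'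
  have hsum : 13 * K * R ^ 2 * (ℓ ^ 2 / β ^ 3) *
      ∑ j, (∫ e, ‖v j e‖ ^ 3 ∂(μ j) + ∫ e, ‖v' j e‖ ^ 3 ∂(ν j)) ≤
      13 * K * R ^ 2 * (ℓ ^ 2 / β ^ 3 * ∑ j, (∫ e, b j e ^ 3 ∂(μ j) + ∫ e, b' j e ^ 3 ∂(ν j))) := by
    rw [mul_assoc]
    refine mul_le_mul_of_nonneg_left (mul_le_mul_of_nonneg_left (Finset.sum_le_sum fun j _ =>
      add_le_add (integral_mono (hi j) (hb j) (hbn j)) (integral_mono (hi' j) (hb' j) (hbn' j)))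
      (by positivity)) (by positivity)
  refine (abs_sub_le_of_abs_sub_le c1 c2 (main.trans hsum)).trans (le_of_eq ?_)
  ring

end IsTestFunction

end CMI


namespace CMI
namespace Design

variable {d : ℕ} {D : Design d}

/-! ### Deterministic bounds for the kernel weights -/

lemma mem_S {n : ℕ} {s : D.Idx n} : s ∈ D.S n ↔ s.2.2 ≤ D.depth n ∧ s.1 ∈ D.pts n s.2.2 := by
  simp [S]

lemma BandwidthCond.bw_pos (hH : D.BandwidthCond) (k : ℕ) : 0 < D.bw k :=
  mul_pos hH.1 (pow_pos hH.2.1 k)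

lemma BandwidthCond.hmin_pos (hH : D.BandwidthCond) (n : ℕ) : 0 < D.hmin n := hH.bw_pos _

lemma BandwidthCond.hmin_le_bw (hH : D.BandwidthCond) {n k : ℕ} (hk : k ≤ D.depth n) :
    D.hmin n ≤ D.bw k :=
  mul_le_mul_of_nonneg_left (pow_le_pow_of_le_one hH.2.1.le hH.2.2.1.le hk) hH.1.le

lemma BandwidthCond.exists_pow_le_half (hH : D.BandwidthCond) : ∃ r : ℕ, D.a ^ r ≤ 1 / 2 := by
  obtain ⟨r, hr⟩ := exists_pow_lt_of_lt_one (show (0 : ℝ) < 1 / 2 by norm_num) hH.2.2.1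
  exact ⟨r, hr.le⟩

lemma bw_add (k r : ℕ) : D.bw (k + r) = D.bw k * D.a ^ r := by
  simp [bw, pow_add, mul_assoc]

lemma BandwidthCond.tendsto_depth (hH : D.BandwidthCond) : Tendsto D.depth atTop atTop := by
  refine tendsto_atTop.2 fun r => ?_
  filter_upwards [hH.2.2.2.1.eventually (gt_mem_nhds (hH.bw_pos r))] with n hn
  by_contra hlt
  push Not at hlt
  have : D.bw r ≤ D.hmin n :=
    mul_le_mul_of_nonneg_left (pow_le_pow_of_le_one hH.2.1.le hH.2.2.1.le hlt.le) hH.1.le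
  linarith

lemma weight_eq {n : ℕ} {h : ℝ} (hh : 0 < h) (i j : Fin n) :
    D.weight n h i j = D.ker (h⁻¹ • (D.X i - D.X j)) /
      ∑ k : Fin n, D.ker (h⁻¹ • (D.X i - D.X k)) := by
  simp only [weight, kerScaled]
  rw [← Finset.sum_div, div_div_div_cancel_right₀ (by positivity)]

lemma KernelCond.mul_count_le (hK : D.KernelCond) : ∃ C : ℝ, 0 < C ∧ ∀ (n : ℕ) (i : Fin n)
    (h r : ℝ), 0 < h → r ≤ h / 2 →
    C * D.count n r i ≤ ∑ k : Fin n, D.ker (h⁻¹ • (D.X i - D.X k)) := by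
  classical
  obtain ⟨hK0, -, -, C, hC0, -, hC⟩ := hK
  refine ⟨C, hC0, fun n i h r hh hr => ?_⟩
  calc C * D.count n r i
      = ∑ k ∈ Finset.univ.filter (fun j : Fin n => ‖D.X j - D.X i‖ ≤ r), C := by
        rw [Finset.sum_const, nsmul_eq_mul, mul_comm, count]
    _ ≤ ∑ k ∈ Finset.univ.filter (fun j : Fin n => ‖D.X j - D.X i‖ ≤ r),
          D.ker (h⁻¹ • (D.X i - D.X k)) := by
        refine Finset.sum_le_sum fun k hk => hC _ ?_
        rw [Finset.mem_filter, norm_sub_rev] at hk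
        rw [norm_smul, Real.norm_eq_abs, abs_of_pos (inv_pos.2 hh), inv_mul_le_iff₀ hh]
        linarith [hk.2]
    _ ≤ _ := Finset.sum_le_sum_of_subset_of_nonneg (Finset.filter_subset _ _)
        fun k _ _ => hK0 _

/-- The kernel is bounded below on the half ball only, whereas the counts are controlled at radii of
the bandwidth grid. One passes to the bandwidth `r` steps further down, with `a ^ r ≤ 1/2`; close to
the end of the grid, where it is missing, the assumption at radius `h_min / 2` takes over. -/
lemma exists_kernel_sum_ge (hX : D.DesignPointsCond) (hH : D.BandwidthCond) (hK : D.KernelCond) :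
    ∃ c0 : ℝ, 0 < c0 ∧ ∀ᶠ n : ℕ in atTop, ∀ (i : Fin n), ∀ k ≤ D.depth n,
      c0 * (n * D.bw k ^ d) ≤ ∑ j : Fin n, D.ker ((D.bw k)⁻¹ • (D.X i - D.X j)) := by
  obtain ⟨-, C1, C2, hC1, -, hev⟩ := hX
  obtain ⟨CK, hCK, hcount⟩ := hK.mul_count_le
  obtain ⟨r, hr⟩ := hH.exists_pow_le_half
  have ha0 := hH.2.1
  refine ⟨CK * (C1 * (D.a ^ r / 2) ^ d), by positivity, ?_⟩
  filter_upwards [hev] with n hn i k hk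
  have hb := hH.bw_pos k
  by_cases hkr : k + r ≤ D.depth n
  · refine le_trans ?_ (hcount n i (D.bw k) (D.bw (k + r)) hb (by rw [bw_add]; nlinarith))
    have := ((hn i).1 _ hkr).1
    rw [mul_assoc]
    refine mul_le_mul_of_nonneg_left (le_trans ?_ this) hCK.le
    rw [bw_add, mul_pow]
    calc C1 * (D.a ^ r / 2) ^ d * (n * D.bw k ^ d)
        ≤ C1 * (D.a ^ r) ^ d * (n * D.bw k ^ d) := by
          gcongr; exact half_le_self (by positivity)
      _ = _ := by ring
  · refine le_trans ?_ (hcount n i (D.bw k) (D.hmin n / 2) hb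
      (by have := hH.hmin_le_bw hk; linarith))
    have := (hn i).2 i.2
    rw [mul_assoc]
    refine mul_le_mul_of_nonneg_left (le_trans ?_ this) hCK.le
    have h1 : D.bw k * D.a ^ r ≤ D.hmin n := by
      rw [← bw_add]
      push Not at hkr
      exact mul_le_mul_of_nonneg_left (pow_le_pow_of_le_one ha0.le hH.2.2.1.le hkr.le) hH.1.le
    calc C1 * (D.a ^ r / 2) ^ d * (n * D.bw k ^ d)
        = C1 * n * (D.bw k * D.a ^ r / 2) ^ d := by rw [div_pow, div_pow, mul_pow]; ring
      _ ≤ _ := by gcongr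

/-- Properties of the kernel weights at sample size `n`. -/
def WeightBounds (D : Design d) (c0 C2 : ℝ) (n : ℕ) : Prop :=
  ∀ (i : Fin n), ∀ k ≤ D.depth n,
    (∀ j, 0 ≤ D.weight n (D.bw k) i j) ∧
    (∀ j, D.weight n (D.bw k) i j ≤ (c0 * (n * D.bw k ^ d))⁻¹) ∧
    ∑ j, D.weight n (D.bw k) i j = 1 ∧
    (∀ j : Fin n, D.bw k < ‖D.X i - D.X j‖ → D.weight n (D.bw k) i j = 0) ∧
    1 ≤ C2 * (n * D.bw k ^ d) * ∑ j, D.weight n (D.bw k) i j ^ 2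

/-- The upper bound on the weights comes from the kernel sums. The lower bound on their squares is
Cauchy–Schwarz: the weights sum to one over at most `C₂ n h^d` points. -/
lemma exists_weightBounds (hX : D.DesignPointsCond) (hH : D.BandwidthCond) (hK : D.KernelCond) :
    ∃ c0 C2 : ℝ, 0 < c0 ∧ 0 < C2 ∧ ∀ᶠ n : ℕ in atTop, WeightBounds D c0 C2 n := by
  classical
  obtain ⟨c0, hc0, hsum⟩ := exists_kernel_sum_ge hX hH hK
  obtain ⟨-, C1, C2, hC1, hC12, hev⟩ := hX
  refine ⟨c0, C2, hc0, hC1.trans hC12, ?_⟩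
  filter_upwards [hsum, hev] with n hn hc i k hk
  have hb := hH.bw_pos k
  have hn0 : (0 : ℝ) < n := by exact_mod_cast i.pos
  have hlow := hn i k hk
  have hpos : 0 < c0 * (n * D.bw k ^ d) := by positivity
  have hspos := hpos.trans_le hlow
  have h1 : ∑ j, D.weight n (D.bw k) i j = 1 := by
    simp_rw [weight_eq hb]
    rw [← Finset.sum_div, div_self hspos.ne']
  have h4 : ∀ j : Fin n, D.bw k < ‖D.X i - D.X j‖ → D.weight n (D.bw k) i j = 0 := by
    intro j hj
    rw [weight_eq hb, hK.2.1, zero_div]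
    rw [norm_smul, Real.norm_eq_abs, abs_of_pos (inv_pos.2 hb), lt_inv_mul_iff₀ hb]
    linarith
  refine ⟨fun j => ?_, fun j => ?_, h1, h4, ?_⟩
  · rw [weight_eq hb]
    exact div_nonneg (hK.1 _) hspos.le
  · rw [weight_eq hb, div_eq_mul_inv]
    calc _ ≤ 1 * (∑ k_1 : Fin n, D.ker ((D.bw k)⁻¹ • (D.X i - D.X k_1)))⁻¹ := by
          gcongr; exact hK.2.2.1 _
      _ ≤ _ := by rw [one_mul]; exact inv_anti₀ hpos hlow
  · let F := Finset.univ.filter (fun j : Fin n => ‖D.X j - D.X i‖ ≤ D.bw k)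
    have hF : ∑ j ∈ F, D.weight n (D.bw k) i j = 1 := by
      rw [← h1]
      refine Finset.sum_subset (Finset.filter_subset _ _) fun j _ hj => h4 j ?_
      simp only [F, Finset.mem_filter, Finset.mem_univ, true_and, not_le] at hj
      rwa [norm_sub_rev]
    have hcard : (F.card : ℝ) ≤ C2 * (n * D.bw k ^ d) := by
      have := ((hc i).1 k hk).2
      rw [count] at this
      rw [← mul_assoc]
      convert this
    have cs := sq_sum_le_card_mul_sum_sq (s := F) (f := fun j => D.weight n (D.bw k) i j)
    rw [hF, one_pow] at cs
    refine cs.trans (mul_le_mul hcard ?_ (Finset.sum_nonneg fun _ _ => sq_nonneg _)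
      ((Nat.cast_nonneg _).trans hcard))
    exact Finset.sum_le_sum_of_subset_of_nonneg (Finset.filter_subset _ _)
      fun _ _ _ => sq_nonneg _

/-- The number of test points for the smallest bandwidth value tends to infinity. -/
lemma eventually_le_card_pts (hd : 0 < d) (hX : D.DesignPointsCond) (hH : D.BandwidthCond)
    (hI : D.TestPointsCond) (N : ℕ) : ∀ᶠ n : ℕ in atTop, N ≤ (D.pts n (D.depth n)).card := by
  classical
  obtain ⟨-, C1, C2, hC1, hC12, hev⟩ := hX
  have hC2 : 0 < C2 := hC1.trans hC12
  obtain ⟨r, hr⟩ := hH.exists_pow_le_half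
  have ha0 := hH.2.1
  -- Positivity of `d` matters here: `N` balls of radius `h_min / a ^ r` hold a vanishing fraction
  -- of the sample.
  have hlim : Tendsto (fun n => N * (C2 * (D.hmin n / D.a ^ r) ^ d)) atTop (𝓝 0) := by
    have h := (((hH.2.2.2.1.div_const (D.a ^ r)).pow d).const_mul C2).const_mul (N : ℝ)
    simpa [hd.ne'] using h
  filter_upwards [hev, hH.tendsto_depth.eventually_ge_atTop r, eventually_gt_atTop 0,
    hlim.eventually (gt_mem_nhds one_pos)] with n hn hdep hn0 hsmall
  have hmul : D.bw (D.depth n - r) * D.a ^ r = D.hmin n := by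
    rw [← bw_add, Nat.sub_add_cancel hdep, hmin]
  have hbw : D.bw (D.depth n - r) = D.hmin n / D.a ^ r := by
    rw [← hmul]; field_simp
  have h2 : 2 * D.hmin n ≤ D.bw (D.depth n - r) := by
    have := hH.bw_pos (D.depth n - r)
    rw [← hmul]; nlinarith
  -- The test points form a `2 h_min` net, and `2 h_min` is at most the bandwidth `r` steps up the
  -- grid, where the upper count bound is available.
  have hcov : (Finset.univ : Finset (Fin n)) ⊆ (D.pts n (D.depth n)).biUnion fun j =>
      Finset.univ.filter fun i : Fin n => ‖D.X i - D.X j‖ ≤ D.bw (D.depth n - r) := by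
    intro i _
    obtain ⟨j, hj, hij⟩ := (hI n (D.depth n) le_rfl).2 i
    rw [Finset.mem_biUnion]
    refine ⟨j, hj, ?_⟩
    rw [Finset.mem_filter]
    exact ⟨Finset.mem_univ _, hij.trans h2⟩
  have hle : (n : ℝ) ≤ (D.pts n (D.depth n)).card * (C2 * n * (D.hmin n / D.a ^ r) ^ d) := by
    have h := (Finset.card_le_card hcov).trans Finset.card_biUnion_le
    rw [Finset.card_univ, Fintype.card_fin] at h
    have h' : (n : ℝ) ≤ ∑ j ∈ D.pts n (D.depth n), ((Finset.univ.filter fun i : Fin n =>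
        ‖D.X i - D.X j‖ ≤ D.bw (D.depth n - r)).card : ℝ) := by exact_mod_cast h
    refine h'.trans ?_
    rw [← nsmul_eq_mul]
    refine Finset.sum_le_card_nsmul _ _ _ fun j _ => ?_
    have := ((hn j).1 (D.depth n - r) (Nat.sub_le _ _)).2
    rw [count, hbw] at this
    rw [hbw]
    convert this
  by_contra hlt
  push Not at hlt
  have hltR : ((D.pts n (D.depth n)).card : ℝ) ≤ N := by exact_mod_cast hlt.le
  have hn0R : (0 : ℝ) < n := by exact_mod_cast hn0
  have hq : 0 ≤ D.hmin n / D.a ^ r := div_nonneg (hH.hmin_pos n).le (by positivity)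
  have : (n : ℝ) ≤ N * (C2 * (D.hmin n / D.a ^ r) ^ d) * n := by
    refine hle.trans ?_
    calc _ ≤ (N : ℝ) * (C2 * n * (D.hmin n / D.a ^ r) ^ d) := by gcongr
      _ = _ := by ring
  nlinarith

/-- The number of indices grows at most polynomially. -/
lemma exists_card_S_le (hH : D.BandwidthCond) {κ : ℝ}
    (hKκ : Tendsto (fun n : ℕ => D.numIneq n * Real.log n / (n : ℝ) ^ (κ / 4)) atTop (𝓝 0)) :
    ∃ p : ℝ, 1 ≤ p ∧ ∀ᶠ n : ℕ in atTop, ((D.S n).card : ℝ) ≤ Real.exp (p * Real.log n) := by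
  obtain ⟨-, -, -, -, C, hC, hdep⟩ := hH
  -- There are at most `n` test points, `n ^ (κ / 4)` inequalities and `n` bandwidth values.
  refine ⟨max 1 (κ / 4 + 2), le_max_left _ _, ?_⟩
  have hlogn : ∀ᶠ n : ℕ in atTop, C * Real.log n ≤ n := by
    have h := (Real.isLittleO_log_id_atTop.comp_tendsto tendsto_natCast_atTop_atTop).bound
      (show 0 < 1 / C by positivity)
    filter_upwards [h] with n hn
    simp only [Function.comp_def, id_eq, Real.norm_eq_abs, Nat.abs_cast] at hn
    have := (le_abs_self _).trans hn
    rw [div_mul_eq_mul_div, one_mul, le_div_iff₀ hC] at this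
    linarith
  filter_upwards [hdep, hlogn, hKκ.eventually (gt_mem_nhds one_pos), eventually_ge_atTop 3]
    with n h1 h2 h3 hn
  have hn0 : (0 : ℝ) < n := by positivity
  have hlog1 : 1 ≤ Real.log n := by
    rw [Real.le_log_iff_exp_le hn0]
    have : (3 : ℝ) ≤ n := by exact_mod_cast hn
    linarith [Real.exp_one_lt_d9]
  have hK : (D.numIneq n : ℝ) ≤ (n : ℝ) ^ (κ / 4) := by
    rw [div_lt_one (by positivity)] at h3
    have : (0 : ℝ) ≤ D.numIneq n := Nat.cast_nonneg _
    nlinarith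
  have hcard : (D.S n).card ≤ n * (D.numIneq n * (D.depth n + 1)) := by
    refine (Finset.card_filter_le _ _).trans (le_of_eq ?_)
    simp [numIneq]
  calc ((D.S n).card : ℝ) ≤ n * (D.numIneq n * (D.depth n + 1)) := by exact_mod_cast hcard
    _ ≤ n * ((n : ℝ) ^ (κ / 4) * n) := by gcongr; linarith
    _ = Real.exp ((κ / 4 + 2) * Real.log n) := by
        rw [Real.rpow_def_of_pos hn0]
        nth_rewrite 1 3 [← Real.exp_log hn0]
        rw [← Real.exp_add, ← Real.exp_add]
        congr 1; ring
    _ ≤ _ := by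
        apply Real.exp_le_exp.2
        gcongr
        exact le_max_right _ _

lemma S_nonempty {n : ℕ} (hI : D.TestPointsCond) (hn : 0 < n) (h0 : (D.ineq n).Nonempty) :
    (D.S n).Nonempty := by
  obtain ⟨m, hm⟩ := h0
  obtain ⟨j, hj, -⟩ := (hI n 0 (Nat.zero_le _)).2 ⟨0, hn⟩
  exact ⟨(j, ⟨m, hm⟩, 0), mem_S.2 ⟨Nat.zero_le _, hj⟩⟩

end Design
end CMI


namespace CMI

/-! ### Sums of independent Gaussian functionals -/

section SumDual

variable {n : ℕ} {E : Type} [NormedAddCommGroup E] [NormedSpace ℝ E]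

/-- The continuous linear functional `u ↦ ∑ j, L j (u j)`. -/
noncomputable def sumDual (L : Fin n → StrongDual ℝ E) : StrongDual ℝ (Fin n → E) :=
  ∑ j, (L j).comp (ContinuousLinearMap.proj j)

@[simp] lemma sumDual_apply (L : Fin n → StrongDual ℝ E) (u : Fin n → E) :
    sumDual L u = ∑ j, L j (u j) := by
  simp [sumDual]

lemma sumDual_add (L L' : Fin n → StrongDual ℝ E) :
    sumDual (fun j => L j + L' j) = sumDual L + sumDual L' := by
  ext u; simp [Finset.sum_add_distrib]

lemma sumDual_sub (L L' : Fin n → StrongDual ℝ E) :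
    sumDual (fun j => L j - L' j) = sumDual L - sumDual L' := by
  ext u; simp [Finset.sum_sub_distrib]

variable [MeasurableSpace E] [BorelSpace E] [SecondCountableTopology E] [CompleteSpace E]
  {μ : Fin n → Measure E} [∀ j, IsGaussian (μ j)]

instance isGaussian_pi : IsGaussian (Measure.pi μ) := by
  have h1 : ∀ j, HasGaussianLaw (fun u : Fin n → E => u j) (Measure.pi μ) := fun j => by
    refine ⟨?_⟩
    rw [(measurePreserving_eval μ j).map_eq]
    infer_instance
  have h2 : iIndepFun (fun j (u : Fin n → E) => u j) (Measure.pi μ) :=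
    iIndepFun_pi (X := fun _ => id) fun _ => aemeasurable_id
  have h := (iIndepFun.hasGaussianLaw h1 h2).isGaussian_map
  simpa using h

lemma integral_id_pi (h0 : ∀ j, (μ j)[id] = 0) : (Measure.pi μ)[id] = 0 := by
  have hint : Integrable (fun u : Fin n → E => u) (Measure.pi μ) := IsGaussian.integrable_fun_id
  have key : ∫ u, u ∂Measure.pi μ = 0 := by
    funext j
    have h := (ContinuousLinearMap.proj (R := ℝ) (φ := fun _ : Fin n => E) j).integral_comp_comm hint
    simp only [ContinuousLinearMap.proj_apply] at h
    rw [← h]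
    rw [Pi.zero_apply, ← h0 j, ← (measurePreserving_eval μ j).map_eq,
      integral_map (measurable_pi_apply j).aemeasurable
        (by rw [(measurePreserving_eval μ j).map_eq]; exact IsGaussian.integrable_id.1)]
    rfl
  simpa using key

lemma variance_sumDual (L : Fin n → StrongDual ℝ E) :
    Var[sumDual L; Measure.pi μ] = ∑ j, Var[L j; μ j] := by
  have h := variance_sum_pi (μ := μ) (X := fun j => L j) fun j => IsGaussian.memLp_dual _ _ _ (by simp)
  rw [← h]
  congr 1
  ext u
  simp

lemma map_strongDual_eq_gaussianReal {F : Type*} [NormedAddCommGroup F] [NormedSpace ℝ F]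
    [MeasurableSpace F] [BorelSpace F] [SecondCountableTopology F] [CompleteSpace F]
    {ν : Measure F} [IsGaussian ν] (h0 : ν[id] = 0)
    (L : StrongDual ℝ F) {v : ℝ} (hv : Var[L; ν] = v) :
    ν.map L = gaussianReal 0 v.toNNReal := by
  rw [IsGaussian.map_eq_gaussianReal, ContinuousLinearMap.integral_comp_id_comm
    IsGaussian.integrable_id, show ∫ x, x ∂ν = 0 from h0, map_zero, hv]

/-- Functionals of disjoint groups of independent components are uncorrelated. -/
lemma covariance_sumDual_eq_zero {L L' : Fin n → StrongDual ℝ E}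
    (h : ∀ j, L j = 0 ∨ L' j = 0) : cov[sumDual L, sumDual L'; Measure.pi μ] = 0 := by
  have hL : ∀ L : StrongDual ℝ (Fin n → E), MemLp L 2 (Measure.pi μ) := fun L =>
    IsGaussian.memLp_dual _ _ _ (by simp)
  -- The covariance is read off from the variance of the sum, which is additive because in each
  -- component one of the functionals vanishes.
  have h1 := variance_add (hL (sumDual L)) (hL (sumDual L'))
  have h2 : (⇑(sumDual L) + ⇑(sumDual L') : (Fin n → E) → ℝ) =
      sumDual fun j => L j + L' j := by
    rw [sumDual_add]; rfl
  rw [h2, variance_sumDual, variance_sumDual, variance_sumDual] at h1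
  have h3 : ∀ j, Var[(L j + L' j : StrongDual ℝ E); μ j] = Var[L j; μ j] + Var[L' j; μ j] := by
    intro j
    have hz : Var[(0 : StrongDual ℝ E); μ j] = 0 := by
      have := variance_zero (μ j)
      exact this
    rcases h j with h | h <;> simp only [h, hz, zero_add, add_zero]
  simp only [h3, Finset.sum_add_distrib] at h1
  linarith

end SumDual

namespace Design

open scoped MatrixOrder

variable {d : ℕ} {D : Design d}

/-- The law of `n` independent standard normal vectors. -/
noncomputable abbrev gauss (D : Design d) (n : ℕ) : Measure (Fin n → EuclideanSpace ℝ (D.ineq n)) :=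
  Measure.pi fun _ => stdGaussian (EuclideanSpace ℝ (D.ineq n))

lemma integral_id_gauss (n : ℕ) : (D.gauss n)[id] = 0 :=
  integral_id_pi fun _ => by simp

/-- The component `m` of `Q x`. -/
noncomputable def rowDual {n : ℕ} (Q : Matrix (D.ineq n) (D.ineq n) ℝ) (m : D.ineq n) :
    StrongDual ℝ (EuclideanSpace ℝ (D.ineq n)) :=
  (EuclideanSpace.proj m).comp (Matrix.toEuclideanCLM (𝕜 := ℝ) Q)

/-- The kernel smoother of the vectors `√M_j e_j`, as a functional of `e`. -/
noncomputable def rootDual (D : Design d) (n : ℕ) (M : Fin n → Matrix (D.ineq n) (D.ineq n) ℝ)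
    (s : D.Idx n) : StrongDual ℝ (Fin n → EuclideanSpace ℝ (D.ineq n)) :=
  sumDual fun j => D.weight n (D.bw s.2.2) s.1 j • rowDual (CFC.sqrt (M j)) s.2.1

lemma rootDual_apply (n : ℕ) (M : Fin n → Matrix (D.ineq n) (D.ineq n) ℝ) (s : D.Idx n)
    (e : Fin n → EuclideanSpace ℝ (D.ineq n)) : D.rootDual n M s e =
      D.smooth n (fun j m => Matrix.toEuclideanCLM (𝕜 := ℝ) (CFC.sqrt (M j)) (e j) m) s := by
  simp [rootDual, smooth, rowDual]

lemma variance_rowDual {n : ℕ} {M : Matrix (D.ineq n) (D.ineq n) ℝ} (hM : M.PosSemidef)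
    (m : D.ineq n) : Var[rowDual (CFC.sqrt M) m; stdGaussian _] = M m m := by
  rw [← variance_eval_multivariateGaussian (μ := 0) hM m, multivariateGaussian,
    variance_map (by fun_prop) (by fun_prop)]
  congr 1
  ext x
  simp [rowDual]

lemma variance_smul_dual {E : Type*} [NormedAddCommGroup E] [NormedSpace ℝ E] [MeasurableSpace E]
    (μ : Measure E) (a : ℝ) (L : StrongDual ℝ E) : Var[(a • L : StrongDual ℝ E); μ] = a ^ 2 * Var[L; μ] :=
  variance_const_mul a L μ

lemma variance_rootDual {n : ℕ} {M : Fin n → Matrix (D.ineq n) (D.ineq n) ℝ}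
    (hM : ∀ j, (M j).PosSemidef) (s : D.Idx n) : Var[D.rootDual n M s; D.gauss n] =
      ∑ j, D.weight n (D.bw s.2.2) s.1 j ^ 2 * M j s.2.1 s.2.1 := by
  rw [rootDual, variance_sumDual]
  exact Finset.sum_congr rfl fun j _ => by rw [variance_smul_dual, variance_rowDual (hM j)]

/-- The variance of a functional under the standard Gaussian law is its squared norm, so the Hölder
bound for square roots turns a spectral error `δ` into a variance `δ`. -/
lemma variance_rowDual_sub_le {n : ℕ} {M M' : Matrix (D.ineq n) (D.ineq n) ℝ} (hM : M.PosSemidef)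
    (hM' : M'.PosSemidef) {δ : ℝ} (h : ‖Matrix.toEuclideanCLM (𝕜 := ℝ) (M - M')‖ ≤ δ)
    (m : D.ineq n) :
    Var[(rowDual (CFC.sqrt M) m - rowDual (CFC.sqrt M') m : StrongDual ℝ _); stdGaussian _] ≤ δ := by
  have hδ : 0 ≤ δ := (norm_nonneg _).trans h
  rw [variance_dual_stdGaussian, ← Real.sq_sqrt hδ]
  refine pow_le_pow_left₀ (norm_nonneg _) ?_ 2
  refine ContinuousLinearMap.opNorm_le_bound _ (Real.sqrt_nonneg _) fun x => ?_
  have h1 := norm_sqrt_sub_sqrt_apply_sq_le hM hM' h x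
  have h2 : ‖(rowDual (CFC.sqrt M) m - rowDual (CFC.sqrt M') m : StrongDual ℝ _) x‖ ≤
      ‖Matrix.toEuclideanCLM (𝕜 := ℝ) (CFC.sqrt M) x -
        Matrix.toEuclideanCLM (𝕜 := ℝ) (CFC.sqrt M') x‖ := by
    have := PiLp.norm_apply_le (Matrix.toEuclideanCLM (𝕜 := ℝ) (CFC.sqrt M) x -
        Matrix.toEuclideanCLM (𝕜 := ℝ) (CFC.sqrt M') x) m
    simpa [rowDual] using this
  refine h2.trans (le_trans (Real.le_sqrt_of_sq_le h1) (le_of_eq ?_))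
  rw [Real.sqrt_mul hδ, Real.sqrt_sq (norm_nonneg _)]

lemma variance_rootDual_sub_le {n : ℕ} {M M' : Fin n → Matrix (D.ineq n) (D.ineq n) ℝ}
    (hM : ∀ j, (M j).PosSemidef) (hM' : ∀ j, (M' j).PosSemidef) {δ : ℝ}
    (h : ∀ j, ‖Matrix.toEuclideanCLM (𝕜 := ℝ) (M j - M' j)‖ ≤ δ) (s : D.Idx n) :
    Var[(D.rootDual n M s - D.rootDual n M' s : StrongDual ℝ _); D.gauss n] ≤
      δ * ∑ j, D.weight n (D.bw s.2.2) s.1 j ^ 2 := by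
  rw [rootDual, rootDual, ← sumDual_sub, variance_sumDual, Finset.mul_sum]
  refine Finset.sum_le_sum fun j _ => ?_
  have hsub : D.weight n (D.bw s.2.2) s.1 j • rowDual (CFC.sqrt (M j)) s.2.1 -
      D.weight n (D.bw s.2.2) s.1 j • rowDual (CFC.sqrt (M' j)) s.2.1 =
      D.weight n (D.bw s.2.2) s.1 j •
        (rowDual (CFC.sqrt (M j)) s.2.1 - rowDual (CFC.sqrt (M' j)) s.2.1) := by
    ext x
    simp [mul_sub]
  rw [hsub, variance_smul_dual, mul_comm]
  exact mul_le_mul_of_nonneg_right (variance_rowDual_sub_le (hM j) (hM' j) (h j) _) (sq_nonneg _)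

/-- The law of independent `N(0, M_j)` vectors, as an image of independent standard ones. -/
lemma pi_multivariateGaussian_eq_map (n : ℕ) (M : Fin n → Matrix (D.ineq n) (D.ineq n) ℝ) :
    Measure.pi (fun j => multivariateGaussian 0 (M j)) = (D.gauss n).map fun e j =>
      Matrix.toEuclideanCLM (𝕜 := ℝ) (CFC.sqrt (M j)) (e j) := by
  rw [gauss, Measure.pi_map_pi (f := fun j x => Matrix.toEuclideanCLM (𝕜 := ℝ) (CFC.sqrt (M j)) x)
    fun j => by fun_prop]
  congr 1
  ext1 j
  simp [multivariateGaussian]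

/-- Expectations of functions of the maximum of the normalized smoothers of Gaussian vectors. -/
lemma integral_max_smooth_eq (n : ℕ) (M : Fin n → Matrix (D.ineq n) (D.ineq n) ℝ)
    (A : Finset (D.Idx n)) (v : D.Idx n → ℝ) {g : ℝ → ℝ} (hg : Measurable g) :
    ∫ u, g (maxOver A fun s => D.smooth n (fun j m => u j m) s / v s)
      ∂(Measure.pi fun j => multivariateGaussian 0 (M j)) =
    ∫ e, g (maxOver A fun s => D.rootDual n M s e / v s) ∂(D.gauss n) := by
  rw [pi_multivariateGaussian_eq_map, integral_map]
  · simp only [rootDual_apply]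
  · exact (measurable_pi_lambda _ fun j => by fun_prop).aemeasurable
  · refine (hg.comp (measurable_maxOver fun s _ => ?_)).aestronglyMeasurable
    unfold smooth
    fun_prop

end Design
end CMI


namespace CMI

/-! ### Moments -/

/-- The bound `|x|³ ≤ 3! exp |x| ≤ 6 (exp x + exp (-x))` reduces the claim to the moment generating
function at `±1`. -/
lemma integrable_abs_pow_three_gaussianReal (v : NNReal) :
    Integrable (fun x : ℝ => |x| ^ 3) (gaussianReal 0 v) ∧
      ∫ x, |x| ^ 3 ∂gaussianReal 0 v ≤ 12 * Real.exp (v / 2) := by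
  have i1 : Integrable (fun x : ℝ => Real.exp x) (gaussianReal 0 v) := by
    simpa using integrable_exp_mul_gaussianReal (μ := 0) (v := v) 1
  have i2 : Integrable (fun x : ℝ => Real.exp (-x)) (gaussianReal 0 v) := by
    simpa using integrable_exp_mul_gaussianReal (μ := 0) (v := v) (-1)
  have i3 : Integrable (fun x : ℝ => 6 * (Real.exp x + Real.exp (-x))) (gaussianReal 0 v) :=
    (i1.add i2).const_mul 6
  have hb : ∀ x : ℝ, |x| ^ 3 ≤ 6 * (Real.exp x + Real.exp (-x)) := by
    intro x
    have h1 := Real.pow_div_factorial_le_exp |x| (abs_nonneg x) 3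
    have h2 : Real.exp |x| ≤ Real.exp x + Real.exp (-x) := by
      rcases abs_choice x with h | h <;> rw [h] <;>
        linarith [Real.exp_pos x, Real.exp_pos (-x)]
    have h3 : ((3).factorial : ℝ) = 6 := by norm_num [Nat.factorial]
    rw [h3, div_le_iff₀ (by norm_num)] at h1
    linarith
  have m1 : ∫ x, Real.exp x ∂gaussianReal 0 v = Real.exp (v / 2) := by
    have := congrFun (mgf_id_gaussianReal (μ := 0) (v := v)) 1
    simpa [mgf] using this
  have m2 : ∫ x, Real.exp (-x) ∂gaussianReal 0 v = Real.exp (v / 2) := by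
    have := congrFun (mgf_id_gaussianReal (μ := 0) (v := v)) (-1)
    simpa [mgf] using this
  have i4 : Integrable (fun x : ℝ => |x| ^ 3) (gaussianReal 0 v) := by
    refine i3.mono' (by fun_prop) (ae_of_all _ fun x => ?_)
    rw [Real.norm_eq_abs, abs_of_nonneg (by positivity)]
    exact hb x
  refine ⟨i4, (integral_mono i4 i3 hb).trans (le_of_eq ?_)⟩
  rw [integral_const_mul, integral_add i1 i2, m1, m2]
  ring

lemma integrable_mul_sum_abs_pow_three {ι E : Type*} [MeasurableSpace E] {μ : Measure E}
    {s : Finset ι} {v : ι → E → ℝ} {C B : ℝ} (hv : ∀ m ∈ s, Measurable (v m))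
    (hi : ∀ m ∈ s, Integrable (fun e => |v m e| ^ 3) μ)
    (hC : ∀ m ∈ s, ∫ e, |v m e| ^ 3 ∂μ ≤ C) (hB : 0 ≤ B) :
    Integrable (fun e => (B * ∑ m ∈ s, |v m e|) ^ 3) μ ∧
      ∫ e, (B * ∑ m ∈ s, |v m e|) ^ 3 ∂μ ≤ B ^ 3 * (s.card : ℝ) ^ 3 * C := by
  have h1 : Integrable (fun e => B ^ 3 * ((s.card : ℝ) ^ 2 * ∑ m ∈ s, |v m e| ^ 3)) μ :=
    ((integrable_finsetSum s hi).const_mul _).const_mul _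
  have hle : ∀ e, (B * ∑ m ∈ s, |v m e|) ^ 3 ≤
      B ^ 3 * ((s.card : ℝ) ^ 2 * ∑ m ∈ s, |v m e| ^ 3) := fun e => by
    rw [mul_pow]
    exact mul_le_mul_of_nonneg_left
      (pow_sum_le_card_mul_sum_pow (fun _ _ => abs_nonneg _) 2) (by positivity)
  have h2 : Integrable (fun e => (B * ∑ m ∈ s, |v m e|) ^ 3) μ := by
    refine h1.mono' ?_ (ae_of_all _ fun e => ?_)
    · refine Measurable.aestronglyMeasurable (Measurable.pow_const (Measurable.const_mul
        (Finset.measurable_sum s fun m hm => ?_) B) 3)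
      exact continuous_abs.measurable.comp (hv m hm)
    · rw [Real.norm_eq_abs, abs_of_nonneg
        (pow_nonneg (mul_nonneg hB (Finset.sum_nonneg fun _ _ => abs_nonneg _)) 3)]
      exact hle e
  refine ⟨h2, (integral_mono h2 h1 hle).trans ?_⟩
  rw [integral_const_mul, integral_const_mul, integral_finsetSum s hi]
  have : ∑ m ∈ s, ∫ e, |v m e| ^ 3 ∂μ ≤ s.card * C := by
    rw [← nsmul_eq_mul]
    exact Finset.sum_le_card_nsmul _ _ _ hC
  calc _ ≤ B ^ 3 * ((s.card : ℝ) ^ 2 * (s.card * C)) := by gcongr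
    _ = _ := by ring

section ModelMoments

variable {d : ℕ} {c : ClassConst} {X : ℕ → EuclideanSpace ℝ (Fin d)} {w : Model d}

lemma abs_pow_le_one_add_rpow {k : ℕ} (hk : k ≤ 4) {δ : ℝ} (hδ : 0 < δ) (x : ℝ) :
    |x| ^ k ≤ 1 + |x| ^ (4 + δ) := by
  rcases le_total |x| 1 with h | h
  · have := pow_le_one₀ (abs_nonneg x) h (n := k)
    have := Real.rpow_nonneg (abs_nonneg x) (4 + δ)
    linarith
  · have h1 : |x| ^ k ≤ |x| ^ (4 + δ) := by
      rw [← Real.rpow_natCast]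
      refine Real.rpow_le_rpow_of_exponent_le h ?_
      have : (k : ℝ) ≤ 4 := by exact_mod_cast hk
      linarith
    linarith

lemma DisturbanceCond.integrable_rpow (hc : c.Admissible) (hw : DisturbanceCond c X w) (i m : ℕ) :
    Integrable (fun e : ℕ → ℝ => |e m| ^ (4 + c.δ)) (w.law i) ∧
      ∫ e, |e m| ^ (4 + c.δ) ∂(w.law i) ≤ c.Cmom := by
  have h0 : 0 ≤ᵐ[w.law i] fun e : ℕ → ℝ => |e m| ^ (4 + c.δ) :=
    ae_of_all _ fun e => Real.rpow_nonneg (abs_nonneg _) _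
  have hm : AEStronglyMeasurable (fun e : ℕ → ℝ => |e m| ^ (4 + c.δ)) (w.law i) := by
    refine Measurable.aestronglyMeasurable ?_
    have := continuous_abs.measurable.comp (measurable_pi_apply (X := fun _ : ℕ => ℝ) m)
    exact this.pow_const (4 + c.δ)
  refine ⟨⟨hm, ?_⟩, ?_⟩
  · rw [hasFiniteIntegral_iff_ofReal h0]
    exact (hw.1 i m).trans_lt ENNReal.ofReal_lt_top
  · rw [integral_eq_lintegral_of_nonneg_ae h0 hm]
    exact ENNReal.toReal_le_of_le_ofReal hc.1.le (hw.1 i m)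

lemma DisturbanceCond.integrable_pow (hc : c.Admissible) (hw : DisturbanceCond c X w) (i m : ℕ)
    {k : ℕ} (hk : k ≤ 4) : Integrable (fun e : ℕ → ℝ => |e m| ^ k) (w.law i) ∧
      ∫ e, |e m| ^ k ∂(w.law i) ≤ 1 + c.Cmom := by
  obtain ⟨h1, h2⟩ := hw.integrable_rpow hc i m
  have h3 : Integrable (fun e : ℕ → ℝ => 1 + |e m| ^ (4 + c.δ)) (w.law i) :=
    (integrable_const _).add h1
  have h4 : Integrable (fun e : ℕ → ℝ => |e m| ^ k) (w.law i) := by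
    refine h3.mono' ?_ (ae_of_all _ fun e => ?_)
    · exact ((continuous_abs.measurable.comp (measurable_pi_apply m)).pow_const
        k).aestronglyMeasurable
    · rw [Real.norm_eq_abs, abs_of_nonneg (by positivity)]
      exact abs_pow_le_one_add_rpow hk hc.2.1 _
  refine ⟨h4, (integral_mono h4 h3 fun e => abs_pow_le_one_add_rpow hk hc.2.1 _).trans ?_⟩
  rw [integral_add (integrable_const _) h1]
  simpa using h2

lemma DisturbanceCond.memLp_two (hc : c.Admissible) (hw : DisturbanceCond c X w) (i m : ℕ) :
    MemLp (fun e : ℕ → ℝ => e m) 2 (w.law i) := by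
  rw [memLp_two_iff_integrable_sq (measurable_pi_apply m).aestronglyMeasurable]
  simpa using (hw.integrable_pow hc i m (k := 2) (by norm_num)).1

lemma DisturbanceCond.cov_self_le (hc : c.Admissible) (hw : DisturbanceCond c X w) (i m : ℕ) :
    w.cov i m m ≤ 1 + c.Cmom := by
  have := (hw.integrable_pow hc i m (k := 2) (by norm_num)).2
  simpa [Model.cov, sq] using this

/-- The quadratic form is the second moment of a linear combination of the disturbances. -/
lemma DisturbanceCond.posSemidef_sigma (hc : c.Admissible) (D : Design d)
    (hw : DisturbanceCond c X w) (n : ℕ) (i : Fin n) : (D.sigma w n i).PosSemidef := by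
  have hint : ∀ m m' : D.ineq n, Integrable (fun e : ℕ → ℝ => e m * e m') (w.law i) := fun m m' =>
    (hw.memLp_two hc i m).integrable_mul (hw.memLp_two hc i m')
  refine Matrix.PosSemidef.of_dotProduct_mulVec_nonneg ?_ fun x => ?_
  · ext m m'
    simp [Design.sigma, Model.cov, mul_comm]
  · have : star x ⬝ᵥ (D.sigma w n i).mulVec x =
        ∫ e : ℕ → ℝ, (∑ m : D.ineq n, x m * e m) ^ 2 ∂(w.law i) := by
      have hexp : ∀ e : ℕ → ℝ, (∑ m : D.ineq n, x m * e m) ^ 2 =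
          ∑ m : D.ineq n, ∑ m' : D.ineq n, x m * x m' * (e m * e m') := fun e => by
        rw [sq, Finset.sum_mul_sum]
        exact Finset.sum_congr rfl fun m _ => Finset.sum_congr rfl fun m' _ => by ring
      simp_rw [hexp]
      rw [integral_finsetSum _ fun m _ => integrable_finsetSum _ fun m' _ =>
        (hint m m').const_mul _]
      simp only [dotProduct, Matrix.mulVec, Design.sigma, Matrix.of_apply, star_trivial]
      refine Finset.sum_congr rfl fun m _ => ?_
      rw [integral_finsetSum _ fun m' _ => (hint m m').const_mul _, Finset.mul_sum]
      refine Finset.sum_congr rfl fun m' _ => ?_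
      rw [integral_const_mul, Model.cov]
      ring
    rw [this]
    exact integral_nonneg fun e => sq_nonneg _

end ModelMoments

namespace Design

variable {d : ℕ} {D : Design d} {c : ClassConst} {w : Model d}

/-! ### Standard deviations of the smoothed disturbances -/

/-- The standard deviation of the smoothed disturbances. -/
noncomputable def sdev (D : Design d) (w : Model d) (n : ℕ) (s : D.Idx n) : ℝ :=
  Real.sqrt (∑ j : Fin n, D.weight n (D.bw s.2.2) s.1 j ^ 2 * w.cov j s.2.1 s.2.1)

/-- Bounds for the standard deviations at sample size `n`. -/
def SdevBounds (D : Design d) (c : ClassConst) (C : ℝ) (n : ℕ) : Prop :=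
  ∀ w ∈ modelClass c D.X, ∀ s ∈ D.S n,
    0 < D.sdev w n s ∧
    (∀ j, |D.weight n (D.bw s.2.2) s.1 j| ≤
      C / Real.sqrt (n * D.hmin n ^ d) * D.sdev w n s) ∧
    c.Cvar * ∑ j, D.weight n (D.bw s.2.2) s.1 j ^ 2 ≤ D.sdev w n s ^ 2 ∧
    D.sdev w n s ^ 2 ≤ C / (n * D.bw s.2.2 ^ d)

/-- The squared standard deviation is comparable to the sum of squared weights, hence to `1 / (n
h^d)`, while single weights are of order `1 / (n h^d)`. The ratio is of order `(n h_min^d)^(-1/2)`: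
no observation dominates, as Lindeberg's method requires. -/
lemma exists_sdevBounds (hc : c.Admissible) (hX : D.DesignPointsCond) (hH : D.BandwidthCond)
    (hK : D.KernelCond) : ∃ C : ℝ, 0 < C ∧ ∀ᶠ n : ℕ in atTop, SdevBounds D c C n := by
  obtain ⟨c0, C2, hc0, hC2, hev⟩ := exists_weightBounds hX hH hK
  have hCv : 0 < c.Cvar := hc.2.2.2.1
  have hCm : 0 < c.Cmom := hc.1
  refine ⟨max (Real.sqrt (C2 / c.Cvar) / c0) ((1 + c.Cmom) / c0), by positivity, ?_⟩
  filter_upwards [hev] with n hn w hw s hs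
  obtain ⟨hk, -⟩ := mem_S.1 hs
  obtain ⟨w0, wle, wsum, -, wsq⟩ := hn s.1 s.2.2 hk
  have hn0 : (0 : ℝ) < n := by exact_mod_cast s.1.pos
  have hb := hH.bw_pos s.2.2
  have hm := hH.hmin_pos n
  set W : ℝ := ∑ j, D.weight n (D.bw s.2.2) s.1 j ^ 2 with hW
  set N : ℝ := n * D.bw s.2.2 ^ d with hN
  have hN0 : 0 < N := by positivity
  have hsum0 : c.Cvar * W ≤ ∑ j : Fin n, D.weight n (D.bw s.2.2) s.1 j ^ 2 * w.cov j s.2.1 s.2.1 := by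
    rw [hW, Finset.mul_sum]
    refine Finset.sum_le_sum fun j _ => ?_
    rw [mul_comm]
    exact mul_le_mul_of_nonneg_left (hw.1.2.2.2.2 _ _) (sq_nonneg _)
  have hsum1 : ∑ j : Fin n, D.weight n (D.bw s.2.2) s.1 j ^ 2 * w.cov j s.2.1 s.2.1 ≤
      (1 + c.Cmom) * W := by
    rw [hW, Finset.mul_sum]
    refine Finset.sum_le_sum fun j _ => ?_
    rw [mul_comm]
    exact mul_le_mul_of_nonneg_right (hw.1.cov_self_le hc _ _) (sq_nonneg _)
  have hW0 : (C2 * N)⁻¹ ≤ W := by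
    rw [inv_le_iff_one_le_mul₀ (by positivity), mul_comm]
    exact wsq
  have hWpos : 0 < W := lt_of_lt_of_le (by positivity) hW0
  have hW1 : W ≤ (c0 * N)⁻¹ := by
    calc W ≤ ∑ j, (c0 * N)⁻¹ * D.weight n (D.bw s.2.2) s.1 j := by
          refine Finset.sum_le_sum fun j _ => ?_
          rw [sq]
          exact mul_le_mul_of_nonneg_right (wle j) (w0 j)
      _ = _ := by rw [← Finset.mul_sum, wsum, mul_one]
  have hsq : D.sdev w n s ^ 2 =
      ∑ j : Fin n, D.weight n (D.bw s.2.2) s.1 j ^ 2 * w.cov j s.2.1 s.2.1 :=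
    Real.sq_sqrt (le_trans (by positivity) hsum0)
  have hpos : 0 < D.sdev w n s := Real.sqrt_pos.2 (lt_of_lt_of_le (by positivity) hsum0)
  refine ⟨hpos, fun j => ?_, hsq ▸ hsum0, ?_⟩
  · rw [abs_of_nonneg (w0 j)]
    have hmN : n * D.hmin n ^ d ≤ N := by
      rw [hN]
      have := hH.hmin_le_bw hk
      gcongr
    have h1 : (Real.sqrt (C2 / c.Cvar) * Real.sqrt N)⁻¹ ≤ D.sdev w n s := by
      rw [← Real.sqrt_mul (by positivity), ← Real.sqrt_inv]
      refine Real.sqrt_le_sqrt (le_trans ?_ hsum0)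
      calc (C2 / c.Cvar * N)⁻¹ = c.Cvar * (C2 * N)⁻¹ := by field_simp
        _ ≤ _ := by gcongr
    calc D.weight n (D.bw s.2.2) s.1 j ≤ (c0 * N)⁻¹ := wle j
      _ = Real.sqrt (C2 / c.Cvar) / c0 / Real.sqrt N *
          (Real.sqrt (C2 / c.Cvar) * Real.sqrt N)⁻¹ := by
        have h2 : Real.sqrt N * Real.sqrt N = N := Real.mul_self_sqrt hN0.le
        have h3 : Real.sqrt (C2 / c.Cvar) ≠ 0 := by positivity
        have h4 : Real.sqrt N ≠ 0 := by positivity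
        calc (c0 * N)⁻¹ = (c0 * (Real.sqrt N * Real.sqrt N))⁻¹ := by rw [h2]
          _ = _ := by field_simp
      _ ≤ _ := by
        gcongr
        exact le_max_left _ _
  · rw [hsq]
    calc _ ≤ (1 + c.Cmom) * (c0 * N)⁻¹ := hsum1.trans (by gcongr)
      _ = (1 + c.Cmom) / c0 / N := by field_simp
      _ ≤ _ := by gcongr; exact le_max_right _ _

end Design
end CMI


namespace CMI
namespace Design

variable {d : ℕ} {D : Design d} {c : ClassConst} {w : Model d}

/-! ### Gaussian approximation of the maximum of the normalized disturbances -/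

/-- The Gaussian analogue of the normalized smoothed disturbance. -/
noncomputable def zDual (D : Design d) (w : Model d) (n : ℕ) (s : D.Idx n) :
    StrongDual ℝ (Fin n → EuclideanSpace ℝ (D.ineq n)) :=
  (D.sdev w n s)⁻¹ • D.rootDual n (D.sigma w n) s

/-- `E[g₀((max_A Z - t) / β_n)]` for the Gaussian analogue `Z` of the normalized disturbances. -/
noncomputable def gaussVal (D : Design d) (w : Model d) (n : ℕ) (A : Finset (D.Idx n)) (t : ℝ) : ℝ :=
  ∫ e, D.g0 ((maxOver A (fun s => D.zDual w n s e) - t) / D.β n) ∂(D.gauss n)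

/-- The normalized smoothed disturbances. -/
noncomputable def noise (D : Design d) (w : Model d) (n : ℕ) (e : Fin n → ℕ → ℝ) (s : D.Idx n) : ℝ :=
  D.fHat n e s / D.sdev w n s

lemma measurable_fHat (n : ℕ) (s : D.Idx n) : Measurable fun y => D.fHat n y s := by
  unfold fHat smooth
  refine Finset.measurable_sum _ fun j _ => Measurable.const_mul ?_ _
  exact (measurable_pi_apply (X := fun _ : ℕ => ℝ) _).comp (measurable_pi_apply j)

lemma measurable_noise (n : ℕ) (s : D.Idx n) : Measurable fun y => D.noise w n y s :=
  (measurable_fHat n s).div_const _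

lemma map_zDual (hc : c.Admissible) (hw : w ∈ modelClass c D.X) {n : ℕ} {s : D.Idx n}
    (hs : 0 < D.sdev w n s) : (D.gauss n).map (D.zDual w n s) = gaussianReal 0 1 := by
  have hpsd := hw.1.posSemidef_sigma hc D n
  have hv : Var[D.zDual w n s; D.gauss n] = 1 := by
    have h1 : D.sdev w n s ^ 2 = Var[D.rootDual n (D.sigma w n) s; D.gauss n] := by
      rw [variance_rootDual hpsd, sdev, Real.sq_sqrt]
      · rfl
      · refine Finset.sum_nonneg fun j _ => mul_nonneg (sq_nonneg _) ?_
        exact le_trans hc.2.2.2.1.le (hw.1.2.2.2.2 _ _)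
    rw [zDual, variance_smul_dual, ← h1, ← mul_pow, inv_mul_cancel₀ hs.ne', one_pow]
  rw [map_strongDual_eq_gaussianReal (integral_id_gauss n) _ hv, Real.toNNReal_one]

/-- The square of the Lindeberg error is `β_n⁴` times the quantity in the rate assumption, and `β_n`
is bounded. -/
lemma tendsto_lindeberg (hH : D.BandwidthCond)
    (hβ : ∀ n, 0 < D.β n) {Cβ : ℝ} (hβC : ∀ n, D.β n ≤ Cβ)
    (hrate : Tendsto (fun n : ℕ => (D.numIneq n : ℝ) ^ 6 * Real.log n ^ 4 /
      (D.β n ^ 10 * D.hmin n ^ (3 * d) * n)) atTop (𝓝 0)) :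
    Tendsto (fun n : ℕ => Real.log n ^ 2 / D.β n ^ 3 *
      (n * ((Real.sqrt (n * D.hmin n ^ d))⁻¹ ^ 3 * (D.numIneq n : ℝ) ^ 3))) atTop (𝓝 0) := by
  have hC0 : 0 ≤ Cβ := (hβ 0).le.trans (hβC 0)
  have h0 := ((hrate.const_mul (Cβ ^ 4)).sqrt)
  rw [mul_zero, Real.sqrt_zero] at h0
  refine squeeze_zero' ?_ ?_ h0
  · filter_upwards with n
    have := hβ n
    positivity
  · filter_upwards [eventually_gt_atTop 0] with n hn
    have hn0 : (0 : ℝ) < n := by exact_mod_cast hn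
    have hb := hβ n
    have hm := hH.hmin_pos n
    apply Real.le_sqrt_of_sq_le
    set N : ℝ := n * D.hmin n ^ d with hN
    have hN0 : 0 < N := by positivity
    have hs : Real.sqrt N ^ 2 = N := Real.sq_sqrt hN0.le
    have e1 : (Real.log n ^ 2 / D.β n ^ 3 * (n * ((Real.sqrt N)⁻¹ ^ 3 * (D.numIneq n : ℝ) ^ 3))) ^ 2
        = D.β n ^ 4 * ((D.numIneq n : ℝ) ^ 6 * Real.log n ^ 4 /
          (D.β n ^ 10 * D.hmin n ^ (3 * d) * n)) := by
      have e2 : ((Real.sqrt N)⁻¹ ^ 3) ^ 2 = (n ^ 3 * D.hmin n ^ (3 * d))⁻¹ := by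
        rw [← pow_mul, inv_pow, show 3 * 2 = 2 * 3 from rfl, pow_mul, hs, hN, mul_pow, ← pow_mul,
          mul_comm d 3]
      calc _ = (Real.log n ^ 4 / D.β n ^ 6) * (n ^ 2 * (((Real.sqrt N)⁻¹ ^ 3) ^ 2 *
            (D.numIneq n : ℝ) ^ 6)) := by ring
        _ = _ := by rw [e2]; field_simp
    rw [e1]
    have : 0 ≤ (D.numIneq n : ℝ) ^ 6 * Real.log n ^ 4 /
          (D.β n ^ 10 * D.hmin n ^ (3 * d) * n) := by positivity
    gcongr
    exact hβC n

lemma integrable_coord_multivariateGaussian {n : ℕ} {M : Matrix (D.ineq n) (D.ineq n) ℝ}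
    (hM : M.PosSemidef) {v : ℝ} (m : D.ineq n) (hv : M m m ≤ v) :
    Integrable (fun e : EuclideanSpace ℝ (D.ineq n) => |e m| ^ 3) (multivariateGaussian 0 M) ∧
      ∫ e, |e m| ^ 3 ∂(multivariateGaussian 0 M) ≤ 12 * Real.exp (v / 2) := by
  have hp := measurePreserving_eval_multivariateGaussian (μ := 0) hM (i := m)
  simp only [PiLp.zero_apply] at hp
  obtain ⟨h1, h2⟩ := integrable_abs_pow_three_gaussianReal (M m m).toNNReal
  refine ⟨hp.integrable_comp_of_integrable h1, ?_⟩
  rw [← integral_map (f := fun x : ℝ => |x| ^ 3) hp.measurable.aemeasurable (by fun_prop), hp.map_eq]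
  refine h2.trans ?_
  rw [Real.coe_toNNReal _ (hM.diag_nonneg)]
  gcongr

/-- Uniform Gaussian approximation. -/
theorem eventually_abs_integral_noise_sub_le (hc : c.Admissible) (hX : D.DesignPointsCond)
    (hH : D.BandwidthCond) (hK : D.KernelCond) (hg : D.TestFunctionCond) {κ : ℝ}
    (hKκ : Tendsto (fun n : ℕ => D.numIneq n * Real.log n / (n : ℝ) ^ (κ / 4)) atTop (𝓝 0))
    (hβ : ∀ n, 0 < D.β n) {Cβ : ℝ} (hβC : ∀ n, D.β n ≤ Cβ)
    (hrate : Tendsto (fun n : ℕ => (D.numIneq n : ℝ) ^ 6 * Real.log n ^ 4 /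
      (D.β n ^ 10 * D.hmin n ^ (3 * d) * n)) atTop (𝓝 0)) {η : ℝ} (hη : 0 < η) :
    ∀ᶠ n : ℕ in atTop, ∀ w ∈ modelClass c D.X, ∀ A ⊆ D.S n, A.Nonempty → ∀ t σ : ℝ, |σ| = 1 →
      |∫ e, D.g0 ((maxOver A (fun s => σ * D.noise w n e s) - t) / D.β n)
          ∂(Measure.pi fun j : Fin n => w.law j) - D.gaussVal w n A t| ≤ η := by
  have hg' : IsTestFunction D.g0 := hg
  obtain ⟨K, hK0, hcomp⟩ := hg'.exists_abs_integral_max_sub_le (half_pos hη)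
  obtain ⟨Cs, hCs, hsd⟩ := exists_sdevBounds hc hX hH hK
  obtain ⟨p, hp1, hcard⟩ := exists_card_S_le hH hKκ
  set Q : ℝ := 1 + c.Cmom + 12 * Real.exp ((1 + c.Cmom) / 2) with hQ
  have hlim := (tendsto_lindeberg hH hβ hβC hrate).const_mul (K * (p ^ 2 * Cs ^ 3 * Q))
  rw [mul_zero] at hlim
  filter_upwards [hsd, hcard, hlim.eventually (gt_mem_nhds (half_pos hη)), eventually_ge_atTop 3]
    with n hn hnc hsmall hn3 w hw A hA hAne t σ hσ
  have hn0 : (0 : ℝ) < n := by positivity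
  have hlog1 : 1 ≤ Real.log n := by
    rw [Real.le_log_iff_exp_le hn0]
    have : (3 : ℝ) ≤ n := by exact_mod_cast hn3
    linarith [Real.exp_one_lt_d9]
  have hpsd := hw.1.posSemidef_sigma hc D n
  set B : ℝ := Cs / Real.sqrt (n * D.hmin n ^ d) with hB
  have hB0 : 0 ≤ B := by positivity
  -- coefficients
  let a : Fin n → D.Idx n → ℝ := fun j s => D.weight n (D.bw s.2.2) s.1 j / D.sdev w n s
  have ha : ∀ j, ∀ s ∈ A, |a j s| ≤ B := fun j s hs => by
    obtain ⟨h1, h2, -⟩ := hn w hw s (hA hs)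
    simp only [a]
    rw [abs_div, abs_of_pos h1, div_le_iff₀ h1]
    exact h2 j
  have hlogA : Real.log A.card ≤ p * Real.log n := by
    have h1 : (A.card : ℝ) ≤ Real.exp (p * Real.log n) :=
      le_trans (by exact_mod_cast Finset.card_le_card hA) hnc
    rw [← Real.log_exp (p * Real.log n)]
    exact Real.log_le_log (by exact_mod_cast hAne.card_pos) h1
  have hmeas : ∀ m : ℕ, Measurable fun e : ℕ → ℝ => e m := fun m => measurable_pi_apply m
  have hmom := fun (j : Fin n) => integrable_mul_sum_abs_pow_three (μ := w.law j)
    (s := Finset.univ) (v := fun (m : D.ineq n) e => e m) (B := B) (fun m _ => hmeas m)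
    (fun m _ => (hw.1.integrable_pow hc j m (k := 3) (by norm_num)).1)
    (fun m _ => (hw.1.integrable_pow hc j m (k := 3) (by norm_num)).2) hB0
  have hmom' := fun (j : Fin n) => integrable_mul_sum_abs_pow_three
    (μ := multivariateGaussian 0 (D.sigma w n j))
    (s := Finset.univ) (v := fun (m : D.ineq n) e => e m) (B := B) (fun m _ => by fun_prop)
    (fun m _ => (integrable_coord_multivariateGaussian (hpsd j) m (hw.1.cov_self_le hc j m)).1)
    (fun m _ => (integrable_coord_multivariateGaussian (hpsd j) m (hw.1.cov_self_le hc j m)).2) hB0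
  -- One bound serves all test points and bandwidths at once: an observation contributes to every
  -- index at most `B` times the sum of its absolute disturbances. Only the number of inequalities
  -- enters the third moment.
  have hbound : ∀ {x : D.ineq n → ℝ} {j : Fin n} {s : D.Idx n}, s ∈ A → ∀ τ : ℝ, |τ| = 1 →
      |τ * (a j s * x s.2.1)| ≤ B * ∑ m, |x m| := fun {x j s} hs τ hτ => by
    rw [abs_mul, hτ, one_mul, abs_mul]
    exact mul_le_mul (ha j s hs)
      (Finset.single_le_sum (f := fun m => |x m|) (fun m _ => abs_nonneg _) (Finset.mem_univ _))
      (abs_nonneg _) hB0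
  have hcoordG : ∀ (j : Fin n) (m : D.ineq n), MemLp (fun e : EuclideanSpace ℝ (D.ineq n) => e m) 2
      (multivariateGaussian 0 (D.sigma w n j)) := fun j m =>
    IsGaussian.memLp_dual (multivariateGaussian 0 (D.sigma w n j))
      (EuclideanSpace.proj m : StrongDual ℝ (EuclideanSpace ℝ (D.ineq n))) 2 (by simp)
  have hmeanG : ∀ (j : Fin n) (m : D.ineq n),
      ∫ e, e m ∂(multivariateGaussian 0 (D.sigma w n j)) = 0 := fun j m => by
    have h := integral_of_map_gaussianReal (Z := fun e : EuclideanSpace ℝ (D.ineq n) => e m)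
      (by fun_prop) (measurePreserving_eval_multivariateGaussian (μ := 0) (hpsd j) (i := m)).map_eq
    exact h
  have key := hcomp A hAne (hβ n) (ℓ := p * Real.log n) (by nlinarith) hlogA n
    (fun j => w.law j) (fun j => multivariateGaussian 0 (D.sigma w n j))
    (fun j e s => σ * (a j s * e s.2.1)) (fun j e s => a j s * e s.2.1)
    (fun j e => B * ∑ m : D.ineq n, |e m|) (fun j e => B * ∑ m : D.ineq n, |e m|)
    (fun j s _ => ((hmeas _).const_mul _).const_mul _) (fun j s _ => by fun_prop)
    (fun j e s hs => hbound (x := fun m => e m) (j := j) hs σ hσ)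
    (fun j e s hs => by simpa using hbound (x := fun m => e m) (j := j) hs 1 (by simp))
    (fun j => (hmom j).1) (fun j => (hmom' j).1)
    (fun j s hs => by
      rw [integral_const_mul, integral_const_mul, integral_const_mul, hw.1.2.1, hmeanG]
      ring)
    -- Second moments do not see the sign `σ`, so noise and negated noise have the same Gaussian
    -- analogue.
    (fun j s hs s' hs' => by
      have hσ2 : σ * σ = 1 := by rw [← abs_mul_abs_self, hσ, one_mul]
      have e1 : ∀ e : ℕ → ℝ, σ * (a j s * e s.2.1) * (σ * (a j s' * e s'.2.1)) =
          a j s * a j s' * (e s.2.1 * e s'.2.1) := fun e => by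
        linear_combination (a j s * e s.2.1 * (a j s' * e s'.2.1)) * hσ2
      have e2 : ∀ e : EuclideanSpace ℝ (D.ineq n), a j s * e s.2.1 * (a j s' * e s'.2.1) =
          a j s * a j s' * (e s.2.1 * e s'.2.1) := fun e => by ring
      simp_rw [e1, e2]
      rw [integral_const_mul, integral_const_mul]
      congr 1
      have h1 := covariance_eval_multivariateGaussian (μ := 0) (hpsd j) s.2.1 s'.2.1
      rw [covariance_eq_sub (hcoordG j _) (hcoordG j _), hmeanG, hmeanG, mul_zero, sub_zero] at h1
      exact h1.symm) t
  have e1 : ∀ (e : Fin n → ℕ → ℝ) (s : D.Idx n), ∑ j, σ * (a j s * e j s.2.1) =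
      σ * D.noise w n e s := fun e s => by
    rw [← Finset.mul_sum, noise, fHat, smooth, Finset.sum_div]
    congr 1
    exact Finset.sum_congr rfl fun j _ => by simp only [a]; ring
  have e2 : ∀ (e : Fin n → EuclideanSpace ℝ (D.ineq n)) (s : D.Idx n), ∑ j, a j s * e j s.2.1 =
      D.smooth n (fun j m => e j m) s / D.sdev w n s := fun e s => by
    rw [smooth, Finset.sum_div]
    exact Finset.sum_congr rfl fun j _ => by simp only [a]; ring
  simp_rw [e1, e2] at key
  have e3 := integral_max_smooth_eq (D := D) n (D.sigma w n) A (D.sdev w n)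
    (g := fun x => D.g0 ((x - t) / D.β n)) (hg'.continuous.measurable.comp (by fun_prop))
  have e4 : ∀ e s, D.rootDual n (D.sigma w n) s e / D.sdev w n s = D.zDual w n s e := fun e s => by
    simp [zDual, div_eq_inv_mul]
  simp_rw [e4] at e3
  rw [e3] at key
  refine key.trans ?_
  have hsum : ∑ j : Fin n, (∫ e, (B * ∑ m : D.ineq n, |e m|) ^ 3 ∂(w.law j) +
      ∫ e, (B * ∑ m : D.ineq n, |e m|) ^ 3 ∂(multivariateGaussian 0 (D.sigma w n j))) ≤
      n * (B ^ 3 * (D.numIneq n : ℝ) ^ 3 * Q) := by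
    have : ∀ j ∈ (Finset.univ : Finset (Fin n)),
        (∫ e, (B * ∑ m : D.ineq n, |e m|) ^ 3 ∂(w.law j) +
        ∫ e, (B * ∑ m : D.ineq n, |e m|) ^ 3 ∂(multivariateGaussian 0 (D.sigma w n j))) ≤
        B ^ 3 * (D.numIneq n : ℝ) ^ 3 * Q := fun j _ => by
      have h1 := (hmom j).2
      have h2 := (hmom' j).2
      simp only [Finset.card_univ, Fintype.card_coe] at h1 h2
      rw [hQ, mul_add]
      exact add_le_add h1 h2
    simpa using Finset.sum_le_card_nsmul _ _ _ this
  have hpos : 0 ≤ (p * Real.log n) ^ 2 / D.β n ^ 3 := by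
    have := hβ n; positivity
  have hfin : K * ((p * Real.log n) ^ 2 / D.β n ^ 3 * (n * (B ^ 3 * (D.numIneq n : ℝ) ^ 3 * Q))) =
      K * (p ^ 2 * Cs ^ 3 * Q) * (Real.log n ^ 2 / D.β n ^ 3 *
      (n * ((Real.sqrt (n * D.hmin n ^ d))⁻¹ ^ 3 * (D.numIneq n : ℝ) ^ 3))) := by
    rw [hB, div_eq_mul_inv Cs]; ring
  have := mul_le_mul_of_nonneg_left (mul_le_mul_of_nonneg_left hsum hpos) hK0
  linarith

end Design
end CMI


namespace CMI

/-! ### Smoothed distribution functions and their quantiles -/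

/-- Continuous distribution functions. -/
structure IsContCdf (F : ℝ → ℝ) : Prop where
  continuous : Continuous F
  mono : Monotone F
  tendsto_atBot : Tendsto F atBot (𝓝 0)
  tendsto_atTop : Tendsto F atTop (𝓝 1)

/-- The solution set is nonempty by the intermediate value theorem, bounded below and closed, so its
infimum is a solution. By monotonicity the least solution is then the quantile, adjoint to `F`. -/
lemma IsContCdf.sInf_spec {F : ℝ → ℝ} (hF : IsContCdf F) {q : ℝ} (h0 : 0 < q) (h1 : q < 1) :
    F (sInf {t | F t = q}) = q ∧ ∀ t, sInf {t | F t = q} ≤ t ↔ q ≤ F t := by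
  obtain ⟨a, ha⟩ := (hF.tendsto_atBot.eventually (gt_mem_nhds h0)).exists
  obtain ⟨b, hb⟩ := (hF.tendsto_atTop.eventually (lt_mem_nhds h1)).exists
  have hab : a ≤ b := by
    by_contra h
    have := hF.mono (not_le.1 h).le
    linarith
  have hivt : ∀ t, q ≤ F t → ∃ u ≤ t, F u = q := fun t ht => by
    have hat : a ≤ t := by
      by_contra h
      have := hF.mono (not_le.1 h).le
      linarith
    obtain ⟨u, hu, hu'⟩ := intermediate_value_Icc hat hF.continuous.continuousOn ⟨ha.le, ht⟩
    exact ⟨u, hu.2, hu'⟩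
  have hbdd : BddBelow {t | F t = q} := ⟨a, fun t ht => by
    by_contra h
    have := hF.mono (not_le.1 h).le
    rw [Set.mem_ofPred_eq] at ht
    linarith⟩
  have hne : {t | F t = q}.Nonempty := by
    obtain ⟨u, -, hu⟩ := hivt b hb.le
    exact ⟨u, hu⟩
  have hmem : F (sInf {t | F t = q}) = q :=
    (isClosed_singleton.preimage hF.continuous : IsClosed {t | F t = q}).csInf_mem hne hbdd
  refine ⟨hmem, fun t => ⟨fun h => hmem ▸ hF.mono h, fun h => ?_⟩⟩
  obtain ⟨u, hut, hu⟩ := hivt t h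
  exact (csInf_le hbdd hu).trans hut

section Smooth

variable {Ω : Type*} [MeasurableSpace Ω] {P : Measure Ω} [IsProbabilityMeasure P] {g : ℝ → ℝ}
  {T : Ω → ℝ} {β : ℝ}

namespace IsTestFunction

lemma integrable_comp (hg : IsTestFunction g) {T : Ω → ℝ} (hT : Measurable T) :
    Integrable (fun ω => g (T ω)) P :=
  Integrable.of_bound (hg.continuous.measurable.comp hT).aestronglyMeasurable 1
    (ae_of_all _ fun _ => hg.abs_le_one _)

lemma isContCdf (hg : IsTestFunction g) (hT : Measurable T) (hβ : 0 < β) :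
    IsContCdf fun t => ∫ ω, g ((T ω - t) / β) ∂P := by
  have hmeas : ∀ t, AEStronglyMeasurable (fun ω => g ((T ω - t) / β)) P := fun t =>
    (hg.continuous.measurable.comp (by fun_prop)).aestronglyMeasurable
  have hbd : ∀ t, ∀ᵐ ω ∂P, ‖g ((T ω - t) / β)‖ ≤ 1 := fun t => ae_of_all _ fun _ => hg.abs_le_one _
  refine ⟨?_, ?_, ?_, ?_⟩
  · refine continuous_of_dominated (bound := fun _ => 1) hmeas hbd (integrable_const 1)
      (ae_of_all _ fun ω => ?_)
    exact hg.continuous.comp (by fun_prop)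
  · intro t t' h
    refine integral_mono (hg.integrable_comp (by fun_prop)) (hg.integrable_comp (by fun_prop))
      fun ω => hg.antitone ?_
    gcongr
  · have : (0 : ℝ) = ∫ _ : Ω, (0 : ℝ) ∂P := by simp
    rw [this]
    refine tendsto_integral_filter_of_dominated_convergence (fun _ => 1) (Eventually.of_forall hmeas)
      (Eventually.of_forall hbd) (integrable_const 1) (ae_of_all _ fun ω => ?_)
    refine tendsto_const_nhds.congr' ?_
    filter_upwards [eventually_le_atBot (T ω - β)] with t ht
    exact (hg.2.2.2 _ ((one_le_div hβ).2 (by linarith))).symm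
  · have : (1 : ℝ) = ∫ _ : Ω, (1 : ℝ) ∂P := by simp
    rw [this]
    refine tendsto_integral_filter_of_dominated_convergence (fun _ => 1) (Eventually.of_forall hmeas)
      (Eventually.of_forall hbd) (integrable_const 1) (ae_of_all _ fun ω => ?_)
    refine tendsto_const_nhds.congr' ?_
    filter_upwards [eventually_ge_atTop (T ω)] with t ht
    exact (hg.2.2.1 _ (div_nonpos_of_nonpos_of_nonneg (by linarith) hβ.le)).symm

lemma measureReal_le_integral (hg : IsTestFunction g) (hT : Measurable T) (hβ : 0 < β) (t : ℝ) :
    P.real {ω | T ω ≤ t} ≤ ∫ ω, g ((T ω - t) / β) ∂P := by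
  have hm : MeasurableSet {ω | T ω ≤ t} := measurableSet_le hT measurable_const
  rw [← integral_indicator_one hm]
  refine integral_mono ((integrable_const (1 : ℝ)).indicator hm) (hg.integrable_comp (by fun_prop))
    fun ω => ?_
  by_cases h : T ω ≤ t
  · simp only [Set.indicator, Set.mem_ofPred_eq, h, if_true, Pi.one_apply]
    exact (hg.2.2.1 _ (div_nonpos_of_nonpos_of_nonneg (by linarith) hβ.le)).ge
  · simp only [Set.indicator, Set.mem_ofPred_eq, h, if_false]
    exact hg.nonneg _

lemma integral_le_measureReal (hg : IsTestFunction g) (hT : Measurable T) (hβ : 0 < β) (t : ℝ) :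
    ∫ ω, g ((T ω - t) / β) ∂P ≤ P.real {ω | T ω < t + β} := by
  have hm : MeasurableSet {ω | T ω < t + β} := measurableSet_lt hT measurable_const
  rw [← integral_indicator_one hm]
  refine integral_mono (hg.integrable_comp (by fun_prop)) ((integrable_const (1 : ℝ)).indicator hm)
    fun ω => ?_
  by_cases h : T ω < t + β
  · simp only [Set.indicator, Set.mem_ofPred_eq, h, if_true, Pi.one_apply]
    exact hg.le_one _
  · simp only [Set.indicator, Set.mem_ofPred_eq, h, if_false]
    exact (hg.2.2.2 _ ((one_le_div hβ).2 (by linarith))).le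

end IsTestFunction

/-- Smoothed distribution functions of maxima of standard normal variables have a bounded modulus
of continuity, up to logarithmic factors. -/
lemma IsTestFunction.exists_integral_max_add_le (hg : IsTestFunction g) : ∃ C : ℝ, 0 ≤ C ∧
    ∀ {Ω : Type} [NormedAddCommGroup Ω] [NormedSpace ℝ Ω] [MeasurableSpace Ω] [BorelSpace Ω]
      [SecondCountableTopology Ω] [CompleteSpace Ω] {P : Measure Ω} [IsGaussian P] {ι : Type}
      [Countable ι] (Z : ι → StrongDual ℝ Ω) (A : Finset ι), A.Nonempty →
      (∀ s ∈ A, P.map (Z s) = gaussianReal 0 1) → ∀ {β r B : ℝ}, 0 < β → 0 ≤ r → 0 ≤ B → ∀ t,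
      ∫ ω, g ((maxOver A (fun s => Z s ω) - (t + r)) / β) ∂P ≤
        ∫ ω, g ((maxOver A (fun s => Z s ω) - t) / β) ∂P +
          (A.card * (2 * Real.exp (-B ^ 2 / 2)) + C * (1 + B) * r) := by
  obtain ⟨L, hL0, hL, -⟩ := hg.exists_smoothing
  refine ⟨Real.exp 4 * (1 + L), by positivity, ?_⟩
  intro Ω _ _ _ _ _ _ P _ ι _ Z A hA hZ β r B hβ hr hB t
  set T : Ω → ℝ := fun ω => maxOver A (fun s => Z s ω) with hT
  have hTm : Measurable T := measurable_maxOver fun s _ => (Z s).continuous.measurable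
  -- A shift by `r` changes the value of `g` by at most `q`, and only when the maximum lies in `(t,
  -- t + r + β]`. Since `q (r + β) ≤ (1 + L) r`, the resulting bound is free of `1 / β`.
  set q : ℝ := min 1 (L * (r / β)) with hq
  have hq0 : 0 ≤ q := by positivity
  have hq1 : q ≤ 1 := min_le_left _ _
  set I : Set Ω := {ω | (∀ s ∈ A, Z s ω ≤ t + (r + β)) ∧ ∃ s ∈ A, t < Z s ω} with hI
  have hIm : MeasurableSet I := by
    have : I = {ω | T ω ≤ t + (r + β)} ∩ {ω | t < T ω} := by
      ext ω
      simp only [hI, hT, Set.mem_ofPred_eq, Set.mem_inter_iff, maxOver_le_iff hA, lt_maxOver_iff hA]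
    rw [this]
    exact (measurableSet_le hTm measurable_const).inter (measurableSet_lt measurable_const hTm)
  have hprob := measureReal_max_mem_Ioc_le (μ := P) Z A hZ t (δ := r + β) (by positivity) hB
  have hpt : ∀ ω, g ((T ω - (t + r)) / β) ≤ g ((T ω - t) / β) + q * I.indicator 1 ω := by
    intro ω
    by_cases hω : ω ∈ I
    · rw [Set.indicator_of_mem hω, Pi.one_apply, mul_one]
      rcases min_choice 1 (L * (r / β)) with h | h
      · rw [hq, h]
        linarith [hg.nonneg ((T ω - t) / β), hg.le_one ((T ω - (t + r)) / β)]
      · rw [hq, h]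
        have h1 := hL ((T ω - (t + r)) / β) ((T ω - t) / β)
        have h2 : |(T ω - (t + r)) / β - (T ω - t) / β| = r / β := by
          rw [← sub_div, show T ω - (t + r) - (T ω - t) = -r by ring, neg_div, abs_neg,
            abs_of_nonneg (by positivity)]
        rw [h2] at h1
        linarith [le_abs_self (g ((T ω - (t + r)) / β) - g ((T ω - t) / β))]
    · rw [Set.indicator_of_notMem hω, mul_zero, add_zero]
      have hω' : t + (r + β) < T ω ∨ T ω ≤ t := by
        by_contra hcon
        push Not at hcon
        refine hω ⟨(maxOver_le_iff hA).1 hcon.1, (lt_maxOver_iff hA).1 hcon.2⟩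
      rcases hω' with h | h
      · rw [hg.2.2.2 ((T ω - (t + r)) / β) ((one_le_div hβ).2 (by linarith))]
        exact hg.nonneg _
      · rw [hg.2.2.1 ((T ω - t) / β) (div_nonpos_of_nonpos_of_nonneg (by linarith) hβ.le)]
        exact hg.le_one _
  have hint : ∀ t', Integrable (fun ω => g ((T ω - t') / β)) P := fun t' =>
    hg.integrable_comp (by fun_prop)
  have hind : Integrable (fun ω => q * I.indicator (1 : Ω → ℝ) ω) P :=
    ((integrable_const (1 : ℝ)).indicator hIm).const_mul q
  have h1 := integral_mono (hint (t + r)) ((hint t).add hind) hpt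
  simp only [Pi.add_apply] at h1
  rw [integral_add (hint t) hind, integral_const_mul, integral_indicator_one hIm] at h1
  refine h1.trans ?_
  gcongr
  have h2 : q * β ≤ L * r := by
    calc q * β ≤ L * (r / β) * β := by gcongr; exact min_le_right _ _
      _ = _ := by field_simp
  calc q * P.real I ≤ q * (A.card * (2 * Real.exp (-B ^ 2 / 2)) +
        Real.exp 4 * (r + β) * (1 + B)) := by gcongr
    _ = q * (A.card * (2 * Real.exp (-B ^ 2 / 2))) +
        Real.exp 4 * (1 + B) * (q * r + q * β) := by ring
    _ ≤ 1 * (A.card * (2 * Real.exp (-B ^ 2 / 2))) + Real.exp 4 * (1 + B) * (1 * r + L * r) := by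
        gcongr
    _ = _ := by ring

end Smooth
end CMI


namespace CMI
namespace Design

variable {d : ℕ} {D : Design d} {c : ClassConst} {w : Model d} {κ Cβ : ℝ}

/-- The standing assumptions on the design, the class of models, and the rates. -/
structure Setting (D : Design d) (c : ClassConst) (κ Cβ : ℝ) : Prop where
  hd : 0 < d
  hc : c.Admissible
  hX : D.DesignPointsCond
  hH : D.BandwidthCond
  hK : D.KernelCond
  hI : D.TestPointsCond
  hg : IsTestFunction D.g0
  hS : D.EstimatorCond
  hcover : ∀ m : ℕ, ∀ᶠ n in atTop, m ∈ D.ineq n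
  hκ : 0 < κ
  hKκ : Tendsto (fun n : ℕ => D.numIneq n * Real.log n / (n : ℝ) ^ (κ / 4)) atTop (𝓝 0)
  hβ : ∀ n, 0 < D.β n
  hβC : ∀ n, D.β n ≤ Cβ
  hrate : Tendsto (fun n : ℕ => (D.numIneq n : ℝ) ^ 6 * Real.log n ^ 4 /
      (D.β n ^ 10 * D.hmin n ^ (3 * d) * n)) atTop (𝓝 0)

/-! ### Properties of the Gaussian analogue -/

lemma measurable_max_dual {n : ℕ} {A : Finset (D.Idx n)}
    (Z : D.Idx n → StrongDual ℝ (Fin n → EuclideanSpace ℝ (D.ineq n))) :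
    Measurable fun e => maxOver A fun s => Z s e :=
  measurable_maxOver fun s _ => (Z s).continuous.measurable

lemma tendsto_log_natCast : Tendsto (fun n : ℕ => Real.log n) atTop atTop :=
  Real.tendsto_log_atTop.comp tendsto_natCast_atTop_atTop

/-- The bound `n ^ (-κ / 4)` for negligible perturbations. -/
noncomputable def slack (κ : ℝ) (n : ℕ) : ℝ := (n : ℝ) ^ (-(κ / 4))

lemma slack_nonneg (n : ℕ) : 0 ≤ slack κ n := Real.rpow_nonneg (Nat.cast_nonneg _) _

lemma tendsto_rpow_mul_log_pow {θ : ℝ} (hθ : 0 < θ) (k : ℕ) :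
    Tendsto (fun n : ℕ => (n : ℝ) ^ (-θ) * Real.log n ^ k) atTop (𝓝 0) := by
  have h := (isLittleO_log_rpow_rpow_atTop (k : ℝ) hθ).tendsto_div_nhds_zero
  refine (h.comp tendsto_natCast_atTop_atTop).congr fun n => ?_
  simp only [Function.comp_def, Real.rpow_natCast]
  rw [Real.rpow_neg (Nat.cast_nonneg _), div_eq_inv_mul]

lemma tendsto_slack_mul_log_pow (hκ : 0 < κ) (k : ℕ) :
    Tendsto (fun n : ℕ => slack κ n * Real.log n ^ k) atTop (𝓝 0) :=
  tendsto_rpow_mul_log_pow (by positivity) k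

lemma tendsto_slack (hκ : 0 < κ) : Tendsto (slack κ) atTop (𝓝 0) := by
  simpa using tendsto_slack_mul_log_pow hκ 0

/-- Union bounds over the index set at levels of logarithmic order are negligible. -/
lemma tendsto_union_bound {p : ℝ} (hp : 1 ≤ p) :
    Tendsto (fun n : ℕ => Real.exp (p * Real.log n) *
      (2 * Real.exp (-(2 * p * Real.log n) ^ 2 / 2))) atTop (𝓝 0) := by
  have h0 : Tendsto (fun n : ℕ => 2 * Real.exp (-Real.log n)) atTop (𝓝 (2 * 0)) :=
    (Real.tendsto_exp_atBot.comp (tendsto_neg_atTop_atBot.comp tendsto_log_natCast)).const_mul 2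
  rw [mul_zero] at h0
  refine squeeze_zero' (Eventually.of_forall fun n => by positivity) ?_ h0
  filter_upwards [tendsto_log_natCast.eventually_ge_atTop 1] with n hn
  calc Real.exp (p * Real.log n) * (2 * Real.exp (-(2 * p * Real.log n) ^ 2 / 2))
      = 2 * Real.exp (p * Real.log n - (2 * p * Real.log n) ^ 2 / 2) := by
        rw [sub_eq_add_neg, Real.exp_add, neg_div]; ring
    _ ≤ _ := by
        gcongr
        have h1 : Real.log n ≤ p * Real.log n := by nlinarith
        nlinarith

lemma Setting.isContCdf_gaussVal (hs : Setting D c κ Cβ) (w : Model d) (n : ℕ)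
    (A : Finset (D.Idx n)) : IsContCdf (D.gaussVal w n A) :=
  hs.hg.isContCdf (measurable_max_dual _) (hs.hβ n)

/-- In the anticoncentration bound `B = 2 p log n` makes the union bound over the polynomially many
indices negligible, and `slack` beats the remaining logarithm. -/
lemma Setting.eventually_gaussVal_add_le (hs : Setting D c κ Cβ) {η : ℝ} (hη : 0 < η) :
    ∀ᶠ n : ℕ in atTop, ∀ w ∈ modelClass c D.X, ∀ A ⊆ D.S n, A.Nonempty → ∀ t,
      D.gaussVal w n A (t + slack κ n) ≤ D.gaussVal w n A t + η := by
  obtain ⟨C, hC0, hC⟩ := hs.hg.exists_integral_max_add_le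
  obtain ⟨p, hp1, hcard⟩ := exists_card_S_le hs.hH hs.hKκ
  obtain ⟨Cs, -, hsd⟩ := exists_sdevBounds hs.hc hs.hX hs.hH hs.hK
  have h1 : Tendsto (fun n : ℕ => C * (1 + 2 * p * Real.log n) * slack κ n) atTop (𝓝 0) := by
    have := ((tendsto_slack hs.hκ).const_mul C).add
      ((tendsto_slack_mul_log_pow hs.hκ 1).const_mul (C * (2 * p)))
    rw [mul_zero, mul_zero, add_zero] at this
    exact this.congr fun n => by ring
  filter_upwards [hcard, hsd, (tendsto_union_bound hp1).eventually (gt_mem_nhds (half_pos hη)),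
    h1.eventually (gt_mem_nhds (half_pos hη)), tendsto_log_natCast.eventually_ge_atTop 1]
    with n hn hn2 hn3 hn4 hn5 w hw A hA hAne t
  have key := hC (P := D.gauss n) (D.zDual w n) A hAne
    (fun s hs' => map_zDual hs.hc hw (hn2 w hw s (hA hs')).1) (hs.hβ n) (slack_nonneg (κ := κ) n)
    (B := 2 * p * Real.log n) (by positivity) t
  refine key.trans ?_
  have hA' : (A.card : ℝ) ≤ Real.exp (p * Real.log n) :=
    le_trans (by exact_mod_cast Finset.card_le_card hA) hn
  have : (A.card : ℝ) * (2 * Real.exp (-(2 * p * Real.log n) ^ 2 / 2)) ≤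
      Real.exp (p * Real.log n) * (2 * Real.exp (-(2 * p * Real.log n) ^ 2 / 2)) := by gcongr
  unfold gaussVal
  linarith

/-- The level `log² n`, which maxima do not exceed. -/
lemma Setting.eventually_prob_max_zDual_le (hs : Setting D c κ Cβ) {η : ℝ} (hη : 0 < η) (C : ℝ) :
    ∀ᶠ n : ℕ in atTop, ∀ w ∈ modelClass c D.X,
      (D.gauss n).real {e | ∃ s ∈ D.S n, Real.log n ^ 2 - C ≤ |D.zDual w n s e|} ≤ η := by
  obtain ⟨p, hp1, hcard⟩ := exists_card_S_le hs.hH hs.hKκ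
  obtain ⟨Cs, -, hsd⟩ := exists_sdevBounds hs.hc hs.hX hs.hH hs.hK
  filter_upwards [hcard, hsd, (tendsto_union_bound hp1).eventually (gt_mem_nhds hη),
    tendsto_log_natCast.eventually_ge_atTop (2 * p + 1 + |C|)] with n hn hn2 hn3 hn5 w hw
  have hl : 2 * p * Real.log n ≤ Real.log n ^ 2 - C := by
    have := le_abs_self C
    have := abs_nonneg C
    nlinarith
  have hl0 : 0 ≤ 2 * p * Real.log n := by
    have := abs_nonneg C
    have : 0 ≤ Real.log n := by linarith
    positivity
  have key := measureReal_exists_abs_ge_le (μ := D.gauss n) (D.S n)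
    (X := fun s => D.zDual w n s) (fun s _ => (D.zDual w n s).continuous.measurable)
    (σ := 1) one_pos (fun s hs' => ⟨1, by simp, map_zDual hs.hc hw (hn2 w hw s hs').1⟩) hl0
  refine (measureReal_mono ?_).trans (key.trans (le_trans ?_ hn3.le))
  · rintro e ⟨s, hs', h⟩
    exact ⟨s, hs', hl.trans h⟩
  · rw [mul_one]
    gcongr

open scoped MatrixOrder in
/-- The maximum of the Gaussian analogue tends to infinity. -/
lemma Setting.eventually_gaussVal_le (hs : Setting D c κ Cβ) {η : ℝ} (hη : 0 < η) (T : ℝ) :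
    ∀ᶠ n : ℕ in atTop, ∀ w ∈ modelClass c D.X, D.gaussVal w n (D.S n) T ≤ η := by
  obtain ⟨c0, C2, -, -, hwb⟩ := exists_weightBounds hs.hX hs.hH hs.hK
  obtain ⟨Cs, -, hsd⟩ := exists_sdevBounds hs.hc hs.hX hs.hH hs.hK
  set φ : ℝ := (gaussianReal 0 1).real (Set.Iic (T + Cβ)) with hφ
  have hφ1 : φ < 1 := by
    have h0 : 0 < (gaussianReal 0 1).real (Set.Ioi (T + Cβ)) := by
      rw [measureReal_def]
      refine ENNReal.toReal_pos (fun h0 => ?_) (measure_ne_top _ _)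
      have := (gaussianReal_absolutelyContinuous' 0 (one_ne_zero)) h0
      simp at this
    have h1 := measureReal_add_measureReal_compl (μ := gaussianReal 0 1)
      (measurableSet_Iic (a := T + Cβ))
    rw [Set.compl_Iic, probReal_univ] at h1
    linarith
  have hφ0 : 0 ≤ φ := measureReal_nonneg
  -- `N` independent standard normal variables all stay below `T + Cβ` with probability less than
  -- `η`. They are found among the test points of the smallest bandwidth, for one inequality.
  obtain ⟨N, hN⟩ := exists_pow_lt_of_lt_one hη hφ1
  filter_upwards [hwb, hsd, eventually_le_card_pts hs.hd hs.hX hs.hH hs.hI N, hs.hcover 0]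
    with n hn hn2 hn3 hn4 w hw
  let I := D.pts n (D.depth n)
  let ix : I → D.Idx n := fun i => (i, ⟨0, hn4⟩, D.depth n)
  have hix : ∀ i, ix i ∈ D.S n := fun i => mem_S.2 ⟨le_rfl, i.2⟩
  let Z : I → StrongDual ℝ (Fin n → EuclideanSpace ℝ (D.ineq n)) := fun i => D.zDual w n (ix i)
  have hgl : HasGaussianLaw (fun e (i : I) => Z i e) (D.gauss n) := by
    refine ⟨?_⟩
    have : (fun e (i : I) => Z i e) = ⇑(ContinuousLinearMap.pi Z) := rfl
    rw [this]
    infer_instance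
  have hind : iIndepFun (fun i => ⇑(Z i)) (D.gauss n) := by
    refine hgl.iIndepFun_of_covariance_eq_zero fun i j hij => ?_
    -- Test points more than two bandwidths apart have weights with disjoint supports; uncorrelated
    -- jointly Gaussian variables are independent.
    have hsep := (hs.hI n (D.depth n) le_rfl).1 i i.2 j j.2 (fun h => hij (Subtype.ext h))
    have hz := covariance_sumDual_eq_zero (n := n)
      (μ := fun _ => stdGaussian (EuclideanSpace ℝ (D.ineq n)))
      (L := fun k => D.weight n (D.bw (D.depth n)) i k •
        rowDual (CFC.sqrt (D.sigma w n k)) ⟨0, hn4⟩)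
      (L' := fun k => D.weight n (D.bw (D.depth n)) j k •
        rowDual (CFC.sqrt (D.sigma w n k)) ⟨0, hn4⟩) (fun k => by
        by_cases h : D.bw (D.depth n) < ‖D.X i - D.X k‖
        · left; rw [(hn i _ le_rfl).2.2.2.1 k h, zero_smul]
        · right
          rw [(hn j _ le_rfl).2.2.2.1 k, zero_smul]
          have := norm_sub_le_norm_sub_add_norm_sub (D.X i) (D.X k) (D.X j)
          rw [norm_sub_rev (D.X k)] at this
          linarith)
    have e1 : ∀ i : I, ⇑(Z i) = fun e => (D.sdev w n (ix i))⁻¹ *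
        D.rootDual n (D.sigma w n) (ix i) e := fun i => rfl
    rw [e1 i, e1 j, covariance_const_mul_left, covariance_const_mul_right]
    have e2 : cov[fun e => D.rootDual n (D.sigma w n) (ix i) e,
      fun e => D.rootDual n (D.sigma w n) (ix j) e; D.gauss n] = 0 := hz
    rw [e2, mul_zero, mul_zero]
  have hlaw : ∀ i, (D.gauss n).map (Z i) = gaussianReal 0 1 := fun i =>
    map_zDual hs.hc hw (hn2 w hw _ (hix i)).1
  refine (hs.hg.integral_le_measureReal (measurable_max_dual _) (hs.hβ n) T).trans ?_
  calc (D.gauss n).real {e | maxOver (D.S n) (fun s => D.zDual w n s e) < T + D.β n}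
      ≤ (D.gauss n).real (⋂ i : I, Z i ⁻¹' Set.Iic (T + Cβ)) := by
        refine measureReal_mono fun e he => ?_
        simp only [Set.mem_iInter, Set.mem_preimage, Set.mem_Iic]
        intro i
        rw [Set.mem_ofPred_eq] at he
        have := le_maxOver (r := fun s => D.zDual w n s e) (hix i)
        have := hs.hβC n
        simp only [Z]
        linarith
    _ = φ ^ I.card := by
        rw [measureReal_def, hind.meas_iInter fun i => ⟨_, measurableSet_Iic, rfl⟩,
          ENNReal.toReal_prod]
        have : ∀ i, ((D.gauss n) (Z i ⁻¹' Set.Iic (T + Cβ))).toReal = φ := fun i => by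
          rw [hφ, measureReal_def, ← hlaw i, Measure.map_apply (Z i).continuous.measurable
            measurableSet_Iic]
        simp [this]
    _ ≤ φ ^ N := pow_le_pow_of_le_one hφ0 hφ1.le hn3
    _ ≤ η := hN.le

end Design
end CMI


namespace CMI
namespace Design

open scoped MatrixOrder

variable {d : ℕ} {D : Design d} {c : ClassConst} {w : Model d} {κ Cβ : ℝ}

/-! ### The simulated statistic and its quantiles -/

/-- The normalized smoother of the simulated responses, as a functional of standard normal
vectors. -/
noncomputable def bootDual (D : Design d) (n : ℕ) (y : Fin n → ℕ → ℝ) (s : D.Idx n) :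
    StrongDual ℝ (Fin n → EuclideanSpace ℝ (D.ineq n)) :=
  (D.vHat n y s)⁻¹ • D.rootDual n (D.sigmaHat n y) s

/-- The smoothed conditional distribution function of the simulated statistic. -/
noncomputable def bootVal (D : Design d) (n : ℕ) (y : Fin n → ℕ → ℝ) (A : Finset (D.Idx n))
    (t : ℝ) : ℝ :=
  ∫ u, D.g0 ((D.tBoot n y A u - t) / D.β n) ∂(D.bootLaw n y)

/-- The simulated statistic becomes a functional of standard normal vectors whose law does not
depend on the sample. This places it on the same space as `zDual`. -/
lemma Setting.bootVal_eq (hs : Setting D c κ Cβ) (n : ℕ) (y : Fin n → ℕ → ℝ) (A : Finset (D.Idx n))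
    (t : ℝ) : D.bootVal n y A t =
      ∫ e, D.g0 ((maxOver A (fun s => D.bootDual n y s e) - t) / D.β n) ∂(D.gauss n) := by
  have h := integral_max_smooth_eq (D := D) n (D.sigmaHat n y) A (D.vHat n y)
    (g := fun x => D.g0 ((x - t) / D.β n)) (hs.hg.continuous.measurable.comp (by fun_prop))
  have e1 : ∀ e s, D.rootDual n (D.sigmaHat n y) s e / D.vHat n y s = D.bootDual n y s e :=
    fun e s => by simp [bootDual, div_eq_inv_mul]
  simp_rw [e1] at h
  exact h

lemma Setting.isContCdf_bootVal (hs : Setting D c κ Cβ) (n : ℕ) (y : Fin n → ℕ → ℝ)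
    (A : Finset (D.Idx n)) : IsContCdf (D.bootVal n y A) := by
  have h := hs.hg.isContCdf (P := D.gauss n) (measurable_max_dual (A := A) (D.bootDual n y)) (hs.hβ n)
  have e : D.bootVal n y A = fun t =>
      ∫ e, D.g0 ((maxOver A (fun s => D.bootDual n y s e) - t) / D.β n) ∂(D.gauss n) :=
    funext fun t => hs.bootVal_eq n y A t
  rw [e]
  exact h

lemma Setting.crit_le_iff (hs : Setting D c κ Cβ) {n : ℕ} {y : Fin n → ℕ → ℝ} {A : Finset (D.Idx n)}
    {q : ℝ} (h0 : 0 < q) (h1 : q < 1) (t : ℝ) : D.crit n y A q ≤ t ↔ q ≤ D.bootVal n y A t :=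
  ((hs.isContCdf_bootVal n y A).sInf_spec h0 h1).2 t

lemma Setting.lt_crit_iff (hs : Setting D c κ Cβ) {n : ℕ} {y : Fin n → ℕ → ℝ} {A : Finset (D.Idx n)}
    {q : ℝ} (h0 : 0 < q) (h1 : q < 1) (t : ℝ) : t < D.crit n y A q ↔ D.bootVal n y A t < q := by
  rw [← not_le, hs.crit_le_iff h0 h1, not_le]

lemma Setting.bootVal_anti (hs : Setting D c κ Cβ) {n : ℕ} (y : Fin n → ℕ → ℝ)
    {A B : Finset (D.Idx n)} (hA : A.Nonempty) (hAB : A ⊆ B) (t : ℝ) :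
    D.bootVal n y B t ≤ D.bootVal n y A t := by
  rw [hs.bootVal_eq, hs.bootVal_eq]
  have hβ := hs.hβ n
  refine integral_mono (hs.hg.integrable_comp (((measurable_max_dual _).sub_const _).div_const _))
    (hs.hg.integrable_comp (((measurable_max_dual _).sub_const _).div_const _)) fun e => hs.hg.antitone ?_
  gcongr
  exact maxOver_mono hA hAB

lemma Setting.crit_mono (hs : Setting D c κ Cβ) {n : ℕ} {y : Fin n → ℕ → ℝ}
    {A B : Finset (D.Idx n)} (hA : A.Nonempty) (hAB : A ⊆ B) {q : ℝ} (h0 : 0 < q) (h1 : q < 1) :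
    D.crit n y A q ≤ D.crit n y B q := by
  rw [hs.crit_le_iff h0 h1]
  exact ((hs.crit_le_iff h0 h1 _).1 le_rfl).trans (hs.bootVal_anti y hA hAB _)

lemma Setting.vHat_sq (hs : Setting D c κ Cβ) (n : ℕ) (y : Fin n → ℕ → ℝ) (s : D.Idx n) :
    D.vHat n y s ^ 2 =
      ∑ j, D.weight n (D.bw s.2.2) s.1 j ^ 2 * D.sigmaHat n y j s.2.1 s.2.1 := by
  rw [vHat, Real.sq_sqrt]
  exact Finset.sum_nonneg fun j _ => mul_nonneg (sq_nonneg _) ((hs.hS.2 n y j).diag_nonneg)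

/-- The variance is one, except when the estimated standard deviation vanishes; then division by
zero gives the zero functional. -/
lemma Setting.map_bootDual (hs : Setting D c κ Cβ) (n : ℕ) (y : Fin n → ℕ → ℝ) (s : D.Idx n) :
    ∃ v : NNReal, (v : ℝ) ≤ 1 ∧ (D.gauss n).map (D.bootDual n y s) = gaussianReal 0 v := by
  have hv : Var[D.bootDual n y s; D.gauss n] = (D.vHat n y s)⁻¹ ^ 2 * D.vHat n y s ^ 2 := by
    rw [bootDual, variance_smul_dual, variance_rootDual (hs.hS.2 n y), hs.vHat_sq]
  refine ⟨_, ?_, map_strongDual_eq_gaussianReal (integral_id_gauss n) _ hv⟩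
  rw [← mul_pow, Real.coe_toNNReal _ (sq_nonneg _)]
  by_cases h : D.vHat n y s = 0
  · simp [h]
  · simp [inv_mul_cancel₀ h]

/-- Critical values are bounded below. -/
lemma Setting.exists_le_crit (hs : Setting D c κ Cβ) {q0 : ℝ} (hq0 : 0 < q0) : ∃ C : ℝ, ∀ (n : ℕ)
    (y : Fin n → ℕ → ℝ) (A : Finset (D.Idx n)), A.Nonempty → ∀ q, q0 ≤ q → q < 1 →
      -C ≤ D.crit n y A q := by
  obtain ⟨M, hM0, hM⟩ : ∃ M : ℝ, 0 ≤ M ∧ 2 * Real.exp (-M ^ 2 / 2) < q0 := by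
    have ht : Tendsto (fun C : ℝ => 2 * Real.exp (-C ^ 2 / 2)) atTop (𝓝 (2 * 0)) := by
      refine Tendsto.const_mul _ (Real.tendsto_exp_atBot.comp ?_)
      have : Tendsto (fun C : ℝ => C ^ 2 / 2) atTop atTop :=
        (tendsto_pow_atTop (by norm_num)).atTop_div_const (by norm_num)
      refine (tendsto_neg_atTop_atBot.comp this).congr fun x => ?_
      simp only [Function.comp_apply]; ring
    rw [mul_zero] at ht
    obtain ⟨M, h1, h2⟩ := ((ht.eventually (gt_mem_nhds hq0)).and (eventually_ge_atTop 0)).exists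
    exact ⟨M, h2, h1⟩
  refine ⟨M + Cβ, fun n y A hA q hq hq1 => le_of_lt ?_⟩
  rw [hs.lt_crit_iff (hq0.trans_le hq) hq1, hs.bootVal_eq]
  -- A single index suffices: the maximum is at least one centered normal variable of variance at
  -- most one, which rarely falls below `-M`.
  obtain ⟨s, hsA⟩ := hA
  obtain ⟨v, hv1, hv⟩ := hs.map_bootDual n y s
  refine (hs.hg.integral_le_measureReal (measurable_max_dual _) (hs.hβ n) _).trans_lt
    (lt_of_le_of_lt ?_ (hM.trans_le hq))
  have key := measureReal_abs_ge_le_of_map_gaussianReal (μ := D.gauss n)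
    (X := fun e => D.bootDual n y s e) (D.bootDual n y s).continuous.measurable hv one_pos hv1 hM0
  rw [mul_one] at key
  refine (measureReal_mono fun e he => ?_).trans key
  rw [Set.mem_ofPred_eq] at he ⊢
  have h1 := le_maxOver (r := fun s => D.bootDual n y s e) hsA
  have h2 := hs.hβC n
  have h3 := neg_abs_le (D.bootDual n y s e)
  linarith

/-- Critical values are at most of logarithmic order. -/
lemma Setting.eventually_crit_le (hs : Setting D c κ Cβ) {q1 : ℝ} (hq1 : q1 < 1) :
    ∀ᶠ n : ℕ in atTop, ∀ (y : Fin n → ℕ → ℝ), ∀ A ⊆ D.S n, A.Nonempty → ∀ q, 0 < q → q ≤ q1 →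
      D.crit n y A q ≤ Real.log n ^ 2 := by
  obtain ⟨p, hp1, hcard⟩ := exists_card_S_le hs.hH hs.hKκ
  filter_upwards [hcard, (tendsto_union_bound hp1).eventually (gt_mem_nhds (sub_pos.2 hq1)),
    tendsto_log_natCast.eventually_ge_atTop (2 * p + 1)] with n hn hn3 hn5 y A hA hAne q hq hqq
  rw [hs.crit_le_iff hq (hqq.trans_lt hq1), hs.bootVal_eq]
  refine le_trans ?_ (hs.hg.measureReal_le_integral (measurable_max_dual _) (hs.hβ n) _)
  have hl : 2 * p * Real.log n < Real.log n ^ 2 := by nlinarith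
  have hl0 : 0 ≤ 2 * p * Real.log n := by
    have : 0 ≤ Real.log n := by linarith
    positivity
  have key := measureReal_exists_abs_ge_le (μ := D.gauss n) A
    (X := fun s => D.bootDual n y s) (fun s _ => (D.bootDual n y s).continuous.measurable)
    (σ := 1) one_pos (fun s _ => hs.map_bootDual n y s) hl0
  rw [mul_one] at key
  have hA' : (A.card : ℝ) ≤ Real.exp (p * Real.log n) :=
    le_trans (by exact_mod_cast Finset.card_le_card hA) hn
  have h2 : (A.card : ℝ) * (2 * Real.exp (-(2 * p * Real.log n) ^ 2 / 2)) ≤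
      Real.exp (p * Real.log n) * (2 * Real.exp (-(2 * p * Real.log n) ^ 2 / 2)) := by gcongr
  have hm : MeasurableSet {e | maxOver A (fun s => D.bootDual n y s e) ≤ Real.log n ^ 2} :=
    measurableSet_le (measurable_max_dual _) measurable_const
  have h3 := measureReal_add_measureReal_compl (μ := D.gauss n) hm
  rw [probReal_univ] at h3
  have h4 : (D.gauss n).real {e | maxOver A (fun s => D.bootDual n y s e) ≤ Real.log n ^ 2}ᶜ ≤
      (D.gauss n).real {e | ∃ s ∈ A, 2 * p * Real.log n ≤ |D.bootDual n y s e|} := by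
    refine measureReal_mono fun e he => ?_
    rw [Set.mem_compl_iff, Set.mem_ofPred_eq, not_le, lt_maxOver_iff hAne] at he
    obtain ⟨s, hsA, h⟩ := he
    exact ⟨s, hsA, (hl.trans h).le.trans (le_abs_self _)⟩
  linarith

/-! ### Measurability of the test -/

lemma Setting.measurable_vHat (hs : Setting D c κ Cβ) (n : ℕ) (s : D.Idx n) :
    Measurable fun y => D.vHat n y s := by
  unfold vHat
  exact (Finset.measurable_sum _ fun j _ => (hs.hS.1 n j s.2.1 s.2.1).const_mul _).sqrt

lemma Setting.measurable_ratio (hs : Setting D c κ Cβ) (n : ℕ) (s : D.Idx n) :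
    Measurable fun y => D.fHat n y s / D.vHat n y s :=
  (measurable_fHat n s).div (hs.measurable_vHat n s)

/-- The integrand is jointly measurable in sample and normal vectors, because entries of square
roots of the estimators are measurable in the sample. -/
lemma Setting.measurable_bootVal (hs : Setting D c κ Cβ) (n : ℕ) (A : Finset (D.Idx n)) (t : ℝ) :
    Measurable fun y => D.bootVal n y A t := by
  have hboot : ∀ s : D.Idx n, Measurable fun p : (Fin n → ℕ → ℝ) ×
      (Fin n → EuclideanSpace ℝ (D.ineq n)) => D.bootDual n p.1 s p.2 := by
    intro s
    have e : ∀ (y : Fin n → ℕ → ℝ) (e : Fin n → EuclideanSpace ℝ (D.ineq n)), D.bootDual n y s e =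
        (D.vHat n y s)⁻¹ * ∑ j, D.weight n (D.bw s.2.2) s.1 j *
          ∑ k, CFC.sqrt (D.sigmaHat n y j) s.2.1 k * e j k := fun y e => by
      simp [bootDual, rootDual, rowDual, Matrix.mulVec, dotProduct]
    simp_rw [e]
    refine (((hs.measurable_vHat n s).comp measurable_fst).inv).mul
      (Finset.measurable_sum _ fun j _ => Measurable.const_mul (Finset.measurable_sum _ fun k _ => ?_) _)
    refine Measurable.mul ?_ ?_
    · exact (measurable_sqrt_apply (hs.hS.1 n j) (fun y => hs.hS.2 n y j) s.2.1 k).comp measurable_fst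
    · fun_prop
  have hmax : Measurable fun p : (Fin n → ℕ → ℝ) × (Fin n → EuclideanSpace ℝ (D.ineq n)) =>
      D.g0 ((maxOver A (fun s => D.bootDual n p.1 s p.2) - t) / D.β n) :=
    hs.hg.continuous.measurable.comp
      (((measurable_maxOver (X := fun s (p : (Fin n → ℕ → ℝ) ×
        (Fin n → EuclideanSpace ℝ (D.ineq n))) => D.bootDual n p.1 s p.2)
        fun s _ => hboot s).sub_const t).div_const _)
  simp_rw [hs.bootVal_eq]
  exact (hmax.stronglyMeasurable.integral_prod_right (ν := D.gauss n)).measurable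

lemma Setting.measurable_crit (hs : Setting D c κ Cβ) (n : ℕ) (A : Finset (D.Idx n)) {q : ℝ}
    (h0 : 0 < q) (h1 : q < 1) : Measurable fun y => D.crit n y A q := by
  refine measurable_of_Iic fun t => ?_
  have : (fun y => D.crit n y A q) ⁻¹' Set.Iic t = {y | q ≤ D.bootVal n y A t} := by
    ext y
    exact hs.crit_le_iff h0 h1 t
  rw [this]
  exact measurableSet_le measurable_const (hs.measurable_bootVal n A t)

lemma Setting.measurable_tHat (hs : Setting D c κ Cβ) (n : ℕ) : Measurable fun y => D.tHat n y :=
  measurable_maxOver fun s _ => hs.measurable_ratio n s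

/-- The selected set takes countably many values, and for each fixed value the critical value is
measurable. -/
lemma Setting.measurable_accept (hs : Setting D c κ Cβ) {α : ℝ} (hα0 : 0 < α) (hα1 : α < 1) (n : ℕ)
    (hγ0 : 0 < D.γ n) (hγ1 : D.γ n < α / 2) (P : Method) : Measurable fun y => D.accept α n y P := by
  classical
  have hstep : ∀ (A : Finset (D.Idx n)) {q : ℝ}, 0 < q → q < 1 →
      Measurable fun y => D.g0 ((D.tHat n y - D.crit n y A q) / D.β n) := fun A q h0 h1 =>
    hs.hg.continuous.measurable.comp
      (((hs.measurable_tHat n).sub (hs.measurable_crit n A h0 h1)).div_const _)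
  cases P with
  | PIA => exact hstep (D.S n) (by linarith) (by linarith)
  | RMS =>
    let _ : MeasurableSpace (Finset (D.Idx n)) := ⊤
    have hsel : Measurable fun y => D.SRMS n y := by
      refine measurable_to_countable' fun A => ?_
      have : (fun y => D.SRMS n y) ⁻¹' {A} = ⋂ s : D.Idx n, {y | s ∈ D.SRMS n y ↔ s ∈ A} := by
        ext y
        simp [Finset.ext_iff]
      rw [this]
      refine MeasurableSet.iInter fun s => ?_
      have hmem : MeasurableSet {y | s ∈ D.SRMS n y} := by
        by_cases hsS : s ∈ D.S n
        · have : {y | s ∈ D.SRMS n y} = {y | -2 * (D.critPIA n y (1 - D.γ n) + D.β n) <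
              D.fHat n y s / D.vHat n y s} := by
            ext y
            simp [SRMS, hsS]
          rw [this]
          exact measurableSet_lt (((hs.measurable_crit n (D.S n) (by linarith)
            (by linarith)).add_const _).const_mul _) (hs.measurable_ratio n s)
        · have : {y | s ∈ D.SRMS n y} = ∅ := by
            ext y
            simp [SRMS, hsS]
          rw [this]
          exact MeasurableSet.empty
      by_cases hsA : s ∈ A
      · simpa [hsA] using hmem
      · have : {y | s ∈ D.SRMS n y ↔ s ∈ A} = {y | s ∈ D.SRMS n y}ᶜ := by
          ext y
          simp [hsA]
        rw [this]
        exact hmem.compl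
    have hF : Measurable fun p : Finset (D.Idx n) × (Fin n → ℕ → ℝ) =>
        if p.1.Nonempty then
          D.g0 ((D.tHat n p.2 - D.crit n p.2 p.1 (1 - α + 2 * D.γ n)) / D.β n) else 1 := by
      refine measurable_from_prod_countable_right fun A => ?_
      by_cases hA : A.Nonempty
      · simp only [hA, if_true]
        exact hstep A (by linarith) (by linarith)
      · simp only [hA, if_false]
        exact measurable_const
    have := hF.comp (hsel.prodMk measurable_id)
    convert this using 1
    funext y
    by_cases h : (D.SRMS n y).Nonempty <;> simp [accept, h]

end Design
end CMI


namespace CMI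

/-- Comparison of expectations of functions with values in `[0, 1]` off an exceptional set. -/
lemma integral_le_add_measureReal {Ω : Type*} [MeasurableSpace Ω] {P : Measure Ω}
    [IsProbabilityMeasure P] {f g : Ω → ℝ} (hf : Measurable f) (hg : Measurable g)
    (hf1 : ∀ ω, 0 ≤ f ω ∧ f ω ≤ 1) (hg1 : ∀ ω, 0 ≤ g ω ∧ g ω ≤ 1) {B : Set Ω}
    (h : ∀ ω, ω ∉ B → f ω ≤ g ω) : ∫ ω, f ω ∂P ≤ ∫ ω, g ω ∂P + P.real B := by
  -- The exceptional set need not be measurable; its measurable hull has the same measure.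
  have hBm := measurableSet_toMeasurable P B
  have hfi : Integrable f P := Integrable.of_bound hf.aestronglyMeasurable 1 (ae_of_all _ fun ω => by
    rw [Real.norm_eq_abs, abs_of_nonneg (hf1 ω).1]; exact (hf1 ω).2)
  have hgi : Integrable g P := Integrable.of_bound hg.aestronglyMeasurable 1 (ae_of_all _ fun ω => by
    rw [Real.norm_eq_abs, abs_of_nonneg (hg1 ω).1]; exact (hg1 ω).2)
  have hind : Integrable ((toMeasurable P B).indicator (1 : Ω → ℝ)) P :=
    (integrable_const (1 : ℝ)).indicator hBm
  have h1 : ∫ ω, f ω ∂P ≤ ∫ ω, (g ω + (toMeasurable P B).indicator (1 : Ω → ℝ) ω) ∂P := by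
    refine integral_mono hfi (hgi.add hind) fun ω => ?_
    by_cases hω : ω ∈ toMeasurable P B
    · simp only [Set.indicator_of_mem hω, Pi.one_apply]
      linarith [(hf1 ω).2, (hg1 ω).1]
    · simp only [Set.indicator_of_notMem hω, add_zero]
      exact h ω fun hB => hω (subset_toMeasurable P B hB)
  rw [integral_add hgi hind, integral_indicator_one hBm] at h1
  rwa [measureReal_def, measure_toMeasurable, ← measureReal_def] at h1

namespace Design

variable {d : ℕ} {D : Design d} {c : ClassConst} {w : Model d} {κ Cβ : ℝ}

/-! ### Consistency of the estimated covariance matrices -/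

lemma abs_apply_self_le_norm {n : ℕ} (M : Matrix (D.ineq n) (D.ineq n) ℝ) (m : D.ineq n) :
    |M m m| ≤ ‖Matrix.toEuclideanCLM (𝕜 := ℝ) M‖ := by
  have h1 := PiLp.norm_apply_le
    (Matrix.toEuclideanCLM (𝕜 := ℝ) M (EuclideanSpace.single m (1 : ℝ))) m
  have h2 := (Matrix.toEuclideanCLM (𝕜 := ℝ) M).le_opNorm (EuclideanSpace.single m (1 : ℝ))
  have h3 : Matrix.toEuclideanCLM (𝕜 := ℝ) M (EuclideanSpace.single m (1 : ℝ)) m = M m m := by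
    simp
  rw [h3, Real.norm_eq_abs] at h1
  simpa using h1.trans h2

lemma variance_dual_add_le {E : Type*} [NormedAddCommGroup E] [NormedSpace ℝ E]
    [MeasurableSpace E] [BorelSpace E] [SecondCountableTopology E] [CompleteSpace E]
    {P : Measure E} [IsGaussian P] (L L' : StrongDual ℝ E) :
    Var[(L + L' : StrongDual ℝ E); P] ≤ 2 * Var[L; P] + 2 * Var[L'; P] := by
  have hL : ∀ L : StrongDual ℝ E, MemLp L 2 P := fun L => IsGaussian.memLp_dual _ _ _ (by simp)
  have h1 : Var[(L + L' : StrongDual ℝ E); P] = Var[L; P] + 2 * cov[L, L'; P] + Var[L'; P] :=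
    variance_add (hL L) (hL L')
  have h2 := variance_sub (hL L) (hL L')
  have h3 := variance_nonneg (⇑L - ⇑L') P
  linarith

/-- For `r = x / y` one has `|r² - 1| = |r - 1| (r + 1) ≥ |r - 1|`; then `r ≥ 1/2` controls the
reciprocal. -/
lemma abs_div_sub_one_le {x y ε : ℝ} (hx : 0 ≤ x) (hy : 0 < y) (h : |x ^ 2 - y ^ 2| ≤ ε * y ^ 2)
    (hε : ε ≤ 1 / 2) : 0 < x ∧ |x / y - 1| ≤ ε ∧ |y / x - 1| ≤ 2 * ε := by
  set r := x / y with hr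
  have hxr : x = r * y := by rw [hr]; field_simp
  have hr0 : 0 ≤ r := div_nonneg hx hy.le
  have h1 : |r ^ 2 - 1| ≤ ε := by
    have : x ^ 2 - y ^ 2 = (r ^ 2 - 1) * y ^ 2 := by rw [hxr]; ring
    rw [this, abs_mul, abs_of_pos (by positivity : 0 < y ^ 2)] at h
    exact le_of_mul_le_mul_right h (by positivity)
  have h2 : |r - 1| ≤ ε := by
    have : r ^ 2 - 1 = (r - 1) * (r + 1) := by ring
    rw [this, abs_mul, abs_of_pos (by linarith : 0 < r + 1)] at h1
    have := abs_nonneg (r - 1)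
    nlinarith
  have h3 := neg_abs_le (r - 1)
  have hr1 : 1 / 2 ≤ r := by linarith
  have hx0 : 0 < x := by rw [hxr]; exact mul_pos (by linarith) hy
  refine ⟨hx0, h2, ?_⟩
  have h4 : y / x - 1 = (1 - r) / r := by
    rw [hxr]
    have : r ≠ 0 := by linarith
    field_simp
  rw [h4, abs_div, abs_of_nonneg hr0, div_le_iff₀ (by linarith), abs_sub_comm]
  have := abs_nonneg (r - 1)
  nlinarith

/-- On the event that the estimated covariance matrices are accurate, the simulated statistics
imitate the Gaussian analogue. -/
lemma Setting.eventually_bootVal_close (hs : Setting D c κ Cβ) {η : ℝ} (hη : 0 < η) :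
    ∀ᶠ n : ℕ in atTop, ∀ w ∈ modelClass c D.X, ∀ y : Fin n → ℕ → ℝ,
      (∀ i, ‖Matrix.toEuclideanCLM (𝕜 := ℝ) (D.sigmaHat n y i - D.sigma w n i)‖ ≤ (n : ℝ) ^ (-κ)) →
      (∀ A ⊆ D.S n, A.Nonempty → ∀ t, |D.bootVal n y A t - D.gaussVal w n A t| ≤ η) ∧
      ∀ s ∈ D.S n, 0 < D.vHat n y s ∧ D.vHat n y s ≤ 2 * D.sdev w n s ∧
        |D.sdev w n s / D.vHat n y s - 1| * Real.log n ^ 2 ≤ slack κ n := by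
  have hCv : 0 < c.Cvar := hs.hc.2.2.2.1
  obtain ⟨p, hp1, hcard⟩ := exists_card_S_le hs.hH hs.hKκ
  obtain ⟨Cs, -, hsd⟩ := exists_sdevBounds hs.hc hs.hX hs.hH hs.hK
  have l1 : Tendsto (fun n : ℕ => (n : ℝ) ^ (-κ) * Real.log n ^ 0) atTop (𝓝 0) :=
    tendsto_rpow_mul_log_pow hs.hκ 0
  have l2 : Tendsto (fun n : ℕ => (n : ℝ) ^ (-(κ / 2)) * Real.log n ^ 1) atTop (𝓝 0) :=
    tendsto_rpow_mul_log_pow (half_pos hs.hκ) 1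
  have l3 : Tendsto (fun n : ℕ => (n : ℝ) ^ (-(3 * κ / 4)) * Real.log n ^ 2) atTop (𝓝 0) :=
    tendsto_rpow_mul_log_pow (by have := hs.hκ; positivity) 2
  have l4 : Tendsto (fun n : ℕ => 2 * Real.exp (-Real.log n)) atTop (𝓝 (2 * 0)) :=
    (Real.tendsto_exp_atBot.comp (tendsto_neg_atTop_atBot.comp tendsto_log_natCast)).const_mul 2
  rw [mul_zero] at l4
  filter_upwards [hcard, hsd, l1.eventually (gt_mem_nhds (show 0 < c.Cvar / 2 by positivity)),
    l2.eventually (gt_mem_nhds (show 0 < c.Cvar / (16 * p) by positivity)),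
    l3.eventually (gt_mem_nhds (show 0 < c.Cvar / 2 by positivity)),
    l4.eventually (gt_mem_nhds (half_pos hη)), hs.eventually_gaussVal_add_le (half_pos hη),
    tendsto_log_natCast.eventually_ge_atTop 1, eventually_gt_atTop 0]
    with n hcn hsdn e1 e2 e3 e4 hadd hlog hn w hw y hy
  have hn0 : (0 : ℝ) < n := by exact_mod_cast hn
  have hpsd := hw.1.posSemidef_sigma hs.hc D n
  set δ : ℝ := (n : ℝ) ^ (-κ) with hδ
  have hδ0 : 0 < δ := Real.rpow_pos_of_pos hn0 _
  set ε : ℝ := δ / c.Cvar with hε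
  have hε0 : 0 < ε := by positivity
  have hεh : ε ≤ 1 / 2 := by
    rw [hε, div_le_iff₀ hCv]
    rw [pow_zero, mul_one] at e1
    linarith
  have hslack : slack κ n ^ 2 = (n : ℝ) ^ (-(κ / 2)) := by
    rw [slack, ← Real.rpow_natCast, ← Real.rpow_mul hn0.le]
    congr 1
    push_cast
    ring
  have hratio : ∀ s ∈ D.S n, 0 < D.vHat n y s ∧ |D.vHat n y s / D.sdev w n s - 1| ≤ ε ∧
      |D.sdev w n s / D.vHat n y s - 1| ≤ 2 * ε := fun s hsS => by
    obtain ⟨b1, -, b3, -⟩ := hsdn w hw s hsS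
    refine abs_div_sub_one_le (Real.sqrt_nonneg _) b1 ?_ hεh
    have hsq : D.sdev w n s ^ 2 =
        ∑ j : Fin n, D.weight n (D.bw s.2.2) s.1 j ^ 2 * w.cov j s.2.1 s.2.1 :=
      Real.sq_sqrt (Real.sqrt_pos.1 b1).le
    rw [hs.vHat_sq, hsq, ← Finset.sum_sub_distrib, ← hsq]
    calc |∑ j, (D.weight n (D.bw s.2.2) s.1 j ^ 2 * D.sigmaHat n y j s.2.1 s.2.1 -
          D.weight n (D.bw s.2.2) s.1 j ^ 2 * w.cov j s.2.1 s.2.1)|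
        ≤ ∑ j, D.weight n (D.bw s.2.2) s.1 j ^ 2 * δ := by
          refine (Finset.abs_sum_le_sum_abs _ _).trans (Finset.sum_le_sum fun j _ => ?_)
          rw [← mul_sub, abs_mul, abs_of_nonneg (sq_nonneg _)]
          refine mul_le_mul_of_nonneg_left ?_ (sq_nonneg _)
          exact (abs_apply_self_le_norm (D.sigmaHat n y j - D.sigma w n j) s.2.1).trans (hy j)
      _ = ε * (c.Cvar * ∑ j, D.weight n (D.bw s.2.2) s.1 j ^ 2) := by
          rw [← Finset.sum_mul, hε]; field_simp
      _ ≤ _ := by gcongr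
  refine ⟨?_, fun s hsS => ?_⟩
  -- Off this set the two families differ by at most `slack` at every index, hence so do their
  -- maxima over any subset.
  · set bad : Set (Fin n → EuclideanSpace ℝ (D.ineq n)) :=
      {e | ∃ s ∈ D.S n, slack κ n ≤ |(D.bootDual n y s - D.zDual w n s : StrongDual ℝ _) e|} with hbad
    have hvar : ∀ s ∈ D.S n,
        Var[(D.bootDual n y s - D.zDual w n s : StrongDual ℝ _); D.gauss n] ≤ 4 * ε := fun s hsS => by
      obtain ⟨b1, -, b3, -⟩ := hsdn w hw s hsS
      obtain ⟨v1, v2, -⟩ := hratio s hsS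
      set x : ℝ := D.vHat n y s / D.sdev w n s with hx
      -- The first part is the error of normalization, the second that of the matrix square roots.
      -- Each has variance at most `ε`, and a sum has at most twice the total variance.
      have hdec : (D.bootDual n y s - D.zDual w n s : StrongDual ℝ _) = (1 - x) • D.bootDual n y s +
          (D.sdev w n s)⁻¹ • (D.rootDual n (D.sigmaHat n y) s - D.rootDual n (D.sigma w n) s) := by
        ext e
        simp only [bootDual, zDual, sub_apply, add_apply, smul_apply, smul_eq_mul, hx]
        field_simp
        ring
      rw [hdec]
      refine (variance_dual_add_le _ _).trans ?_
      rw [variance_smul_dual, variance_smul_dual]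
      obtain ⟨v, hv, hlaw⟩ := hs.map_bootDual n y s
      have h1 : Var[D.bootDual n y s; D.gauss n] ≤ 1 := by
        have := variance_of_map_gaussianReal (D.bootDual n y s).continuous.measurable hlaw
        rwa [this]
      have h2 := variance_rootDual_sub_le (hs.hS.2 n y) hpsd hy s
      have h3 : (1 - x) ^ 2 ≤ ε := by
        rw [← sq_abs, abs_sub_comm]
        have := abs_nonneg (x - 1)
        nlinarith
      have h4 : (D.sdev w n s)⁻¹ ^ 2 * (δ * ∑ j, D.weight n (D.bw s.2.2) s.1 j ^ 2) ≤ ε := by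
        rw [inv_pow, inv_mul_le_iff₀ (by positivity)]
        calc δ * ∑ j, D.weight n (D.bw s.2.2) s.1 j ^ 2
            = (c.Cvar * ∑ j, D.weight n (D.bw s.2.2) s.1 j ^ 2) * ε := by rw [hε]; field_simp
          _ ≤ _ := by gcongr
      have h5 : (1 - x) ^ 2 * Var[D.bootDual n y s; D.gauss n] ≤ ε * 1 :=
        mul_le_mul h3 h1 (variance_nonneg _ _) hε0.le
      have h6 := mul_le_mul_of_nonneg_left h2 (sq_nonneg (D.sdev w n s)⁻¹)
      linarith
    have hbadP : (D.gauss n).real bad ≤ η / 2 := by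
      have key := measureReal_exists_abs_ge_le (μ := D.gauss n) (D.S n)
        (X := fun s => (D.bootDual n y s - D.zDual w n s : StrongDual ℝ _))
        (fun s _ => ContinuousLinearMap.measurable _) (σ := 4 * ε) (by positivity)
        (fun s hsS => ⟨_, by
          rw [Real.coe_toNNReal _ (variance_nonneg _ _)]
          exact hvar s hsS, map_strongDual_eq_gaussianReal (integral_id_gauss n) _ rfl⟩)
        (slack_nonneg (κ := κ) n)
      refine key.trans (le_trans ?_ e4.le)
      -- The variance is of order `n ^ (-κ)` and `slack² = n ^ (-κ / 2)`, so the Gaussian exponent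
      -- grows like `n ^ (κ / 2)` and dominates the logarithm of the number of indices.
      have h1 : 2 * p * Real.log n ≤ slack κ n ^ 2 / (2 * (4 * ε)) := by
        have h2 : slack κ n ^ 2 * slack κ n ^ 2 = δ := by
          rw [hslack, ← Real.rpow_add hn0, hδ]
          congr 1
          ring
        have h3 : 0 < slack κ n ^ 2 := by rw [hslack]; positivity
        rw [le_div_iff₀ (by positivity)]
        rw [pow_one, lt_div_iff₀ (by positivity), ← hslack] at e2
        have h4 : 2 * p * Real.log n * (2 * (4 * ε)) * c.Cvar =
            slack κ n ^ 2 * (slack κ n ^ 2 * Real.log n * (16 * p)) := by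
          rw [hε]
          calc _ = 16 * p * Real.log n * δ := by field_simp; ring
            _ = _ := by rw [← h2]; ring
        refine le_of_mul_le_mul_right (a := c.Cvar) ?_ hCv
        rw [h4]
        exact mul_le_mul_of_nonneg_left e2.le h3.le
      calc ((D.S n).card : ℝ) * (2 * Real.exp (-slack κ n ^ 2 / (2 * (4 * ε))))
          ≤ Real.exp (p * Real.log n) * (2 * Real.exp (-(2 * p * Real.log n))) := by
            rw [neg_div]
            gcongr
        _ = 2 * Real.exp (-(p * Real.log n)) := by
            rw [mul_left_comm, ← Real.exp_add]; congr 2; ring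
        _ ≤ _ := by gcongr; nlinarith
    have hβ := hs.hβ n
    have hcl : ∀ A ⊆ D.S n, A.Nonempty → ∀ e, e ∉ bad →
        maxOver A (fun s => D.bootDual n y s e) ≤ maxOver A (fun s => D.zDual w n s e) + slack κ n ∧
        maxOver A (fun s => D.zDual w n s e) ≤ maxOver A (fun s => D.bootDual n y s e) + slack κ n := by
      intro A hA hAne e he
      have h1 : ∀ s ∈ A, |D.bootDual n y s e - D.zDual w n s e| ≤ slack κ n := fun s hsA => by
        by_contra hcon
        exact he ⟨s, hA hsA, (not_le.1 hcon).le⟩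
      exact ⟨maxOver_le_add hAne fun s hsA => by linarith [(abs_le.1 (h1 s hsA)).2],
        maxOver_le_add hAne fun s hsA => by linarith [(abs_le.1 (h1 s hsA)).1]⟩
    have hm : ∀ (A : Finset (D.Idx n))
        (Z : D.Idx n → StrongDual ℝ (Fin n → EuclideanSpace ℝ (D.ineq n))) (t : ℝ),
        Measurable fun e => D.g0 ((maxOver A (fun s => Z s e) - t) / D.β n) := fun A Z t =>
      hs.hg.continuous.measurable.comp (((measurable_max_dual _).sub_const _).div_const _)
    have h01 : ∀ x, 0 ≤ D.g0 x ∧ D.g0 x ≤ 1 := fun x => ⟨hs.hg.nonneg x, hs.hg.le_one x⟩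
    intro A hA hAne t
    rw [abs_sub_le_iff, hs.bootVal_eq]
    constructor
    · have h1 := integral_le_add_measureReal (P := D.gauss n) (hm A (D.bootDual n y) t)
        (hm A (D.zDual w n) (t + slack κ n)) (fun _ => h01 _) (fun _ => h01 _) (B := bad)
        fun e he => hs.hg.antitone (div_le_div_of_nonneg_right
          (by linarith [(hcl A hA hAne e he).2]) hβ.le)
      have h2 := hadd w hw A hA hAne t
      simp only [gaussVal] at h2 ⊢
      linarith
    · have h1 := integral_le_add_measureReal (P := D.gauss n) (hm A (D.zDual w n) (t - slack κ n))
        (hm A (D.bootDual n y) t) (fun _ => h01 _) (fun _ => h01 _) (B := bad)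
        fun e he => hs.hg.antitone (div_le_div_of_nonneg_right
          (by linarith [(hcl A hA hAne e he).1]) hβ.le)
      have h2 := hadd w hw A hA hAne (t - slack κ n)
      rw [sub_add_cancel] at h2
      simp only [gaussVal] at h2 ⊢
      linarith
  · obtain ⟨b1, -, b3, -⟩ := hsdn w hw s hsS
    obtain ⟨v1, v2, v3⟩ := hratio s hsS
    refine ⟨v1, ?_, ?_⟩
    · have h1 := (abs_le.1 v2).2
      have h2 : D.vHat n y s / D.sdev w n s ≤ 2 := by linarith
      rwa [div_le_iff₀ b1] at h2
    · have h1 : 2 * ε * Real.log n ^ 2 ≤ slack κ n := by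
        have h2 : (n : ℝ) ^ (-(3 * κ / 4)) * slack κ n = δ := by
          rw [slack, ← Real.rpow_add hn0, hδ]
          congr 1
          ring
        have h3 : 2 * ε * Real.log n ^ 2 =
            2 / c.Cvar * ((n : ℝ) ^ (-(3 * κ / 4)) * Real.log n ^ 2) * slack κ n := by
          rw [hε, ← h2]; ring
        rw [h3]
        have h4 : 2 / c.Cvar * ((n : ℝ) ^ (-(3 * κ / 4)) * Real.log n ^ 2) ≤ 1 := by
          rw [div_mul_eq_mul_div, div_le_one hCv]
          linarith
        calc _ ≤ 1 * slack κ n := mul_le_mul_of_nonneg_right h4 (slack_nonneg n)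
          _ = _ := one_mul _
      exact (mul_le_mul_of_nonneg_right v3 (sq_nonneg _)).trans h1

end Design
end CMI


namespace CMI
namespace Design

variable {d : ℕ} {D : Design d} {c : ClassConst} {w : Model d} {κ Cβ : ℝ}

/-! ### Good samples -/

/-- The joint law of the disturbances. -/
noncomputable abbrev errLaw (w : Model d) (n : ℕ) : Measure (Fin n → ℕ → ℝ) :=
  Measure.pi fun j : Fin n => w.law j

/-- The responses that result from the disturbances `e`. -/
def resp (D : Design d) (w : Model d) (n : ℕ) (e : Fin n → ℕ → ℝ) : Fin n → ℕ → ℝ :=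
  fun i m => w.f m (D.X i) + e i m

/-- The smoothed regression functions. -/
noncomputable def signal (D : Design d) (w : Model d) (n : ℕ) (s : D.Idx n) : ℝ :=
  D.fHat n (fun i m => w.f m (D.X i)) s

lemma measurable_resp (w : Model d) (n : ℕ) : Measurable (D.resp w n) := by
  refine measurable_pi_lambda _ fun i => measurable_pi_lambda _ fun m => Measurable.const_add ?_ _
  exact (measurable_pi_apply (X := fun _ : ℕ => ℝ) m).comp (measurable_pi_apply i)

lemma fHat_resp (w : Model d) (n : ℕ) (e : Fin n → ℕ → ℝ) (s : D.Idx n) :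
    D.fHat n (D.resp w n e) s = D.signal w n s + D.fHat n e s := by
  simp only [fHat, signal, smooth, resp, ← Finset.sum_add_distrib, mul_add]

/-- Samples for which the estimated variances are accurate and the disturbances are moderate. -/
structure Good (D : Design d) (w : Model d) (κ η : ℝ) (n : ℕ) (e : Fin n → ℕ → ℝ) : Prop where
  boot : ∀ A ⊆ D.S n, A.Nonempty → ∀ t,
    |D.bootVal n (D.resp w n e) A t - D.gaussVal w n A t| ≤ η
  vHat_pos : ∀ s ∈ D.S n, 0 < D.vHat n (D.resp w n e) s
  vHat_le : ∀ s ∈ D.S n, D.vHat n (D.resp w n e) s ≤ 2 * D.sdev w n s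
  ratio : ∀ s ∈ D.S n,
    |D.sdev w n s / D.vHat n (D.resp w n e) s - 1| * Real.log n ^ 2 ≤ slack κ n
  noise_le : ∀ s ∈ D.S n, |D.noise w n e s| ≤ Real.log n ^ 2

lemma Good.sdev_pos {η : ℝ} {n : ℕ} {e : Fin n → ℕ → ℝ} (h : Good D w κ η n e) {s : D.Idx n}
    (hsS : s ∈ D.S n) : 0 < D.sdev w n s := by
  linarith [h.vHat_pos s hsS, h.vHat_le s hsS]

lemma Good.ratio_eq {η : ℝ} {n : ℕ} {e : Fin n → ℕ → ℝ} (h : Good D w κ η n e) {s : D.Idx n}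
    (hsS : s ∈ D.S n) : D.fHat n (D.resp w n e) s / D.vHat n (D.resp w n e) s =
      (D.signal w n s / D.sdev w n s + D.noise w n e s) *
        (D.sdev w n s / D.vHat n (D.resp w n e) s) := by
  have h1 := h.sdev_pos hsS
  have h2 := h.vHat_pos s hsS
  rw [fHat_resp, noise]
  field_simp

/-- Replacing true by estimated standard deviations is harmless for quantities up to `log² n`; the
field `ratio` carries the factor `log² n` for this reason. -/
lemma Good.abs_noise_sub_le {η : ℝ} {n : ℕ} {e : Fin n → ℕ → ℝ} (h : Good D w κ η n e) {s : D.Idx n}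
    (hsS : s ∈ D.S n) {x : ℝ} (hx : |x| ≤ Real.log n ^ 2) :
    |x * (D.sdev w n s / D.vHat n (D.resp w n e) s) - x| ≤ slack κ n := by
  rw [← mul_sub_one, abs_mul, mul_comm]
  exact (mul_le_mul_of_nonneg_left hx (abs_nonneg _)).trans (h.ratio s hsS)

/-- Under the null hypothesis the normalized estimators are at most the normalized disturbances. -/
lemma Good.ratio_le {η : ℝ} {n : ℕ} {e : Fin n → ℕ → ℝ} (h : Good D w κ η n e) {s : D.Idx n}
    (hsS : s ∈ D.S n) (h0 : D.signal w n s ≤ 0) :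
    D.fHat n (D.resp w n e) s / D.vHat n (D.resp w n e) s ≤ D.noise w n e s + slack κ n := by
  have h1 := h.sdev_pos hsS
  have h2 := h.vHat_pos s hsS
  rw [h.ratio_eq hsS, add_mul]
  have h3 : D.signal w n s / D.sdev w n s * (D.sdev w n s / D.vHat n (D.resp w n e) s) ≤ 0 :=
    mul_nonpos_of_nonpos_of_nonneg (div_nonpos_of_nonpos_of_nonneg h0 h1.le) (by positivity)
  have h4 := (abs_le.1 (h.abs_noise_sub_le hsS (h.noise_le s hsS))).2
  linarith

lemma Setting.eventually_noise (hs : Setting D c κ Cβ) {η : ℝ} (hη : 0 < η) :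
    ∀ᶠ n : ℕ in atTop, ∀ w ∈ modelClass c D.X, ∀ A ⊆ D.S n, A.Nonempty → ∀ t σ : ℝ, |σ| = 1 →
      (errLaw w n).real {e | maxOver A (fun s => σ * D.noise w n e s) ≤ t} ≤
        D.gaussVal w n A t + η ∧
      D.gaussVal w n A t - η ≤
        (errLaw w n).real {e | maxOver A (fun s => σ * D.noise w n e s) < t + D.β n} := by
  filter_upwards [eventually_abs_integral_noise_sub_le hs.hc hs.hX hs.hH hs.hK hs.hg hs.hKκ hs.hβ
    hs.hβC hs.hrate hη] with n hn w hw A hA hAne t σ hσ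
  have hm : Measurable fun e => maxOver A (fun s => σ * D.noise w n e s) :=
    measurable_maxOver fun s _ => (measurable_noise n s).const_mul σ
  have h1 := abs_le.1 (hn w hw A hA hAne t σ hσ)
  have h2 := hs.hg.measureReal_le_integral (P := errLaw w n) hm (hs.hβ n) t
  have h3 := hs.hg.integral_le_measureReal (P := errLaw w n) hm (hs.hβ n) t
  exact ⟨by linarith [h1.2], by linarith [h1.1]⟩

lemma eventually_S_nonempty (hs : Setting D c κ Cβ) : ∀ᶠ n : ℕ in atTop, (D.S n).Nonempty := by
  filter_upwards [hs.hcover 0, eventually_gt_atTop 0] with n h1 h2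
  exact S_nonempty hs.hI h2 ⟨0, h1⟩

lemma Setting.eventually_gaussVal_ge (hs : Setting D c κ Cβ) {η : ℝ} (hη : 0 < η) (C : ℝ) :
    ∀ᶠ n : ℕ in atTop, ∀ w ∈ modelClass c D.X, ∀ A ⊆ D.S n, A.Nonempty →
      1 - η ≤ D.gaussVal w n A (Real.log n ^ 2 - C) := by
  filter_upwards [hs.eventually_prob_max_zDual_le hη C] with n hn w hw A hA hAne
  have hm : MeasurableSet {e | maxOver A (fun s => D.zDual w n s e) ≤ Real.log n ^ 2 - C} :=
    measurableSet_le (measurable_max_dual _) measurable_const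
  refine le_trans ?_ (hs.hg.measureReal_le_integral (measurable_max_dual _) (hs.hβ n) _)
  have h1 := measureReal_add_measureReal_compl (μ := D.gauss n) hm
  rw [probReal_univ] at h1
  have h2 : (D.gauss n).real {e | maxOver A (fun s => D.zDual w n s e) ≤ Real.log n ^ 2 - C}ᶜ ≤
      (D.gauss n).real {e | ∃ s ∈ D.S n, Real.log n ^ 2 - C ≤ |D.zDual w n s e|} := by
    refine measureReal_mono fun e he => ?_
    rw [Set.mem_compl_iff, Set.mem_ofPred_eq, not_le, lt_maxOver_iff hAne] at he
    obtain ⟨s, hsA, h⟩ := he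
    exact ⟨s, hA hsA, h.le.trans (le_abs_self _)⟩
  linarith [hn w hw]

/-- With probability tending to one the sample is good. -/
lemma Setting.eventually_good (hs : Setting D c κ Cβ) {𝒲 : Set (Model d)}
    (h𝒲 : 𝒲 ⊆ modelClass c D.X) (hV : D.VarianceRate 𝒲 κ) {η ζ : ℝ} (hη : 0 < η) (hζ : 0 < ζ) :
    ∀ᶠ n : ℕ in atTop, ∀ w ∈ 𝒲, (errLaw w n).real {e | ¬ Good D w κ η n e} ≤ ζ := by
  -- One share pays for the estimated covariances, two for each sign of the noise.
  have hζ5 : 0 < ζ / 5 := by positivity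
  have hV1 := (hV 1 one_pos).eventually (gt_mem_nhds (ENNReal.ofReal_pos.2 hζ5))
  filter_upwards [hV1, hs.eventually_bootVal_close hη, hs.eventually_noise hζ5,
    hs.eventually_gaussVal_ge hζ5 Cβ, eventually_S_nonempty hs] with n h1 h2 h3 h4 hne w hw
  have hwc := h𝒲 hw
  set E1 : Set (Fin n → ℕ → ℝ) := {e | ∃ i : Fin n, (n : ℝ) ^ (-κ) <
      ‖Matrix.toEuclideanCLM (𝕜 := ℝ) (D.sigmaHat n (D.resp w n e) i - D.sigma w n i)‖} with hE1
  have hE1P : (errLaw w n).real E1 ≤ ζ / 5 := by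
    rw [measureReal_def]
    refine ENNReal.toReal_le_of_le_ofReal hζ5.le (le_trans ?_ h1.le)
    refine le_trans ?_ (le_iSup₂ (f := fun w (_ : w ∈ 𝒲) => (w.sampleLaw D.X n)
      {y | ∃ i : Fin n, 1 * (n : ℝ) ^ (-κ) <
        ‖Matrix.toEuclideanCLM (𝕜 := ℝ) (D.sigmaHat n y i - D.sigma w n i)‖}) w hw)
    refine le_trans ?_ (Measure.le_map_apply (measurable_resp w n).aemeasurable _)
    refine measure_mono fun e he => ?_
    simpa [hE1] using he
  have htail : ∀ σ : ℝ, |σ| = 1 → (errLaw w n).real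
      {e | Real.log n ^ 2 ≤ maxOver (D.S n) (fun s => σ * D.noise w n e s)} ≤ 2 * (ζ / 5) := by
    intro σ hσ
    have hm : Measurable fun e => maxOver (D.S n) (fun s => σ * D.noise w n e s) :=
      measurable_maxOver fun s _ => (measurable_noise n s).const_mul σ
    have a1 := (h3 w hwc (D.S n) subset_rfl hne (Real.log n ^ 2 - Cβ) σ hσ).2
    have a2 := h4 w hwc (D.S n) subset_rfl hne
    have hset : MeasurableSet
        {e | maxOver (D.S n) (fun s => σ * D.noise w n e s) < Real.log n ^ 2 - Cβ + D.β n} :=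
      measurableSet_lt hm measurable_const
    have a3 := measureReal_add_measureReal_compl (μ := errLaw w n) hset
    rw [probReal_univ] at a3
    have a4 : (errLaw w n).real
        {e | Real.log n ^ 2 ≤ maxOver (D.S n) (fun s => σ * D.noise w n e s)} ≤
        (errLaw w n).real
        {e | maxOver (D.S n) (fun s => σ * D.noise w n e s) < Real.log n ^ 2 - Cβ + D.β n}ᶜ := by
      refine measureReal_mono fun e he => ?_
      rw [Set.mem_compl_iff, Set.mem_ofPred_eq, not_lt]
      rw [Set.mem_ofPred_eq] at he
      linarith [hs.hβC n]
    linarith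
  have hsub : {e | ¬ Good D w κ η n e} ⊆ E1 ∪
      ({e | Real.log n ^ 2 ≤ maxOver (D.S n) (fun s => 1 * D.noise w n e s)} ∪
      {e | Real.log n ^ 2 ≤ maxOver (D.S n) (fun s => (-1) * D.noise w n e s)}) := by
    intro e he
    by_contra hcon
    simp only [Set.mem_union, not_or] at hcon
    obtain ⟨c1, c2, c3⟩ := hcon
    refine he ?_
    have c1' : ∀ i, ‖Matrix.toEuclideanCLM (𝕜 := ℝ)
        (D.sigmaHat n (D.resp w n e) i - D.sigma w n i)‖ ≤ (n : ℝ) ^ (-κ) := fun i => by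
      by_contra hlt
      exact c1 ⟨i, not_le.1 hlt⟩
    rw [Set.mem_ofPred_eq, not_le] at c2 c3
    obtain ⟨b1, b2⟩ := h2 w hwc (D.resp w n e) c1'
    refine ⟨b1, fun s hsS => (b2 s hsS).1, fun s hsS => (b2 s hsS).2.1,
      fun s hsS => (b2 s hsS).2.2, fun s hsS => abs_le.2 ⟨?_, ?_⟩⟩
    · have := le_maxOver (r := fun s => (-1) * D.noise w n e s) hsS
      linarith
    · have := le_maxOver (r := fun s => 1 * D.noise w n e s) hsS
      linarith
  have u1 := measureReal_mono (μ := errLaw w n) hsub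
  have u2 := measureReal_union_le (μ := errLaw w n) E1
    ({e | Real.log n ^ 2 ≤ maxOver (D.S n) (fun s => 1 * D.noise w n e s)} ∪
      {e | Real.log n ^ 2 ≤ maxOver (D.S n) (fun s => (-1) * D.noise w n e s)})
  have u3 := measureReal_union_le (μ := errLaw w n)
    {e | Real.log n ^ 2 ≤ maxOver (D.S n) (fun s => 1 * D.noise w n e s)}
    {e | Real.log n ^ 2 ≤ maxOver (D.S n) (fun s => (-1) * D.noise w n e s)}
  have u4 := htail 1 (by simp)
  have u5 := htail (-1) (by simp)
  linarith

/-! ### Acceptance probabilities under the null hypothesis -/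

lemma Setting.accept_mem (hs : Setting D c κ Cβ) (α : ℝ) (n : ℕ) (y : Fin n → ℕ → ℝ) (P : Method) :
    0 ≤ D.accept α n y P ∧ D.accept α n y P ≤ 1 := by
  cases P with
  | PIA => exact ⟨hs.hg.nonneg _, hs.hg.le_one _⟩
  | RMS =>
    by_cases h : (D.SRMS n y).Nonempty
    · simp only [accept, h, if_true]
      exact ⟨hs.hg.nonneg _, hs.hg.le_one _⟩
    · simp [accept, h]

lemma Setting.acceptProb_eq (hs : Setting D c κ Cβ) {α : ℝ} (hα0 : 0 < α) (hα1 : α < 1) {n : ℕ}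
    (hγ0 : 0 < D.γ n) (hγ1 : D.γ n < α / 2) (P : Method) (w : Model d) :
    D.acceptProb α P n w = ∫ e, D.accept α n (D.resp w n e) P ∂(errLaw w n) := by
  rw [acceptProb, Model.sampleLaw]
  exact integral_map (measurable_resp w n).aemeasurable
    (hs.measurable_accept hα0 hα1 n hγ0 hγ1 P).aestronglyMeasurable

/-- Lower bound for the acceptance probability, when off an exceptional set the critical value
is based on a selection that contains the fixed set `A`, and the other indices do not matter. -/
lemma Setting.le_integral_accept (hs : Setting D c κ Cβ) {n : ℕ} {η q : ℝ} (hη : 0 < η)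
    (hq1 : q < 1) {A : Finset (D.Idx n)} (hA : A ⊆ D.S n)
    (hSne : (D.S n).Nonempty) (hnull : ∀ s ∈ D.S n, D.signal w n s ≤ 0)
    (hclt : A.Nonempty → ∀ t, D.gaussVal w n A t - η ≤
      ∫ e, D.g0 ((maxOver A (fun s => D.noise w n e s) - t) / D.β n) ∂(errLaw w n))
    (hadd : A.Nonempty → ∀ t, D.gaussVal w n A (t + slack κ n) ≤ D.gaussVal w n A t + η)
    {a : (Fin n → ℕ → ℝ) → ℝ} (ha : Measurable a) (ha01 : ∀ e, 0 ≤ a e ∧ a e ≤ 1)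
    {sel : (Fin n → ℕ → ℝ) → Finset (D.Idx n)}
    (ha1 : ∀ e, ¬ (sel e).Nonempty → a e = 1)
    (ha2 : ∀ e, (sel e).Nonempty → a e = D.g0 ((D.tHat n (D.resp w n e) -
      D.crit n (D.resp w n e) (sel e) q) / D.β n))
    {B : Set (Fin n → ℕ → ℝ)}
    (hB : ∀ e, e ∉ B → Good D w κ η n e ∧ ((sel e).Nonempty → A ⊆ sel e ∧ ∀ s ∈ D.S n, s ∉ A →
      D.fHat n (D.resp w n e) s / D.vHat n (D.resp w n e) s ≤
        D.crit n (D.resp w n e) (sel e) q)) :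
    q - 4 * η - (errLaw w n).real B ≤ ∫ e, a e ∂(errLaw w n) := by
  have hβ := hs.hβ n
  have hPB : 0 ≤ (errLaw w n).real B := measureReal_nonneg
  have h1 : ∀ {x : ℝ}, x ≤ 0 → D.g0 (x / D.β n) = 1 := fun hx =>
    hs.hg.2.2.1 _ (div_nonpos_of_nonpos_of_nonneg hx hβ.le)
  rcases A.eq_empty_or_nonempty with rfl | hAne
  -- With `A` empty every index is at most the critical value, so the test accepts outright.
  · have hone : ∀ e, e ∉ B → (1 : ℝ) ≤ a e := fun e he => by
      by_cases hsel : (sel e).Nonempty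
      · rw [ha2 e hsel, h1]
        have := ((hB e he).2 hsel).2
        rw [sub_nonpos]
        exact maxOver_le hSne fun s hsS => this s hsS (Finset.notMem_empty s)
      · exact (ha1 e hsel).ge
    have := integral_le_add_measureReal (P := errLaw w n) (f := fun _ => (1 : ℝ)) measurable_const ha
      (fun _ => ⟨zero_le_one, le_rfl⟩) ha01 hone
    simp only [integral_const, probReal_univ, one_smul] at this
    linarith
  · rcases le_or_gt (q - 2 * η) 0 with hq | hq
    · have : 0 ≤ ∫ e, a e ∂(errLaw w n) := integral_nonneg fun e => (ha01 e).1
      linarith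
    -- Of the margin `2 η` one half pays for the simulation error, the other keeps the inequality
    -- strict, so that `t0` lies below the critical value of `A`, hence below that of the selected
    -- set.
    have hspec := (hs.isContCdf_gaussVal w n A).sInf_spec hq (by linarith)
    set t0 := sInf {t | D.gaussVal w n A t = q - 2 * η} with ht0
    have hm : Measurable fun e => D.g0 ((maxOver A (fun s => D.noise w n e s) -
        (t0 - slack κ n)) / D.β n) :=
      hs.hg.continuous.measurable.comp
        (((measurable_maxOver fun s _ => measurable_noise n s).sub_const _).div_const _)
    have key := integral_le_add_measureReal (P := errLaw w n) (B := B) hm ha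
      (fun _ => ⟨hs.hg.nonneg _, hs.hg.le_one _⟩) ha01 (fun e he => ?_)
    · have h2 := hclt hAne (t0 - slack κ n)
      have h3 := hadd hAne (t0 - slack κ n)
      rw [sub_add_cancel, hspec.1] at h3
      linarith
    · by_cases hsel : (sel e).Nonempty
      · obtain ⟨hgood, hsel2⟩ := hB e he
        obtain ⟨hsub, hoff⟩ := hsel2 hsel
        rw [ha2 e hsel]
        have hcr : t0 < D.crit n (D.resp w n e) (sel e) q := by
          refine lt_of_lt_of_le ?_ (hs.crit_mono hAne hsub (by linarith) hq1)
          rw [hs.lt_crit_iff (by linarith) hq1]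
          have := (abs_le.1 (hgood.boot A hA hAne t0)).2
          rw [hspec.1] at this
          linarith
        -- If the statistic exceeds the critical value, its maximum is attained in `A`, where it is
        -- at most the noise plus `slack`.
        rcases le_or_gt (D.tHat n (D.resp w n e)) (D.crit n (D.resp w n e) (sel e) q) with h | h
        · rw [h1 (sub_nonpos.2 h)]
          exact hs.hg.le_one _
        · refine hs.hg.antitone (div_le_div_of_nonneg_right ?_ hβ.le)
          have : D.tHat n (D.resp w n e) ≤ max (maxOver A (fun s => D.noise w n e s) + slack κ n)
              (D.crit n (D.resp w n e) (sel e) q) := by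
            refine maxOver_le hSne fun s hsS => ?_
            by_cases hsA : s ∈ A
            · refine le_max_of_le_left ((hgood.ratio_le hsS (hnull s hsS)).trans ?_)
              have := le_maxOver (r := fun s => D.noise w n e s) hsA
              linarith
            · exact le_max_of_le_right (hoff s hsS hsA)
          rcases le_max_iff.1 this with h' | h' <;> linarith
      · rw [ha1 e hsel]
        exact hs.hg.le_one _

lemma Setting.signal_nonpos (hs : Setting D c κ Cβ) :
    ∀ᶠ n : ℕ in atTop, ∀ w ∈ nullClass c D.X, ∀ s ∈ D.S n, D.signal w n s ≤ 0 := by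
  obtain ⟨c0, C2, -, -, hwb⟩ := exists_weightBounds hs.hX hs.hH hs.hK
  filter_upwards [hwb] with n hn w hw s hsS
  unfold signal fHat smooth
  exact Finset.sum_nonpos fun j _ =>
    mul_nonpos_of_nonneg_of_nonpos ((hn s.1 s.2.2 (mem_S.1 hsS).1).1 j) (hw.2 _ _)

/-- Asymptotic size of the test with the plug-in critical value. -/
theorem Setting.size_PIA (hs : Setting D c κ Cβ) {α : ℝ} (hα0 : 0 < α) (hα1 : α < 1)
    (hγ0 : ∀ n, 0 < D.γ n) (hγ1 : ∀ n, D.γ n < α / 2) (hV : D.VarianceRate (nullClass c D.X) κ)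
    {η : ℝ} (hη : 0 < η) :
    ∀ᶠ n : ℕ in atTop, ∀ w ∈ nullClass c D.X, 1 - α - η ≤ D.acceptProb α .PIA n w := by
  have hη5 : 0 < η / 5 := by positivity
  filter_upwards [hs.eventually_good (fun w hw => hw.1) hV hη5 hη5, hs.signal_nonpos,
    eventually_abs_integral_noise_sub_le hs.hc hs.hX hs.hH hs.hK hs.hg hs.hKκ hs.hβ hs.hβC hs.hrate
      hη5, hs.eventually_gaussVal_add_le hη5, eventually_S_nonempty hs] with n h1 h2 h3 h4 hne w hw
  rw [hs.acceptProb_eq hα0 hα1 (hγ0 n) (hγ1 n)]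
  -- The selection is constantly `S n`, so no index lies outside `A`.
  have key := hs.le_integral_accept (w := w) (n := n) (q := 1 - α) hη5 (by linarith)
    (A := D.S n) subset_rfl hne (h2 w hw)
    (fun hA t => by
      have := (abs_le.1 (h3 w hw.1 _ subset_rfl hA t 1 (by simp))).1
      simp only [one_mul] at this
      linarith)
    (fun hA t => h4 w hw.1 _ subset_rfl hA t)
    (a := fun e => D.accept α n (D.resp w n e) .PIA)
    ((hs.measurable_accept hα0 hα1 n (hγ0 n) (hγ1 n) .PIA).comp (measurable_resp w n))
    (fun e => hs.accept_mem α n _ _) (sel := fun _ => D.S n) (fun e h => absurd hne h)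
    (fun e _ => rfl) (B := {e | ¬ Good D w κ (η / 5) n e})
    (fun e he => ⟨not_not.1 he, fun _ => ⟨subset_rfl, fun s hsS h => absurd hsS h⟩⟩)
  have := h1 w hw
  linarith

end Design
end CMI


/-! ### Transfer of joint exceedance from two Gaussian copies to noise and Gaussian copy -/

namespace CMI

lemma integral_measureReal_prodMk {Ω Ω' : Type*} [MeasurableSpace Ω] [MeasurableSpace Ω']
    (P : Measure Ω) [IsProbabilityMeasure P] (P' : Measure Ω') [IsProbabilityMeasure P']
    {W : Set (Ω × Ω')} (hW : MeasurableSet W) :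
    Integrable (fun x => P'.real (Prod.mk x ⁻¹' W)) P ∧
      ∫ x, P'.real (Prod.mk x ⁻¹' W) ∂P = (P.prod P').real W := by
  have hm : Measurable fun x => P' (Prod.mk x ⁻¹' W) := measurable_measure_prodMk_left hW
  constructor
  · refine Integrable.of_bound hm.ennreal_toReal.aestronglyMeasurable 1 (ae_of_all _ fun x => ?_)
    rw [Real.norm_eq_abs, abs_of_nonneg measureReal_nonneg]
    exact measureReal_le_one
  · simp only [measureReal_def]
    rw [integral_toReal hm.aemeasurable (ae_of_all _ fun x => measure_lt_top _ _),
      Measure.prod_apply hW]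

/-- If the variables `Z s` of two independent copies often exceed a level at a common index, and
the `X s` are comparable to the `Z s`, then the same holds for `X` and `Z`. -/
lemma mul_measureReal_le_of_comparable {Ω Ω' ι : Type*} [MeasurableSpace Ω] [MeasurableSpace Ω']
    {P : Measure Ω} [IsProbabilityMeasure P] {P' : Measure Ω'} [IsProbabilityMeasure P']
    {J : Finset ι} {X : ι → Ω → ℝ} {Z : ι → Ω' → ℝ} (hX : ∀ s ∈ J, Measurable (X s))
    (hZ : ∀ s ∈ J, Measurable (Z s)) {u v η θ : ℝ} (hη : 0 ≤ η)
    (hcomp : ∀ A ⊆ J, A.Nonempty → P.real {e | ∀ s ∈ A, X s e ≤ u} ≤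
      P'.real {z | ∀ s ∈ A, Z s z ≤ v} + η)
    (hprod : 1 - η ≤ (P'.prod P').real {p | ∃ s ∈ J, v < Z s p.1 ∧ v < Z s p.2}) :
    θ * P.real {e | θ ≤ P'.real {z | ∀ s ∈ J, X s e ≤ u ∨ Z s z ≤ v}} ≤ 2 * η := by
  classical
  let W : Set (Ω' × Ω) := {p | ∀ s ∈ J, X s p.2 ≤ u ∨ Z s p.1 ≤ v}
  let V : Set (Ω' × Ω') := {p | ∀ s ∈ J, Z s p.2 ≤ v ∨ Z s p.1 ≤ v}
  have hW : MeasurableSet W := by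
    have : W = ⋂ s ∈ J, ({p | X s p.2 ≤ u} ∪ {p | Z s p.1 ≤ v}) := by
      ext; simp only [Set.mem_iInter]; rfl
    rw [this]
    exact Finset.measurableSet_biInter _ fun s hs =>
      (measurableSet_le ((hX s hs).comp measurable_snd) measurable_const).union
      (measurableSet_le ((hZ s hs).comp measurable_fst) measurable_const)
  have hV : MeasurableSet V := by
    have : V = ⋂ s ∈ J, ({p | Z s p.2 ≤ v} ∪ {p | Z s p.1 ≤ v}) := by
      ext; simp only [Set.mem_iInter]; rfl
    rw [this]
    exact Finset.measurableSet_biInter _ fun s hs =>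
      (measurableSet_le ((hZ s hs).comp measurable_snd) measurable_const).union
      (measurableSet_le ((hZ s hs).comp measurable_fst) measurable_const)
  obtain ⟨i1, e1⟩ := integral_measureReal_prodMk P' P hW
  obtain ⟨i2, e2⟩ := integral_measureReal_prodMk P' P' hV
  obtain ⟨i3, e3⟩ := integral_measureReal_prodMk P P' (measurable_swap hW)
  have hswap : (P.prod P').real (Prod.swap ⁻¹' W) = (P'.prod P).real W := by
    rw [measureReal_def, measureReal_def, ← Measure.prod_swap (μ := P) (ν := P'),
      Measure.map_apply measurable_swap hW]
  have hpt : ∀ z, P.real (Prod.mk z ⁻¹' W) ≤ P'.real (Prod.mk z ⁻¹' V) + η := by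
    intro z
    -- For a frozen copy `z` both slices concern the same nonrandom set `A` of exceeded indices, to
    -- which the comparison hypothesis applies.
    let A := J.filter fun s => v < Z s z
    have h1 : Prod.mk z ⁻¹' W = {e | ∀ s ∈ A, X s e ≤ u} := by
      ext e
      simp only [A, W, Set.mem_preimage, Set.mem_ofPred_eq, Finset.mem_filter]
      refine forall_congr' fun s => ?_
      rw [and_imp]
      refine imp_congr_right fun _ => ?_
      rw [← not_lt (a := v), or_comm, ← imp_iff_not_or]
    have h2 : Prod.mk z ⁻¹' V = {e | ∀ s ∈ A, Z s e ≤ v} := by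
      ext e
      simp only [A, V, Set.mem_preimage, Set.mem_ofPred_eq, Finset.mem_filter]
      refine forall_congr' fun s => ?_
      rw [and_imp]
      refine imp_congr_right fun _ => ?_
      rw [← not_lt (a := v) (b := Z s z), or_comm, ← imp_iff_not_or]
    rw [h1, h2]
    rcases A.eq_empty_or_nonempty with h | h
    · simp only [h, Finset.notMem_empty, false_imp_iff, implies_true]
      have : {e : Ω | True} = Set.univ := rfl
      rw [this, show {e : Ω' | True} = Set.univ from rfl, probReal_univ, probReal_univ]
      linarith
    · exact hcomp A (Finset.filter_subset _ _) h
  have h3 : (P'.prod P).real W ≤ (P'.prod P').real V + η := by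
    rw [← e1, ← e2]
    have := integral_mono i1 (i2.add (integrable_const η)) hpt
    simp only [Pi.add_apply] at this
    rwa [integral_add i2 (integrable_const η), integral_const, probReal_univ, one_smul] at this
  have h4 : (P'.prod P').real V ≤ η := by
    have hc : {p : Ω' × Ω' | ∃ s ∈ J, v < Z s p.1 ∧ v < Z s p.2} = Vᶜ := by
      ext p
      simp only [V, Set.mem_compl_iff, Set.mem_ofPred_eq, not_forall, not_or, not_le, exists_prop]
      exact exists_congr fun s => and_congr_right fun _ => and_comm
    rw [hc] at hprod
    have := measureReal_add_measureReal_compl (μ := P'.prod P') hV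
    rw [probReal_univ] at this
    linarith
  -- Markov's inequality for the conditional probability given the noise.
  have h5 := mul_meas_ge_le_integral_of_nonneg (μ := P)
    (f := fun e => P'.real (Prod.mk e ⁻¹' (Prod.swap ⁻¹' W)))
    (ae_of_all _ fun _ => measureReal_nonneg) i3 θ
  rw [e3, hswap] at h5
  refine le_trans h5 ?_
  linarith

end CMI


namespace CMI
namespace Design

variable {d : ℕ} {D : Design d} {c : ClassConst} {w : Model d} {κ Cβ : ℝ}

/-! ### Refined moment selection under the null hypothesis -/

lemma Good.sub_le_ratio {η : ℝ} {n : ℕ} {e : Fin n → ℕ → ℝ} (h : Good D w κ η n e) {s : D.Idx n}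
    (hsS : s ∈ D.S n) (hx : |D.signal w n s / D.sdev w n s| ≤ Real.log n ^ 2) :
    D.signal w n s / D.sdev w n s + D.noise w n e s - 2 * slack κ n ≤
      D.fHat n (D.resp w n e) s / D.vHat n (D.resp w n e) s := by
  rw [h.ratio_eq hsS, add_mul]
  have h1 := (abs_le.1 (h.abs_noise_sub_le hsS hx)).1
  have h2 := (abs_le.1 (h.abs_noise_sub_le hsS (h.noise_le s hsS))).1
  linarith

/-- The signal may be far below `-log² n`, beyond the reach of the variance estimates.
Multiplication by a positive factor is monotone, so it is enough to control the upper bound `x`. -/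
lemma Good.ratio_le_of_le {η : ℝ} {n : ℕ} {e : Fin n → ℕ → ℝ} (h : Good D w κ η n e) {s : D.Idx n}
    (hsS : s ∈ D.S n) {x : ℝ} (hx : |x| ≤ Real.log n ^ 2)
    (hle : D.signal w n s / D.sdev w n s + D.noise w n e s ≤ x) :
    D.fHat n (D.resp w n e) s / D.vHat n (D.resp w n e) s ≤ x + slack κ n := by
  rw [h.ratio_eq hsS]
  have h1 := (abs_le.1 (h.abs_noise_sub_le hsS hx)).2
  have h2 := h.sdev_pos hsS
  have h3 := h.vHat_pos s hsS
  have h4 := mul_le_mul_of_nonneg_right hle (div_pos h2 h3).le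
  linarith

/-- Membership in the selected set. -/
lemma Setting.mem_SRMS (hs : Setting D c κ Cβ) {η : ℝ} {n : ℕ} {e : Fin n → ℕ → ℝ}
    (h : Good D w κ η n e) (hSne : (D.S n).Nonempty) (hγ0 : 0 < D.γ n) (hγ1 : D.γ n < 1) {t : ℝ}
    (ht : D.gaussVal w n (D.S n) t + η < 1 - D.γ n) {s : D.Idx n} (hsS : s ∈ D.S n)
    (hle : -2 * (t + D.β n) ≤ D.fHat n (D.resp w n e) s / D.vHat n (D.resp w n e) s) :
    s ∈ D.SRMS n (D.resp w n e) := by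
  have h1 : t < D.critPIA n (D.resp w n e) (1 - D.γ n) := by
    rw [critPIA, hs.lt_crit_iff (by linarith) (by linarith)]
    have := (abs_le.1 (h.boot _ subset_rfl hSne t)).2
    linarith
  simp only [SRMS, Finset.mem_filter]
  exact ⟨hsS, by linarith⟩

lemma measureReal_compl_lt_le {Ω : Type*} [MeasurableSpace Ω] {P : Measure Ω}
    [IsProbabilityMeasure P] {T : Ω → ℝ} (hT : Measurable T) {u δ : ℝ}
    (h : 1 - δ ≤ P.real {ω | T ω < u}) : P.real {ω | u ≤ T ω} ≤ δ := by
  have h1 := measureReal_add_measureReal_compl (μ := P) (measurableSet_lt hT (measurable_const (a := u)))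
  have h2 : {ω | T ω < u}ᶜ = {ω | u ≤ T ω} := by
    ext ω; simp only [Set.mem_compl_iff, Set.mem_ofPred_eq, not_lt]
  rw [h2, probReal_univ] at h1
  linarith

/-- Asymptotic size of the test with refined moment selection. -/
theorem Setting.size_RMS (hs : Setting D c κ Cβ) {α : ℝ} (hα0 : 0 < α) (hα1 : α < 1)
    {γbar : ℝ} (hγbar : γbar < α / 2) (hγ : ∀ n, 0 < D.γ n ∧ D.γ n ≤ γbar)
    (hV : D.VarianceRate (nullClass c D.X) κ) {ζ : ℝ} (hζ : 0 < ζ) :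
    ∀ᶠ n : ℕ in atTop, ∀ w ∈ nullClass c D.X, 1 - α - ζ ≤ D.acceptProb α .RMS n w := by
  have hγ0 : ∀ n, 0 < D.γ n := fun n => (hγ n).1
  have hγ1 : ∀ n, D.γ n < α / 2 := fun n => (hγ n).2.trans_lt hγbar
  -- The larger of the two losses below: `4 η` from `le_integral_accept`, `η`, `3 η` and `5 η` from
  -- `B0`, `B2` and `B1`, and `4 η / (1 - α)` from `B4`.
  obtain ⟨η, hη, hη8, hηα, hηζ⟩ : ∃ η : ℝ, 0 < η ∧ η < 1 / 8 ∧ η ≤ (1 - α) / 2 ∧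
      13 * η + 4 * η / (1 - α) ≤ ζ := by
    have h1α : 0 < 1 - α := by linarith
    refine ⟨min (1 / 9) (min ((1 - α) / 2) (ζ * (1 - α) / 17)), by positivity,
      (min_le_left _ _).trans_lt (by norm_num), (min_le_right _ _).trans (min_le_left _ _), ?_⟩
    set η := min (1 / 9) (min ((1 - α) / 2) (ζ * (1 - α) / 17))
    have h1 : η ≤ ζ * (1 - α) / 17 := (min_le_right _ _).trans (min_le_right _ _)
    have h2 : 4 * η / (1 - α) ≤ 4 * ζ / 17 := by
      rw [div_le_iff₀ h1α]; linarith
    nlinarith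
  obtain ⟨C, hC⟩ := hs.exists_le_crit (q0 := 1 - α) (by linarith)
  obtain ⟨M, hM⟩ := exists_level_prod_exceed hη Cβ
  have hCβ0 : 0 < Cβ := (hs.hβ 0).trans_le (hs.hβC 0)
  set C1 : ℝ := max C 0 with hC1
  have hC10 : 0 ≤ C1 := le_max_right _ _
  set M1 : ℝ := max M 0 with hM1
  have hM10 : 0 ≤ M1 := le_max_right _ _
  -- Large enough that `2 (t + β_n)` exceeds the slackness bound of `J'` plus the noise bound `M1 +
  -- Cβ` when `t > T0`.
  set T0 : ℝ := M1 + Cβ + C1 + 4 with hT0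
  have hbig := tendsto_log_natCast.eventually_ge_atTop (C1 + 1)
  filter_upwards [hs.eventually_good (fun w hw => hw.1) hV hη hη, hs.signal_nonpos,
    eventually_abs_integral_noise_sub_le hs.hc hs.hX hs.hH hs.hK hs.hg hs.hKκ hs.hβ hs.hβC hs.hrate
      hη, hs.eventually_gaussVal_add_le hη, eventually_S_nonempty hs, hs.eventually_noise hη,
    hs.eventually_gaussVal_le (show (0 : ℝ) < 1 / 8 by norm_num) T0,
    hs.eventually_gaussVal_ge hη (Cβ + C1 + 1),
    (tendsto_slack hs.hκ).eventually (ge_mem_nhds (show (0 : ℝ) < 1 / 2 by norm_num)), hbig]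
    with n hgood hnull hclt hadd hSne hnoise hlow hhigh hslack hlogn w hw
  have hwc := hw.1
  have hβ := hs.hβ n
  have hβC := hs.hβC n
  have hsl0 := slack_nonneg (κ := κ) n
  have hg0 := hγ0 n
  have hg1 := hγ1 n
  set q : ℝ := 1 - α + 2 * D.γ n with hq
  have hq0 : 1 - α ≤ q := by linarith
  have hq1 : q < 1 := by linarith
  -- the quantile of the Gaussian analogue
  have hspec := (hs.isContCdf_gaussVal w n (D.S n)).sInf_spec (q := 1 - D.γ n - 2 * η)
    (by linarith) (by linarith)
  set t := sInf {t | D.gaussVal w n (D.S n) t = 1 - D.γ n - 2 * η} with ht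
  have ht0 : T0 < t := by
    rw [← not_le, hspec.2]
    linarith [hlow w hwc]
  have ht1 : t ≤ Real.log n ^ 2 - (Cβ + C1 + 1) := by
    rw [hspec.2]
    linarith [hhigh w hwc (D.S n) subset_rfl hSne]
  have htlt : D.gaussVal w n (D.S n) t + η < 1 - D.γ n := by rw [hspec.1]; linarith
  have hnm : ∀ σ : ℝ, ∀ A : Finset (D.Idx n),
      Measurable fun e => maxOver A (fun s => σ * D.noise w n e s) := fun σ A =>
    measurable_maxOver fun s _ => (measurable_noise n s).const_mul σ
  -- normalized slackness
  let x : D.Idx n → ℝ := fun s => -(D.signal w n s / D.sdev w n s)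
  have hx0 : ∀ s ∈ D.S n, 0 ≤ x s := fun s hsS =>
    neg_nonneg.2 (div_nonpos_of_nonpos_of_nonneg (hnull w hw s hsS) (Real.sqrt_nonneg _))
  have hxabs : ∀ s ∈ D.S n, x s ≤ t + D.β n + C1 + 1 →
      |D.signal w n s / D.sdev w n s| ≤ Real.log n ^ 2 := fun s hsS h => by
    rw [← abs_neg, abs_of_nonneg (hx0 s hsS)]
    exact h.trans (by linarith)
  have hsel : ∀ e, Good D w κ η n e → ∀ s ∈ D.S n, x s ≤ t + D.β n + C1 + 1 →
      x s - D.noise w n e s ≤ 2 * (t + D.β n) - 2 * slack κ n →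
      s ∈ D.SRMS n (D.resp w n e) := fun e he s hsS h1 h2 => by
    refine hs.mem_SRMS he hSne hg0 (by linarith) htlt hsS ?_
    refine le_trans ?_ (he.sub_le_ratio hsS (hxabs s hsS h1))
    simp only [x] at h2
    linarith
  -- the disturbances do not exceed `t + β_n`
  set B2 : Set (Fin n → ℕ → ℝ) :=
    {e | t + D.β n ≤ maxOver (D.S n) (fun s => 1 * D.noise w n e s)} with hB2
  have hB2P : (errLaw w n).real B2 ≤ D.γ n + 3 * η := by
    refine measureReal_compl_lt_le (hnm 1 _) ?_
    have := (hnoise w hwc (D.S n) subset_rfl hSne t 1 (by simp)).2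
    rw [hspec.1] at this
    linarith
  have hB2n : ∀ e, e ∉ B2 → ∀ s ∈ D.S n, D.noise w n e s < t + D.β n := fun e he s hsS => by
    rw [hB2, Set.mem_ofPred_eq, not_le] at he
    have := le_maxOver (r := fun s => 1 * D.noise w n e s) hsS
    linarith
  have hB0P := hgood w hw
  set B0 : Set (Fin n → ℕ → ℝ) := {e | ¬ Good D w κ η n e} with hB0
  have hB0n : ∀ e, e ∉ B0 → Good D w κ η n e := fun e he => not_not.1 he
  rw [hs.acceptProb_eq hα0 hα1 hg0 hg1]
  have hcore : ∀ A ⊆ D.S n, ∀ B : Set (Fin n → ℕ → ℝ),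
      (∀ e, e ∉ B → Good D w κ η n e ∧ ((D.SRMS n (D.resp w n e)).Nonempty →
        A ⊆ D.SRMS n (D.resp w n e) ∧ ∀ s ∈ D.S n, s ∉ A →
        D.fHat n (D.resp w n e) s / D.vHat n (D.resp w n e) s ≤
          D.crit n (D.resp w n e) (D.SRMS n (D.resp w n e)) q)) →
      q - 4 * η - (errLaw w n).real B ≤ ∫ e, D.accept α n (D.resp w n e) .RMS ∂(errLaw w n) := by
    intro A hA B hB
    exact hs.le_integral_accept (w := w) (n := n) (q := q) hη hq1 hA hSne (hnull w hw)
      (fun hAne t => by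
        have := (abs_le.1 (hclt w hwc _ hA hAne t 1 (by simp))).1
        simp only [one_mul] at this
        linarith)
      (fun hAne t => hadd w hwc _ hA hAne t)
      (a := fun e => D.accept α n (D.resp w n e) .RMS)
      ((hs.measurable_accept hα0 hα1 n hg0 hg1 .RMS).comp (measurable_resp w n))
      (fun e => hs.accept_mem α n _ _) (sel := fun e => D.SRMS n (D.resp w n e))
      (fun e h => by simp [accept, h]) (fun e h => by simp [accept, h, hq]) hB
  -- indices that are not far from binding
  classical
  let J' : Finset (D.Idx n) := (D.S n).filter fun s => x s ≤ t + D.β n + C1 + 1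
  have hJ'S : J' ⊆ D.S n := Finset.filter_subset _ _
  -- In the first case negative critical values are harmless, in the second they hardly occur.
  rcases lt_or_ge ((D.gauss n).real {z | ∃ s ∈ J', M < D.zDual w n s z}) η with hcase | hcase
  · -- the disturbances at these indices are bounded
    set B3 : Set (Fin n → ℕ → ℝ) := {e | ∃ s ∈ J', M1 + Cβ ≤ -1 * D.noise w n e s} with hB3
    have hB3P : (errLaw w n).real B3 ≤ 2 * η := by
      rcases J'.eq_empty_or_nonempty with h | h
      · have : B3 = ∅ := by ext e; simp [hB3, h]
        rw [this]; simp; exact hη.le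
      · have h1 : 1 - η ≤ D.gaussVal w n J' M1 := by
          refine le_trans ?_ (hs.hg.measureReal_le_integral (P := D.gauss n)
            (measurable_max_dual (A := J') (D.zDual w n)) hβ M1)
          have hset : MeasurableSet {z | maxOver J' (fun s => D.zDual w n s z) ≤ M1} :=
            measurableSet_le (measurable_max_dual _) measurable_const
          have h2 := measureReal_add_measureReal_compl (μ := D.gauss n) hset
          rw [probReal_univ] at h2
          have h3 : (D.gauss n).real {z | maxOver J' (fun s => D.zDual w n s z) ≤ M1}ᶜ ≤
              (D.gauss n).real {z | ∃ s ∈ J', M < D.zDual w n s z} := by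
            refine measureReal_mono fun z hz => ?_
            rw [Set.mem_compl_iff, Set.mem_ofPred_eq, not_le, lt_maxOver_iff h] at hz
            obtain ⟨s, hsJ, hlt⟩ := hz
            exact ⟨s, hsJ, (le_max_left _ _).trans_lt hlt⟩
          linarith
        have h2 := (hnoise w hwc J' hJ'S h M1 (-1) (by simp)).2
        have h3 : (errLaw w n).real
            {e | M1 + D.β n ≤ maxOver J' (fun s => -1 * D.noise w n e s)} ≤ 2 * η :=
          measureReal_compl_lt_le (hnm (-1) _) (by linarith)
        refine (measureReal_mono ?_).trans h3
        rintro e ⟨s, hsJ, h4⟩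
        have := le_maxOver (r := fun s => -1 * D.noise w n e s) hsJ
        rw [Set.mem_ofPred_eq]
        linarith
    -- All of `J'` is selected. Outside it the slackness exceeds the noise by more than `C1 + 1`, so
    -- the ratios are below `-C1`, which bounds every critical value from below.
    have key := hcore J' hJ'S (B0 ∪ (B2 ∪ B3)) (fun e he => by
      simp only [Set.mem_union, not_or] at he
      obtain ⟨he0, he2, he3⟩ := he
      have hG := hB0n e he0
      refine ⟨hG, fun hne => ⟨fun s hsJ => ?_, fun s hsS hsJ => ?_⟩⟩
      · have h1 : -1 * D.noise w n e s < M1 + Cβ := by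
          by_contra hcon
          exact he3 ⟨s, hsJ, not_lt.1 hcon⟩
        have h2 := (Finset.mem_filter.1 hsJ).2
        refine hsel e hG s (hJ'S hsJ) h2 ?_
        linarith
      · have h1 : t + D.β n + C1 + 1 < x s := by
          by_contra hcon
          exact hsJ (Finset.mem_filter.2 ⟨hsS, not_lt.1 hcon⟩)
        have h2 := hB2n e he2 s hsS
        have h3 : |-(C1 + 1)| ≤ Real.log n ^ 2 := by
          rw [abs_neg, abs_of_nonneg (by linarith)]
          nlinarith
        have h4 := hG.ratio_le_of_le hsS h3 (by simp only [x] at h1; linarith)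
        have h5 := hC n (D.resp w n e) _ hne q hq0 hq1
        have h6 : C ≤ C1 := le_max_left _ _
        linarith)
    have u1 := measureReal_union_le (μ := errLaw w n) B0 (B2 ∪ B3)
    have u2 := measureReal_union_le (μ := errLaw w n) B2 B3
    have : 0 < 4 * η / (1 - α) := div_pos (by linarith) (by linarith)
    linarith
  · -- critical values are rarely negative
    set B1 : Set (Fin n → ℕ → ℝ) := {e | t - slack κ n - slack κ n + D.β n ≤
      maxOver (D.S n) (fun s => -1 * D.noise w n e s)} with hB1
    -- The approximation for the negated noise costs a second `γ_n`. The level is lowered by `slack`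
    -- twice, to match the error in `sub_le_ratio`, and each step costs `η`.
    have hB1P : (errLaw w n).real B1 ≤ D.γ n + 5 * η := by
      refine measureReal_compl_lt_le (hnm (-1) _) ?_
      have h1 := (hnoise w hwc (D.S n) subset_rfl hSne (t - slack κ n - slack κ n) (-1) (by simp)).2
      have h2 := hadd w hwc (D.S n) subset_rfl hSne (t - slack κ n - slack κ n)
      have h3 := hadd w hwc (D.S n) subset_rfl hSne (t - slack κ n)
      rw [sub_add_cancel] at h2 h3
      rw [hspec.1] at h3
      linarith
    -- Noise for which an independent Gaussian copy has a substantial chance of staying below `Cβ`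
    -- at all indices of `J'` where the noise exceeds `-1`. Such indices are selected.
    set B4 : Set (Fin n → ℕ → ℝ) := {e | q - η ≤ (D.gauss n).real
      {z | ∀ s ∈ J', D.noise w n e s ≤ -1 ∨ D.zDual w n s z ≤ Cβ}} with hB4
    have hZlaw : (errLaw w n).real B0 < 1 := by linarith
    -- Any good sample shows that the nonrandom standard deviations are positive, so that `zDual` is
    -- standard normal.
    obtain ⟨e0, he0⟩ : ∃ e, Good D w κ η n e := by
      by_contra hcon
      push Not at hcon
      have : B0 = Set.univ := Set.eq_univ_of_forall hcon
      rw [this, probReal_univ] at hZlaw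
      exact lt_irrefl _ hZlaw
    have hB4P : (errLaw w n).real B4 ≤ 4 * η / (1 - α) := by
      have h1 := mul_measureReal_le_of_comparable (P := errLaw w n) (P' := D.gauss n) (J := J')
        (X := fun s e => D.noise w n e s) (Z := fun s z => D.zDual w n s z) (u := -1) (v := Cβ)
        (η := η) (θ := q - η) (fun s _ => measurable_noise n s)
        (fun s _ => (D.zDual w n s).continuous.measurable) hη.le
        (fun A hA hAne => by
          have h2 := (hnoise w hwc A (hA.trans hJ'S) hAne (-1) 1 (by simp)).1
          have h3 : D.gaussVal w n A (-1) ≤ (D.gauss n).real {z | ∀ s ∈ A, D.zDual w n s z ≤ Cβ} := by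
            refine (hs.hg.integral_le_measureReal (P := D.gauss n)
              (measurable_max_dual (A := A) (D.zDual w n)) hβ (-1)).trans (measureReal_mono ?_)
            intro z hz s hsA
            rw [Set.mem_ofPred_eq] at hz
            have := le_maxOver (r := fun s => D.zDual w n s z) hsA
            linarith
          have h4 : {e | maxOver A (fun s => 1 * D.noise w n e s) ≤ -1} =
              {e | ∀ s ∈ A, D.noise w n e s ≤ -1} := by
            ext e
            simp only [Set.mem_ofPred_eq, maxOver_le_iff hAne, one_mul]
          rw [h4] at h2
          linarith)
        (hM (integral_id_gauss n) (D.zDual w n) J'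
          (fun s hsJ => map_zDual hs.hc hwc (he0.sdev_pos (hJ'S hsJ))) hcase)
      have h2 : 0 ≤ (errLaw w n).real B4 := measureReal_nonneg
      rw [le_div_iff₀ (by linarith)]
      have h3 : (1 - α) / 2 * (errLaw w n).real B4 ≤ (q - η) * (errLaw w n).real B4 :=
        mul_le_mul_of_nonneg_right (by linarith) h2
      linarith
    -- A negative critical value means that the simulated maximum over the selected set, hence over
    -- its subset `N`, is below `β_n` with conditional probability at least `q`. Up to `η` this
    -- passes to the Gaussian copy and puts `e` into `B4`.
    have hcrit : ∀ e, e ∉ B4 → Good D w κ η n e → (D.SRMS n (D.resp w n e)).Nonempty →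
        0 ≤ D.crit n (D.resp w n e) (D.SRMS n (D.resp w n e)) q := by
      intro e he hG hne
      by_contra hneg
      refine he ?_
      rw [hB4, Set.mem_ofPred_eq]
      have h1 : q ≤ D.bootVal n (D.resp w n e) (D.SRMS n (D.resp w n e)) 0 :=
        (hs.crit_le_iff (by linarith) hq1 0).1 (not_le.1 hneg).le
      let N := J'.filter fun s => -1 < D.noise w n e s
      have hNS : N ⊆ D.S n := (Finset.filter_subset _ _).trans hJ'S
      have hNsel : N ⊆ D.SRMS n (D.resp w n e) := fun s hsN => by
        obtain ⟨h2, h3⟩ := Finset.mem_filter.1 hsN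
        obtain ⟨h4, h5⟩ := Finset.mem_filter.1 h2
        exact hsel e hG s h4 h5 (by linarith)
      rcases N.eq_empty_or_nonempty with hN | hN
      · have h2 : {z | ∀ s ∈ J', D.noise w n e s ≤ -1 ∨ D.zDual w n s z ≤ Cβ} = Set.univ := by
          refine Set.eq_univ_of_forall fun z s hsJ => Or.inl ?_
          by_contra hcon
          have : s ∈ N := Finset.mem_filter.2 ⟨hsJ, not_le.1 hcon⟩
          rw [hN] at this
          exact Finset.notMem_empty s this
        rw [h2, probReal_univ]
        linarith
      · have h2 := hs.bootVal_anti (D.resp w n e) hN hNsel 0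
        have h3 := (abs_le.1 (hG.boot N hNS hN 0)).2
        have h4 : D.gaussVal w n N 0 ≤ (D.gauss n).real
            {z | ∀ s ∈ J', D.noise w n e s ≤ -1 ∨ D.zDual w n s z ≤ Cβ} := by
          refine (hs.hg.integral_le_measureReal (P := D.gauss n)
            (measurable_max_dual (A := N) (D.zDual w n)) hβ 0).trans (measureReal_mono ?_)
          intro z hz s hsJ
          rcases le_or_gt (D.noise w n e s) (-1) with h5 | h5
          · exact Or.inl h5
          · right
            have := le_maxOver (r := fun s => D.zDual w n s z)
              (show s ∈ N from Finset.mem_filter.2 ⟨hsJ, h5⟩)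
            rw [Set.mem_ofPred_eq] at hz
            linarith
        linarith
    -- The critical value being nonnegative, the ratios outside `A` need only be nonpositive, so the
    -- smaller slackness bound suffices.
    let J : Finset (D.Idx n) := (D.S n).filter fun s => x s ≤ t + D.β n
    have hJS : J ⊆ D.S n := Finset.filter_subset _ _
    have key := hcore J hJS (B0 ∪ (B2 ∪ (B1 ∪ B4))) (fun e he => by
      simp only [Set.mem_union, not_or] at he
      obtain ⟨he0, he2, he1, he4⟩ := he
      have hG := hB0n e he0
      refine ⟨hG, fun hne => ⟨fun s hsJ => ?_, fun s hsS hsJ => ?_⟩⟩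
      · have h2 := (Finset.mem_filter.1 hsJ).2
        rw [hB1, Set.mem_ofPred_eq, not_le] at he1
        have h3 := le_maxOver (r := fun s => -1 * D.noise w n e s) (hJS hsJ)
        exact hsel e hG s (hJS hsJ) (by linarith) (by linarith)
      · have h1 : t + D.β n < x s := by
          by_contra hcon
          exact hsJ (Finset.mem_filter.2 ⟨hsS, not_lt.1 hcon⟩)
        have h2 := hB2n e he2 s hsS
        refine le_trans ?_ (hcrit e he4 hG hne)
        rw [hG.ratio_eq hsS]
        refine mul_nonpos_of_nonpos_of_nonneg ?_ (div_pos (hG.sdev_pos hsS) (hG.vHat_pos s hsS)).le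
        simp only [x] at h1
        linarith)
    have u1 := measureReal_union_le (μ := errLaw w n) B0 (B2 ∪ (B1 ∪ B4))
    have u2 := measureReal_union_le (μ := errLaw w n) B2 (B1 ∪ B4)
    have u3 := measureReal_union_le (μ := errLaw w n) B1 B4
    linarith

end Design
end CMI


namespace CMI
namespace Design

variable {d : ℕ} {D : Design d} {c : ClassConst} {w : Model d} {κ Cβ : ℝ}

/-! ### Consistency -/

lemma exists_lt_of_mem_altClass {ρ : ℝ} (hρ : 0 < ρ) {X : ℕ → EuclideanSpace ℝ (Fin d)}
    (hw : w ∈ altClass c X ρ) : ∃ i m, ρ / 2 < w.f m (X i) := by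
  have h1 : ENNReal.ofReal (ρ / 2) < rho X w :=
    ((ENNReal.ofReal_lt_ofReal_iff hρ).2 (half_lt_self hρ)).trans_le hw.2
  simp only [rho, lt_iSup_iff] at h1
  obtain ⟨i, m, h⟩ := h1
  exact ⟨i, m, (ENNReal.ofReal_lt_ofReal_iff_of_nonneg (by positivity)).1 h⟩

/-- Under a fixed alternative some smoothed regression function is bounded away from zero, at a
fixed bandwidth value. -/
lemma Setting.exists_signal_ge (hs : Setting D c κ Cβ) {ρ : ℝ} (hρ : 0 < ρ)
    (hw : w ∈ altClass c D.X ρ) : ∃ k : ℕ, ∀ᶠ n : ℕ in atTop, ∃ s ∈ D.S n, s.2.2 = k ∧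
      ρ / 2 ≤ D.signal w n s := by
  obtain ⟨i0, m0, h0⟩ := exists_lt_of_mem_altClass hρ hw
  obtain ⟨c0, C2, -, -, hwb⟩ := exists_weightBounds hs.hX hs.hH hs.hK
  have hcont : Continuous (w.f m0) := (hw.1.2.1 m0).1.1.continuous
  obtain ⟨r, hr, hball⟩ := Metric.eventually_nhds_iff.1
    (hcont.continuousAt.eventually (lt_mem_nhds h0))
  -- A test point lies within two bandwidths of the violation and its kernel reaches one further, so
  -- the whole window stays in the ball where the function exceeds `ρ / 2`.
  obtain ⟨k, hk⟩ : ∃ k, D.bw k < r / 3 := by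
    obtain ⟨k, hk⟩ := exists_pow_lt_of_lt_one
      (show 0 < r / 3 / D.hmax from div_pos (by positivity) hs.hH.1) hs.hH.2.2.1
    refine ⟨k, ?_⟩
    rwa [lt_div_iff₀ hs.hH.1, mul_comm] at hk
  refine ⟨k, ?_⟩
  filter_upwards [hwb, hs.hH.tendsto_depth.eventually_ge_atTop k, eventually_gt_atTop i0,
    hs.hcover m0] with n hn hdep hi hm
  obtain ⟨j, hj, hij⟩ := (hs.hI n k hdep).2 ⟨i0, hi⟩
  refine ⟨(j, ⟨m0, hm⟩, k), mem_S.2 ⟨hdep, hj⟩, rfl, ?_⟩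
  obtain ⟨w0, -, wsum, wzero, -⟩ := hn j k hdep
  calc ρ / 2 = ∑ l, D.weight n (D.bw k) j l * (ρ / 2) := by rw [← Finset.sum_mul, wsum, one_mul]
    _ ≤ ∑ l, D.weight n (D.bw k) j l * w.f m0 (D.X l) := by
        refine Finset.sum_le_sum fun l _ => ?_
        by_cases hl : D.bw k < ‖D.X j - D.X l‖
        · rw [wzero l hl, zero_mul, zero_mul]
        · refine mul_le_mul_of_nonneg_left (le_of_lt ?_) (w0 l)
          refine hball ?_
          rw [dist_eq_norm, norm_sub_rev]
          have := norm_sub_le_norm_sub_add_norm_sub (D.X i0) (D.X j) (D.X l)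
          have h2 : ‖D.X i0 - D.X j‖ ≤ 2 * D.bw k := hij
          push Not at hl
          linarith

/-- The bandwidth is fixed, so standard deviations are of order `n^(-1/2)` and the normalized signal
outgrows every power of the logarithm. -/
lemma Setting.eventually_signal_div_ge (hs : Setting D c κ Cβ) {ρ : ℝ} (hρ : 0 < ρ)
    (hw : w ∈ altClass c D.X ρ) (C : ℝ) : ∀ᶠ n : ℕ in atTop, ∃ s ∈ D.S n,
      C * Real.log n ^ 2 + C ≤ D.signal w n s / D.sdev w n s := by
  obtain ⟨k, hk⟩ := hs.exists_signal_ge hρ hw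
  obtain ⟨Cs, hCs, hsd⟩ := exists_sdevBounds hs.hc hs.hX hs.hH hs.hK
  have hb := hs.hH.bw_pos k
  set a : ℝ := ρ / 2 / Real.sqrt (Cs / D.bw k ^ d) with ha
  have ha0 : 0 < a := by positivity
  have h1 : Tendsto (fun n : ℕ => C * ((n : ℝ) ^ (-(1 / 2 : ℝ)) * Real.log n ^ 2) +
      C * ((n : ℝ) ^ (-(1 / 2 : ℝ)) * Real.log n ^ 0)) atTop (𝓝 (C * 0 + C * 0)) :=
    ((tendsto_rpow_mul_log_pow (by norm_num) 2).const_mul C).add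
      ((tendsto_rpow_mul_log_pow (by norm_num) 0).const_mul C)
  rw [mul_zero, add_zero] at h1
  filter_upwards [hk, hsd, h1.eventually (gt_mem_nhds ha0), eventually_gt_atTop 0]
    with n ⟨s, hsS, hsk, hsig⟩ hn hsmall hn0
  refine ⟨s, hsS, ?_⟩
  have hnR : (0 : ℝ) < n := by exact_mod_cast hn0
  obtain ⟨b1, -, -, b4⟩ := hn w hw.1 s hsS
  rw [hsk] at b4
  have hsn : 0 < Real.sqrt n := Real.sqrt_pos.2 hnR
  have e1 : (n : ℝ) ^ (-(1 / 2 : ℝ)) = (Real.sqrt n)⁻¹ := by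
    rw [Real.rpow_neg hnR.le, Real.sqrt_eq_rpow]
  rw [e1, pow_zero, mul_one] at hsmall
  have h2 : D.sdev w n s ≤ Real.sqrt (Cs / D.bw k ^ d) / Real.sqrt n := by
    rw [← Real.sqrt_div (by positivity)]
    refine Real.le_sqrt_of_sq_le (b4.trans (le_of_eq ?_))
    rw [div_div, mul_comm]
  have h3 : a * Real.sqrt n ≤ D.signal w n s / D.sdev w n s := by
    rw [le_div_iff₀ b1]
    refine le_trans ?_ hsig
    calc a * Real.sqrt n * D.sdev w n s
        ≤ a * Real.sqrt n * (Real.sqrt (Cs / D.bw k ^ d) / Real.sqrt n) := by gcongr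
      _ = ρ / 2 := by rw [ha]; field_simp
  refine le_trans ?_ h3
  have h4 : C * Real.log n ^ 2 + C =
      (C * ((Real.sqrt n)⁻¹ * Real.log n ^ 2) + C * (Real.sqrt n)⁻¹) * Real.sqrt n := by
    field_simp
  rw [h4]
  exact mul_le_mul_of_nonneg_right hsmall.le hsn.le

/-- Consistency against fixed alternatives. -/
theorem Setting.consistency (hs : Setting D c κ Cβ) {α : ℝ} (hα0 : 0 < α) (hα1 : α < 1)
    {γbar : ℝ} (hγbar : γbar < α / 2) (hγ : ∀ n, 0 < D.γ n ∧ D.γ n ≤ γbar)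
    {ρ : ℝ} (hρ : 0 < ρ) (hw : w ∈ altClass c D.X ρ) (hV : D.VarianceRate {w} κ) (P : Method) :
    Tendsto (fun n : ℕ => D.acceptProb α P n w) atTop (𝓝 0) := by
  have hγ0 : ∀ n, 0 < D.γ n := fun n => (hγ n).1
  have hγ1 : ∀ n, D.γ n < α / 2 := fun n => (hγ n).2.trans_lt hγbar
  have hCβ0 : 0 < Cβ := (hs.hβ 0).trans_le (hs.hβC 0)
  rw [Metric.tendsto_nhds]
  intro ζ hζ
  filter_upwards [hs.eventually_good (𝒲 := {w}) (Set.singleton_subset_iff.2 hw.1) hV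
      (show (0 : ℝ) < 1 / 8 by norm_num) (half_pos hζ),
    -- The ratio of standard deviations may halve the signal and the noise may take away `log² n`;
    -- what remains has to exceed `log² n + β_n`.
    hs.eventually_signal_div_ge hρ hw (3 + 2 * Cβ),
    hs.eventually_crit_le (show 1 - α + 2 * γbar < 1 by linarith), eventually_S_nonempty hs,
    hs.eventually_gaussVal_le (show (0 : ℝ) < 1 / 8 by norm_num) 0]
    with n hgood ⟨s, hsS, hsig⟩ hcrit hSne hlow
  have hβ := hs.hβ n
  have hβC := hs.hβC n
  have hg0 := hγ0 n
  have hg1 := hγ1 n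
  have hgb := (hγ n).2
  have hzero : ∀ e, e ∉ {e | ¬ Good D w κ (1 / 8) n e} → D.accept α n (D.resp w n e) P ≤ 0 := by
    intro e he
    have hG : Good D w κ (1 / 8) n e := not_not.1 he
    have hratio : Real.log n ^ 2 + D.β n ≤
        D.fHat n (D.resp w n e) s / D.vHat n (D.resp w n e) s := by
      rw [hG.ratio_eq hsS]
      have h1 : 1 / 2 ≤ D.sdev w n s / D.vHat n (D.resp w n e) s := by
        rw [le_div_iff₀ (hG.vHat_pos s hsS)]
        linarith [hG.vHat_le s hsS]
      have h2 := (abs_le.1 (hG.noise_le s hsS)).1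
      have h3 : 2 * (Real.log n ^ 2 + D.β n) ≤ D.signal w n s / D.sdev w n s + D.noise w n e s := by
        have : 0 ≤ Cβ * Real.log n ^ 2 := by positivity
        linarith
      have h4 : 0 ≤ Real.log n ^ 2 + D.β n := by positivity
      calc Real.log n ^ 2 + D.β n = 2 * (Real.log n ^ 2 + D.β n) * (1 / 2) := by ring
        _ ≤ _ := mul_le_mul h3 h1 (by norm_num) (by linarith)
    have htHat : Real.log n ^ 2 + D.β n ≤ D.tHat n (D.resp w n e) :=
      hratio.trans
        (le_maxOver (r := fun s => D.fHat n (D.resp w n e) s / D.vHat n (D.resp w n e) s) hsS)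
    have hg : ∀ (A : Finset (D.Idx n)), A ⊆ D.S n → A.Nonempty → ∀ q, 0 < q → q ≤ 1 - α + 2 * γbar →
        D.g0 ((D.tHat n (D.resp w n e) - D.crit n (D.resp w n e) A q) / D.β n) ≤ 0 := by
      intro A hA hAne q hq0 hq1
      refine (hs.hg.2.2.2 _ ?_).le
      rw [one_le_div hβ]
      linarith [hcrit (D.resp w n e) A hA hAne q hq0 hq1]
    cases P with
    | PIA => exact hg (D.S n) subset_rfl hSne (1 - α) (by linarith) (by linarith)
    | RMS =>
      -- The critical value of the pretest is positive, because the Gaussian maximum over `S n`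
      -- tends to infinity; hence the selection threshold is negative.
      have hmem : s ∈ D.SRMS n (D.resp w n e) := by
        refine hs.mem_SRMS hG hSne hg0 (by linarith) (t := 0) (by linarith [hlow w hw.1]) hsS ?_
        have : 0 ≤ Real.log n ^ 2 := by positivity
        linarith
      have hne : (D.SRMS n (D.resp w n e)).Nonempty := ⟨s, hmem⟩
      simp only [accept, hne, if_true]
      exact hg _ (Finset.filter_subset _ _) hne _ (by linarith) (by linarith)
  have hmeas := (hs.measurable_accept hα0 hα1 n hg0 hg1 P).comp (measurable_resp (D := D) w n)
  have h1 := integral_le_add_measureReal (P := errLaw w n)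
    (f := fun e => D.accept α n (D.resp w n e) P) (g := fun _ => 0) hmeas measurable_const
    (fun e => hs.accept_mem α n _ _) (fun _ => ⟨le_rfl, zero_le_one⟩) hzero
  have h2 : 0 ≤ D.acceptProb α P n w := integral_nonneg fun y => (hs.accept_mem α n y P).1
  have h3 : D.acceptProb α P n w ≤ ζ / 2 := by
    rw [hs.acceptProb_eq hα0 hα1 hg0 hg1]
    simp only [integral_zero, zero_add] at h1
    exact h1.trans (hgood w rfl)
  rw [Real.dist_eq, sub_zero, abs_of_nonneg h2]
  linarith

end Design
end CMI


/-! ### Size and consistency assembled -/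

theorem corollary2 {d : ℕ} (hd : 0 < d) (D : CMI.Design d) (c : CMI.ClassConst)
    (hc : c.Admissible)
    (hX : D.DesignPointsCond) (hH : D.BandwidthCond) (hK : D.KernelCond)
    (hI : D.TestPointsCond) (hg : D.TestFunctionCond) (hS : D.EstimatorCond)
    -- the inequalities in use eventually include each of the infinitely many ones
    (hcover : ∀ m : ℕ, ∀ᶠ n in atTop, m ∈ D.ineq n)
    -- nominal size, and level of the pretest
    (α : ℝ) (hα0 : 0 < α) (hα1 : α < 1)
    (γbar : ℝ) (hγbar : γbar < α / 2) (hγ : ∀ n, 0 < D.γ n ∧ D.γ n ≤ γbar)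
    -- rates
    (κ : ℝ) (hκ : 0 < κ)
    (hKκ : Tendsto (fun n : ℕ => D.numIneq n * Real.log n / (n : ℝ) ^ (κ / 4)) atTop (𝓝 0))
    (hβ : ∀ n, 0 < D.β n) (Cβ : ℝ) (hβC : ∀ n, D.β n ≤ Cβ)
    (hrate : Tendsto (fun n : ℕ => (D.numIneq n : ℝ) ^ 6 * Real.log n ^ 4 /
      (D.β n ^ 10 * D.hmin n ^ (3 * d) * n)) atTop (𝓝 0)) :
    -- asymptotic size, uniformly over the null models
    (D.VarianceRate (CMI.nullClass c D.X) κ → ∀ P : CMI.Method, ∀ η : ℝ, 0 < η →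
      ∀ᶠ n : ℕ in atTop, ∀ w ∈ CMI.nullClass c D.X, 1 - α - η ≤ D.acceptProb α P n w) ∧
    -- consistency against every fixed alternative
    (∀ ρ : ℝ, 0 < ρ → ∀ w ∈ CMI.altClass c D.X ρ, D.VarianceRate {w} κ →
      ∀ P : CMI.Method, Tendsto (fun n : ℕ => D.acceptProb α P n w) atTop (𝓝 0)) := by
  have hs : D.Setting c κ Cβ :=
    ⟨hd, hc, hX, hH, hK, hI, hg, hS, hcover, hκ, hKκ, hβ, hβC, hrate⟩
  refine ⟨fun hV P η hη => ?_, fun ρ hρ w hw hV P =>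
    hs.consistency hα0 hα1 hγbar hγ hρ hw hV P⟩
  cases P with
  | PIA => exact hs.size_PIA hα0 hα1 (fun n => (hγ n).1) (fun n => (hγ n).2.trans_lt hγbar) hV hη
  | RMS => exact hs.size_RMS hα0 hα1 hγbar hγ hV hη
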